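/- **Setting.** Let $p>2$ be prime and $\ell=\frac{p-1}{2}$. The space of shapes of rank $r$ lattices is $\mathcal S_r=\mathrm{GL}_r(\mathbf Z)\backslash\mathcal G/\mathbf R^\times$, where $\mathcal G$ is the set of positive definite real symmetric $r\times r$ matrices, $g\cdot G=gGg^T$ and $G\cdot t=t^2G$. The shape of a lattice is the class of the Gram matrix of a $\mathbf Z$-basis. A shape is *orthorhombic* if it is represented by a diagonal matrix, and *ordinary* if the lattice has no isometries other than $\pm1$. The dimension of a subset of $\mathcal S_r$ is the Hausdorff dimension of its preimage in the manifold of matrices of determinant $1$ in $\mathcal G$ (of which $\mathcal S_r$ is the quotient by the discrete group $\mathrm{GL}_r(\mathbf Z)$). For a number field $K$ of degree $n$, with $j:K\to\mathbf C^n$, $j(x)=(\sigma(x))_\sigma$, the shape $\mathrm{sh}(K)\in\mathcal S_{n-1}$ is the shape of the lattice $j(\mathcal O_K^\perp)$, where $\mathcal O_K^\perp=\{nx-\mathrm{tr}(x):x\in\mathcal O_K\}$. A *pure field of degree $p$* is a number field $K$ of degree $p$ generated over $\mathbf Q$ by a root of $x^p-m$, with $m\in\mathbf Z$ $p$-th power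 free. It is of *Type I* ($p$ wildly ramified) if $p^p\mid\Delta_K$, and of *Type II* ($p$ tamely ramified) if $p\mid \Delta_K$ and $p^p\nmid\Delta_K$. Let $\mathcal T\subseteq \mathrm{SL}_{p-1}(\mathbf R)$ be the torus of the matrices $\mathrm{diag}(x_1,\dots,x_\ell,x_\ell^{-1},\dots,x_1^{-1})$, $x_i\in\mathbf R^\times$, and let $\mathcal O=\{t\,I\,t^T:t\in\mathcal T\}$ be its orbit of the identity matrix. Let $\mathscr S_I\subseteq\mathcal S_{p-1}$ be the set of shapes represented by the elements of $\mathcal O$. Let $\mathscr S_{II}\subseteq\mathcal S_{p-1}$ be the set of shapes represented by the matrices $CDC^T$ with $D\in\mathcal O$ and $C$ one of the following finitely many matrices $C_u$, $u=(u_1,\dots,u_{p-1})\in(\mathbf F_p^\times)^{p-1}$: the first row of $C_u$ is $\frac1p(c_1,\dots,c_{p-1})$, where $c_k\in\{1,\dots,p-1\}$ represents $\bigl(\prod_i u_i^{i}\bigr)^{-(k-1)}\prod_i u_i^{\lfloor ik/p\rfloor}$ (so $c_1=1$), and the other rows are those of the identity matrix. **Theorem A (Space of shapes).** The sets $\mathscr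 S_I$ and $\mathscr S_{II}$ have dimension $\ell$. Let $K$ be a pure field of degree $p$. Then $K$ is of Type I or of Type II. - If $K$ is of Type I, then $\mathrm{sh}(K)\in\mathscr S_I$, and $\mathrm{sh}(K)$ is orthorhombic. - If $K$ is of Type II, then $\mathrm{sh}(K)\in\mathscr S_{II}$, and $\mathrm{sh}(K)$ is ordinary and not orthorhombic. More explicitly, write $K=\mathbf Q(\theta)$ with $\theta^p=m=\prod_{i=1}^{p-1}a_i^i$, where the $a_i$ are squarefree pairwise coprime integers. Let $\alpha$ be the real $p$-th root of $m$ and $\gamma_k=\alpha^k/\prod_{i=1}^{p-1}a_i^{\lfloor ik/p\rfloor}$. - If $K$ is of Type I, then $\mathrm{sh}(K)$ is represented by $\mathrm{diag}(\gamma_1^2,\dots,\gamma_{p-1}^2)$, and this matrix is $\bigl|\prod_i a_i\bigr|$ times an element of the torus orbit $\mathcal O$. - If $K$ is of Type II, then $p\nmid m$, and for every integer $\epsilon$ with $m\epsilon\equiv1\pmod{p^2}$, $\mathrm{sh}(K)$ is represented by the symmetric matrix with $(1,1)$ entry $\frac1p\sum_{k=1}^{p-1}\epsilon^{2(k-1)}\gamma_1^{2k}$,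 with $(1,k)$ and $(k,1)$ entries $\epsilon^{k-1}\gamma_k\gamma_1^k$ and $(k,k)$ entries $p\gamma_k^2$ for $2\le k\le p-1$, and all other entries $0$. -/

import Mathlib

open Matrix Module NumberField

/-! ### The space of shapes -/

/-- The set `𝒢` of positive definite real symmetric `r × r` matrices. -/
def GramMatrix (r : ℕ) : Type := {G : Matrix (Fin r) (Fin r) ℝ // G.PosDef}

/-- An element of `GL_r(ℤ)`, seen as a real matrix. -/
noncomputable def glReal {r : ℕ} (g : GL (Fin r) ℤ) : Matrix (Fin r) (Fin r) ℝ :=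
  (g : Matrix (Fin r) (Fin r) ℤ).map (Int.castRingHom ℝ)

theorem glReal_one {r : ℕ} : glReal (1 : GL (Fin r) ℤ) = 1 := by
  simp [glReal]

theorem glReal_mul {r : ℕ} (g h : GL (Fin r) ℤ) : glReal (g * h) = glReal g * glReal h := by
  rw [glReal, Units.val_mul, Matrix.map_mul]; rfl

/-- `G` and `H` have the same class in `GL_r(ℤ) \ 𝒢 / ℝˣ`:  `H = t² g G gᵀ`. -/
def gramSetoid (r : ℕ) : Setoid (GramMatrix r) where
  r G H := ∃ (g : GL (Fin r) ℤ) (t : ℝ), t ≠ 0 ∧ H.1 = t ^ 2 • (glReal g * G.1 * (glReal g)ᵀ)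
  iseqv :=
    { refl := fun G => ⟨1, 1, one_ne_zero, by simp [glReal_one]⟩
      symm := by
        rintro G H ⟨g, t, ht, h⟩
        refine ⟨g⁻¹, t⁻¹, inv_ne_zero ht, ?_⟩
        have e1 : glReal g⁻¹ * glReal g = 1 := by rw [← glReal_mul, inv_mul_cancel, glReal_one]
        have e2 : (glReal g)ᵀ * (glReal g⁻¹)ᵀ = 1 := by
          rw [← Matrix.transpose_mul, e1, Matrix.transpose_one]
        rw [h, Matrix.mul_smul, Matrix.smul_mul, smul_smul, ← mul_pow, inv_mul_cancel₀ ht, one_pow,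
          one_smul]
        calc G.1 = (glReal g⁻¹ * glReal g) * G.1 * ((glReal g)ᵀ * (glReal g⁻¹)ᵀ) := by
              rw [e1, e2, Matrix.one_mul, Matrix.mul_one]
          _ = _ := by simp only [Matrix.mul_assoc]
      trans := by
        rintro G H I ⟨g, t, ht, h⟩ ⟨g', t', ht', h'⟩
        refine ⟨g' * g, t' * t, mul_ne_zero ht' ht, ?_⟩
        rw [h', h, glReal_mul, Matrix.transpose_mul, Matrix.mul_smul, Matrix.smul_mul, smul_smul,
          ← mul_pow]
        simp only [Matrix.mul_assoc] }

/-- The space of shapes of rank `r` lattices, `S_r = GL_r(ℤ) \ 𝒢 / ℝˣ`. -/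
def ShapeSpace (r : ℕ) : Type := Quotient (gramSetoid r)

/-- The shape represented by a Gram matrix. -/
def ShapeSpace.mk {r : ℕ} (G : Matrix (Fin r) (Fin r) ℝ) (hG : G.PosDef) : ShapeSpace r :=
  Quotient.mk (gramSetoid r) ⟨G, hG⟩

/-- The shape `s` is represented by the matrix `G`. -/
def ShapeSpace.IsRepresentedBy {r : ℕ} (s : ShapeSpace r) (G : Matrix (Fin r) (Fin r) ℝ) : Prop :=
  ∃ hG : G.PosDef, s = ShapeSpace.mk G hG

/-- The dimension of a set `S` of shapes of rank `r` lattices. Every shape has representatives of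
determinant `1`, and `S_r` is the quotient of the manifold of these by the discrete group
`GL_r(ℤ)`; the dimension of `S` is the Hausdorff dimension of its preimage in that manifold. -/
noncomputable def shapeDim {r : ℕ} (S : Set (ShapeSpace r)) : ENNReal :=
  dimH {G : Fin r → Fin r → ℝ | (Matrix.of G).det = 1 ∧ ∃ s ∈ S, s.IsRepresentedBy (Matrix.of G)}

/-- Orthorhombic shape: shape of a lattice with a basis of pairwise orthogonal vectors. -/
def ShapeSpace.IsOrthorhombic {r : ℕ} (s : ShapeSpace r) : Prop :=
  ∃ d : Fin r → ℝ, s.IsRepresentedBy (Matrix.diagonal d)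

/-- Ordinary shape: shape of a lattice that has no isometries except `1` and `-1`. -/
def ShapeSpace.IsOrdinary {r : ℕ} (s : ShapeSpace r) : Prop :=
  ∀ G : Matrix (Fin r) (Fin r) ℝ, s.IsRepresentedBy G →
    ∀ g : GL (Fin r) ℤ, glReal g * G * (glReal g)ᵀ = G → g = 1 ∨ g = -1

/-! ### The shape of a lattice in a real inner product space -/

/-- `L` is a lattice of rank `r`: the `ℤ`-span of `r` vectors that are independent over `ℝ`. -/
def IsLatticeOfRank {V : Type*} [NormedAddCommGroup V] [InnerProductSpace ℝ V]
    (L : Submodule ℤ V) (r : ℕ) : Prop :=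
  ∃ b : Basis (Fin r) ℤ L, LinearIndependent ℝ (fun i => (b i : V))

/-- The shape of a lattice: the class of the Gram matrix of a `ℤ`-basis. -/
noncomputable def latticeShape {V : Type*} [NormedAddCommGroup V] [InnerProductSpace ℝ V]
    {L : Submodule ℤ V} {r : ℕ} (hL : IsLatticeOfRank L r) : ShapeSpace r :=
  ShapeSpace.mk (Matrix.gram ℝ fun i => (hL.choose i : V))
    (Matrix.posDef_gram_of_linearIndependent hL.choose_spec)

/-- The shape does not depend on the basis. -/
theorem latticeShape_isRepresentedBy {V : Type*} [NormedAddCommGroup V] [InnerProductSpace ℝ V]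
    {L : Submodule ℤ V} {r : ℕ} (hL : IsLatticeOfRank L r) (b : Basis (Fin r) ℤ L) :
    (latticeShape hL).IsRepresentedBy (Matrix.gram ℝ fun i => (b i : V)) := by
  classical
  set c := hL.choose with hc
  let g : GL (Fin r) ℤ := ⟨(c.toMatrix b)ᵀ, (b.toMatrix c)ᵀ,
    by rw [← Matrix.transpose_mul, Basis.toMatrix_mul_toMatrix_flip, Matrix.transpose_one],
    by rw [← Matrix.transpose_mul, Basis.toMatrix_mul_toMatrix_flip, Matrix.transpose_one]⟩
  have hb : ∀ i, (b i : V) = ∑ k, (glReal g i k) • (c k : V) := by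
    intro i
    have h1 : (b i : V) = ((∑ k, c.toMatrix b k i • c k : L) : V) := by
      rw [Basis.sum_toMatrix_smul_self]
    rw [h1, Submodule.coe_sum]
    refine Finset.sum_congr rfl fun k _ => ?_
    simp [glReal, g, Int.cast_smul_eq_zsmul]
  have key : Matrix.gram ℝ (fun i => (b i : V)) =
      glReal g * Matrix.gram ℝ (fun i => (c i : V)) * (glReal g)ᵀ := by
    ext i j
    rw [Matrix.gram_apply, hb i, hb j]
    simp only [Matrix.mul_apply, Matrix.gram_apply, Matrix.transpose_apply, sum_inner, inner_sum,
      real_inner_smul_left, real_inner_smul_right, Finset.sum_mul]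
    refine Finset.sum_congr rfl fun k _ => Finset.sum_congr rfl fun l _ => ?_
    ring
  have hunit : IsUnit (glReal g) :=
    ⟨⟨glReal g, glReal g⁻¹, by rw [← glReal_mul, mul_inv_cancel, glReal_one],
      by rw [← glReal_mul, inv_mul_cancel, glReal_one]⟩, rfl⟩
  have hpd : (Matrix.gram ℝ fun i => (b i : V)).PosDef := by
    rw [key, ← Matrix.conjTranspose_eq_transpose_of_trivial]
    exact (Matrix.posDef_gram_of_linearIndependent hL.choose_spec).mul_mul_conjTranspose_same
      (Matrix.vecMul_injective_of_isUnit hunit)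
  exact ⟨hpd, Quotient.sound ⟨g, 1, one_ne_zero, by rw [one_pow, one_smul]; exact key⟩⟩

/-! ### The shape of a number field -/

section NumberFieldShape

variable (K : Type*) [Field K] [NumberField K]

/-- The Minkowski embedding `j(α) = (σ(α))_σ`, into the complex vectors indexed by the embeddings
of `K` in `ℂ`, with the Euclidean norm. -/
noncomputable def minkowskiMap : K →ₗ[ℤ] EuclideanSpace ℂ (K →+* ℂ) :=
  AddMonoidHom.toIntLinearMap
    { toFun := fun x => WithLp.toLp 2 (fun σ : K →+* ℂ => σ x)
      map_zero' := by ext σ; simp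
      map_add' := fun x y => by ext σ; simp }

/-- The map `α ↦ α^⊥ = n α - tr(α)` on the ring of integers. -/
noncomputable def perpMap : 𝓞 K →ₗ[ℤ] K :=
  AddMonoidHom.toIntLinearMap
    { toFun := fun x => (finrank ℚ K : K) * (x : K) - algebraMap ℚ K (Algebra.trace ℚ K (x : K))
      map_zero' := by simp
      map_add' := fun x y => by simp; ring }

/-- The lattice `j(𝓞_K^⊥)`. -/
noncomputable def perpLattice : Submodule ℤ (EuclideanSpace ℂ (K →+* ℂ)) :=
  LinearMap.range ((minkowskiMap K).comp (perpMap K))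

theorem minkowskiMap_injective : Function.Injective (minkowskiMap K) := by
  intro x y h
  obtain ⟨σ⟩ := (inferInstance : Nonempty (K →+* ℂ))
  have : (minkowskiMap K x) σ = (minkowskiMap K y) σ := by rw [h]
  exact σ.injective this

theorem minkowskiMap_linearIndependent {ι : Type*} {v : ι → K} (hv : LinearIndependent ℤ v) :
    LinearIndependent ℝ (fun i => minkowskiMap K (v i)) := by
  classical
  have hv' : LinearIndependent ℚ v := (LinearIndependent.iff_fractionRing ℤ ℚ).1 hv
  let B := Basis.sumExtend hv'
  have : Finite (ι ⊕ Basis.sumExtendIndex hv') := Module.Finite.finite_basis B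
  have := Fintype.ofFinite (ι ⊕ Basis.sumExtendIndex hv')
  have hspan : ⊤ ≤ Submodule.span ℂ (Set.range fun i => canonicalEmbedding K (B i)) := by
    rw [← (canonicalEmbedding.latticeBasis K).span_eq, Submodule.span_le]
    rintro _ ⟨i, rfl⟩
    rw [canonicalEmbedding.latticeBasis_apply, ← B.sum_repr (integralBasis K i), map_sum]
    refine Submodule.sum_mem _ fun k _ => ?_
    have : canonicalEmbedding K (B.repr (integralBasis K i) k • B k) =
        ((B.repr (integralBasis K i) k : ℚ) : ℂ) • canonicalEmbedding K (B k) := by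
      ext σ
      simp [Algebra.smul_def]
    rw [this]
    exact Submodule.smul_mem _ _ (Submodule.subset_span ⟨k, rfl⟩)
  have hind : LinearIndependent ℂ (fun i => canonicalEmbedding K (B i)) := by
    refine linearIndependent_of_top_le_span_of_card_eq_finrank hspan ?_
    rw [← Module.finrank_eq_card_basis B, Module.finrank_fintype_fun_eq_card,
      NumberField.Embeddings.card]
  have h2 : LinearIndependent ℂ (fun i => canonicalEmbedding K (v i)) := by
    have h3 := hind.comp (Sum.inl : ι → _) Sum.inl_injective
    have h4 : ∀ i, B (Sum.inl i) = v i := fun i => by 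
      simp only [B, Basis.sumExtend, Basis.reindex_apply, Basis.extend_apply_self]
      rfl
    simpa [Function.comp_def, h4] using h3
  have h5 : LinearIndependent ℂ (fun i => minkowskiMap K (v i)) :=
    h2.map' (WithLp.linearEquiv 2 ℂ ((K →+* ℂ) → ℂ)).symm.toLinearMap (LinearEquiv.ker _)
  exact h5.restrict_scalars' ℝ

theorem perpMap_ker : LinearMap.ker (perpMap K) = Submodule.span ℤ {(1 : 𝓞 K)} := by
  have hn : (finrank ℚ K : ℚ) ≠ 0 := by exact_mod_cast (finrank_pos (R := ℚ) (M := K)).ne'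
  ext x
  rw [LinearMap.mem_ker, Submodule.mem_span_singleton]
  have hdef : perpMap K x =
      (finrank ℚ K : K) * (x : K) - algebraMap ℚ K (Algebra.trace ℚ K (x : K)) := rfl
  rw [hdef, sub_eq_zero]
  constructor
  · intro h
    have hx : (x : K) = algebraMap ℚ K (Algebra.trace ℚ K (x : K) / finrank ℚ K) := by
      have hnK : (finrank ℚ K : K) ≠ 0 := by
        exact_mod_cast (finrank_pos (R := ℚ) (M := K)).ne'
      rw [map_div₀, map_natCast, ← h]
      field_simp
    have hint : IsIntegral ℤ (algebraMap ℚ K (Algebra.trace ℚ K (x : K) / finrank ℚ K)) := by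
      rw [← hx]; exact RingOfIntegers.isIntegral_coe x
    rw [isIntegral_algebraMap_iff (algebraMap ℚ K).injective] at hint
    obtain ⟨k, hk⟩ := IsIntegrallyClosed.isIntegral_iff.1 hint
    refine ⟨k, ?_⟩
    apply RingOfIntegers.ext
    rw [hx, ← hk]
    simp
  · rintro ⟨k, rfl⟩
    have : ((k • (1 : 𝓞 K) : 𝓞 K) : K) = algebraMap ℚ K k := by simp
    rw [this, Algebra.trace_algebraMap]
    simp

/-- `j(𝓞_K^⊥)` is a lattice of rank `n - 1`. -/
theorem perpLattice_isLatticeOfRank {n : ℕ} (hn : finrank ℚ K = n) :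
    IsLatticeOfRank (perpLattice K) (n - 1) := by
  classical
  let f := (minkowskiMap K).comp (perpMap K)
  have hker : LinearMap.ker f = Submodule.span ℤ {(1 : 𝓞 K)} := by
    rw [← perpMap_ker, LinearMap.ker_comp_of_ker_eq_bot]
    exact LinearMap.ker_eq_bot.2 (minkowskiMap_injective K)
  have hk1 : finrank ℤ (LinearMap.ker f) = 1 := by
    rw [hker, ← (LinearEquiv.toSpanNonzeroSingleton ℤ (𝓞 K) 1 one_ne_zero).finrank_eq,
      finrank_self]
  have hrn := Submodule.finrank_quotient_add_finrank (LinearMap.ker f)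
  rw [f.quotKerEquivRange.finrank_eq] at hrn
  rw [hk1, RingOfIntegers.rank, hn] at hrn
  have hr : finrank ℤ (perpLattice K) = n - 1 := by
    have : finrank ℤ (perpLattice K) + 1 = n := hrn
    omega
  have : Module.Finite ℤ (perpLattice K) := Module.Finite.range f
  have : IsAddTorsionFree (EuclideanSpace ℂ (K →+* ℂ)) :=
    IsAddTorsionFree.of_isTorsionFree ℂ _
  have : Module.Free ℤ (perpLattice K) := inferInstance
  let b : Basis (Fin (n - 1)) ℤ (perpLattice K) := Module.finBasisOfFinrankEq ℤ _ hr
  refine ⟨b, ?_⟩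
  have hex : ∀ i, ∃ y : K, minkowskiMap K y = (b i : EuclideanSpace ℂ (K →+* ℂ)) := by
    intro i
    obtain ⟨x, hx⟩ := (b i).2
    exact ⟨perpMap K x, hx⟩
  choose y hy using hex
  have h1 : LinearIndependent ℤ (fun i => (b i : EuclideanSpace ℂ (K →+* ℂ))) :=
    b.linearIndependent.map' (perpLattice K).subtype (Submodule.ker_subtype _)
  have h2 : LinearIndependent ℤ y := by
    apply LinearIndependent.of_comp (minkowskiMap K)
    have : (minkowskiMap K : K → _) ∘ y = fun i => (b i : EuclideanSpace ℂ (K →+* ℂ)) :=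
      funext hy
    rw [this]; exact h1
  have h3 := minkowskiMap_linearIndependent K h2
  simpa only [hy] using h3

/-- The shape of a number field of degree `n`: the shape of the lattice `j(𝓞_K^⊥)`. -/
noncomputable def fieldShape {n : ℕ} (hn : finrank ℚ K = n) : ShapeSpace (n - 1) :=
  latticeShape (perpLattice_isLatticeOfRank K hn)

end NumberFieldShape

/-! ### Pure prime degree fields -/

/-- `K` is a pure field of degree `p`: it has degree `p` and is generated over `ℚ` by a root of
`x^p - m`, with `m` a `p`-th power free integer. -/
structure IsPureField (p : ℕ) (K : Type*) [Field K] [NumberField K] : Prop where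
  finrank_eq : finrank ℚ K = p
  exists_root : ∃ m : ℤ, (∀ q : ℕ, q.Prime → ¬ (q : ℤ) ^ p ∣ m) ∧
    ∃ θ : K, θ ^ p = (m : K) ∧ IntermediateField.adjoin ℚ {θ} = ⊤

/-- Type I: `p` is wildly ramified in `K`, i.e. `p ^ p` divides the discriminant. -/
def IsWildAt (p : ℕ) (K : Type*) [Field K] [NumberField K] : Prop :=
  (p : ℤ) ^ p ∣ NumberField.discr K

/-- Type II: `p` is tamely ramified in `K`, i.e. `p` is ramified, but not wildly. -/
def IsTameAt (p : ℕ) (K : Type*) [Field K] [NumberField K] : Prop :=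
  (p : ℤ) ∣ NumberField.discr K ∧ ¬ (p : ℤ) ^ p ∣ NumberField.discr K

/-! In the tuples `(a_1, …, a_{p-1})` below, `a_i` has the index `i - 1` of `Fin (p - 1)`. -/

/-- Strongly carefree tuple: squarefree and pairwise coprime integers. -/
def StronglyCarefree {n : ℕ} (a : Fin n → ℤ) : Prop :=
  (∀ i, Squarefree (a i)) ∧ Pairwise fun i j => IsCoprime (a i) (a j)

/-- `m = ∏ a_i ^ i` (in `ℤ`, or for residues modulo `p`). -/
def pureRadicand {R : Type*} [CommMonoid R] {n : ℕ} (a : Fin n → R) : R :=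
  ∏ i, a i ^ ((i : ℕ) + 1)

/-- `b_k = ∏ a_i ^ ⌊i k / p⌋` (in `ℤ`, or for residues modulo `p`). -/
def pureDenom {R : Type*} [CommMonoid R] (p : ℕ) {n : ℕ} (a : Fin n → R) (k : ℕ) : R :=
  ∏ i, a i ^ (((i : ℕ) + 1) * k / p)

/-- `γ_k = α ^ k / b_k`. -/
noncomputable def pureGamma (p : ℕ) {n : ℕ} (a : Fin n → ℤ) (α : ℝ) (k : ℕ) : ℝ :=
  α ^ k / (pureDenom p a k : ℤ)

/-- The matrix `diag(γ_1², …, γ_{p-1}²)`. -/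
noncomputable def wildGram (p : ℕ) (a : Fin (p - 1) → ℤ) (α : ℝ) :
    Matrix (Fin (p - 1)) (Fin (p - 1)) ℝ :=
  Matrix.diagonal fun i => pureGamma p a α ((i : ℕ) + 1) ^ 2

/-- The symmetric matrix with `(1,1)` entry `(1/p) ∑_{k=1}^{p-1} ε^{2(k-1)} γ_1^{2k}`, with
`(1,k)` entries `ε^{k-1} γ_k γ_1^k` and `(k,k)` entries `p γ_k²` for `2 ≤ k ≤ p - 1`, and zeros
elsewhere. -/
noncomputable def tameGram (p : ℕ) (a : Fin (p - 1) → ℤ) (α : ℝ) (ε : ℤ) :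
    Matrix (Fin (p - 1)) (Fin (p - 1)) ℝ :=
  Matrix.of fun i j =>
    if (i : ℕ) = 0 ∧ (j : ℕ) = 0 then
      1 / (p : ℝ) * ∑ k ∈ Finset.Icc 1 (p - 1),
        (ε : ℝ) ^ (2 * (k - 1)) * pureGamma p a α 1 ^ (2 * k)
    else if (i : ℕ) = 0 then
      (ε : ℝ) ^ (j : ℕ) * pureGamma p a α ((j : ℕ) + 1) * pureGamma p a α 1 ^ ((j : ℕ) + 1)
    else if (j : ℕ) = 0 then
      (ε : ℝ) ^ (i : ℕ) * pureGamma p a α ((i : ℕ) + 1) * pureGamma p a α 1 ^ ((i : ℕ) + 1)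
    else if i = j then (p : ℝ) * pureGamma p a α ((i : ℕ) + 1) ^ 2
    else 0

/-! ### The two spaces of shapes -/

/-- The torus `𝒯 ⊆ SL_r(ℝ)` of the matrices `diag(x_1, …, x_ℓ, x_ℓ⁻¹, …, x_1⁻¹)`, where
`r = 2 ℓ`. -/
def diagTorus (r : ℕ) : Subgroup (Matrix.SpecialLinearGroup (Fin r) ℝ) where
  carrier := {t | ∃ d : Fin r → ℝ, (∀ i, d i * d i.rev = 1) ∧
    (t : Matrix (Fin r) (Fin r) ℝ) = Matrix.diagonal d}
  one_mem' := ⟨fun _ => 1, by simp, by simp⟩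
  mul_mem' := by
    rintro s t ⟨d, hd, hs⟩ ⟨e, he, ht⟩
    refine ⟨fun i => d i * e i, fun i => ?_, ?_⟩
    · calc d i * e i * (d i.rev * e i.rev) = (d i * d i.rev) * (e i * e i.rev) := by ring
        _ = 1 := by rw [hd, he, one_mul]
    · rw [Matrix.SpecialLinearGroup.coe_mul, hs, ht, Matrix.diagonal_mul_diagonal]
  inv_mem' := by
    rintro t ⟨d, hd, ht⟩
    refine ⟨fun i => d i.rev, fun i => hd i.rev, ?_⟩
    have h1 : (t : Matrix (Fin r) (Fin r) ℝ) * Matrix.diagonal (fun i => d i.rev) = 1 := by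
      rw [ht, Matrix.diagonal_mul_diagonal]
      simp [hd]
    have h2 : ((t⁻¹ : Matrix.SpecialLinearGroup (Fin r) ℝ) : Matrix (Fin r) (Fin r) ℝ) * t = 1 := by
      rw [← Matrix.SpecialLinearGroup.coe_mul, inv_mul_cancel, Matrix.SpecialLinearGroup.coe_one]
    exact left_inv_eq_right_inv h2 h1

/-- The orbit of the identity Gram matrix (the square lattice) under the action
`t · G = t G tᵀ` of the torus. -/
def torusOrbit (r : ℕ) : Set (Matrix (Fin r) (Fin r) ℝ) :=
  {D | ∃ t ∈ diagTorus r, D = (t : Matrix (Fin r) (Fin r) ℝ) * 1 * (t : Matrix (Fin r) (Fin r) ℝ)ᵀ}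

/-- The space `𝒮_I`: the shapes represented by the orbit of the square lattice under the torus. -/
def wildShapes (p : ℕ) : Set (ShapeSpace (p - 1)) :=
  {s | ∃ D ∈ torusOrbit (p - 1), s.IsRepresentedBy D}

/-- The change of basis matrix with first row `(1/p) (c_1, …, c_{p-1})`, where `c_k` is the
representative in `{0, …, p-1}` of `m^{-(k-1)} b_k` modulo `p`, for the residues `m = ∏ u_i^i` and
`b_k = ∏ u_i^⌊i k / p⌋`; the other rows are those of the identity matrix. Here `c_1 = 1`. -/
noncomputable def tameChange (p : ℕ) (u : Fin (p - 1) → (ZMod p)ˣ) :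
    Matrix (Fin (p - 1)) (Fin (p - 1)) ℝ :=
  Matrix.of fun i j =>
    if (i : ℕ) = 0 then
      (((((pureRadicand u)⁻¹ ^ (j : ℕ) * pureDenom p u ((j : ℕ) + 1) : (ZMod p)ˣ) :
        ZMod p).val : ℕ) : ℝ) / (p : ℝ)
    else if i = j then 1 else 0

/-- The space `𝒮_II`: the shapes represented by the matrices `C D Cᵀ`, with `D` in the orbit of
the square lattice under the torus, and `C` one of the finitely many matrices `tameChange p u`. -/
def tameShapes (p : ℕ) : Set (ShapeSpace (p - 1)) :=
  {s | ∃ u : Fin (p - 1) → (ZMod p)ˣ, ∃ D ∈ torusOrbit (p - 1),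
    s.IsRepresentedBy (tameChange p u * D * (tameChange p u)ᵀ)}

/-!
Let `K = ℚ(θ)` with `θ ^ p = m = ∏ a_i ^ i`, and put `b_k = ∏ a_i ^ ⌊i k / p⌋`,
`α_k = θ ^ k / b_k`. Each `α_k` is integral, since `α_k ^ p = ∏ a_i ^ (i k mod p)`, and the images
of the `α_k` in Minkowski space are orthogonal, of squared length `p γ_k²` (`inner_pureElt`),
because the trace of `θ ^ n` vanishes unless `p ∣ n`. So everything depends on how far
`Λ = ⟨α_0, …, α_{p-1}⟩` is from the ring of integers.

*Integral bases.* Traces show that `p (∏ a_i) 𝓞_K ⊆ Λ`. A prime `q` dividing some `a_i` is totally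
ramified and the `α_k` have distinct `q`-adic valuations modulo `1`, so `Λ` is maximal at `q`
(`prime_dvd_coeff`). There remains `p`, when `p ∤ m`. Choose `ε` with `m ε ≡ 1` modulo `p` and put
`ρ = ε θ - 1`, so that `(1 + ρ) ^ p = ε ^ p m ≡ 1` modulo `p`. Then `ρ` is nilpotent in `𝓞_K / p`,
and the polynomials over `𝔽_p` that vanish at `ρ` there are the multiples of `X ^ s`, where `s` is
the nilpotency order of `ρ`. If `ε ^ p m ≢ 1` modulo `p ^ 2`, then
`s = p` and `Λ = 𝓞_K`. Otherwise `ρ ^ (p - 1) / p` is integral by a quadratic equation, while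
`p ∤ ρ ^ (p - 2)` by a trace argument; so `s = p - 1`, and `𝓞_K` is generated by `Λ` and
`(∑ ε ^ k θ ^ k) / p ≡ ρ ^ (p - 1) / p` modulo `Λ` (`hasWildBasis_or_hasTameBasis`).

*Types.* The discriminant of `Λ` is `± p ^ p (∏ a_i) ^ (p - 1)`. If `Λ = 𝓞_K`, all traces of
integers are divisible by `p`, hence `p ^ p` divides the discriminant. In the other case `p` divides
the index of `Λ`, hence `p ^ p` does not divide the discriminant, whose `p`-adic valuation is odd.
So the two integral bases correspond to Type I and Type II.

*Shapes.* The Gram matrices follow (`fieldShape_isRepresentedBy`), in the second case with a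
glue vector whose coordinates are all prime to `p`. The `γ_k²` are linearly independent over `ℚ`, so
rational isometries are sign changes in the orthogonal coordinates, and vectors with rational
coordinates are orthogonal only if their supports are disjoint. The glue vector allows
only the sign changes `1` and `-1`, and no orthogonal basis.

*Dimension.* The preimage of a space of shapes is a countable union of images of the torus orbit
`𝒪` under linear maps, and at least one of them is injective; `𝒪` is a smooth image of `ℝ ^ ℓ` that
projects onto an open subset of `ℝ ^ ℓ` (`shapeDim_of_family`).
-/

/-! ### Representatives of a shape -/

theorem isUnit_glReal {r : ℕ} (g : GL (Fin r) ℤ) : IsUnit (glReal g) :=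
  ⟨⟨glReal g, glReal g⁻¹, by rw [← glReal_mul, mul_inv_cancel, glReal_one],
    by rw [← glReal_mul, inv_mul_cancel, glReal_one]⟩, rfl⟩

theorem glReal_inv_mul {r : ℕ} (g : GL (Fin r) ℤ) : glReal g⁻¹ * glReal g = 1 := by
  rw [← glReal_mul, inv_mul_cancel, glReal_one]

theorem det_glReal_sq {r : ℕ} (g : GL (Fin r) ℤ) : (glReal g).det ^ 2 = 1 := by
  have h : IsUnit (g : Matrix (Fin r) (Fin r) ℤ).det := (Matrix.isUnit_iff_isUnit_det _).1 g.isUnit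
  have h2 : (glReal g).det = (((g : Matrix (Fin r) (Fin r) ℤ).det : ℤ) : ℝ) := by
    rw [glReal]; exact (RingHom.map_det (Int.castRingHom ℝ) _).symm
  rw [h2]
  rcases Int.isUnit_iff.1 h with h | h <;> simp [h]

theorem Matrix.PosDef.congr_isUnit {r : ℕ} {G C : Matrix (Fin r) (Fin r) ℝ} (hG : G.PosDef)
    (hC : IsUnit C) : (C * G * Cᵀ).PosDef := by
  rw [← Matrix.conjTranspose_eq_transpose_of_trivial]
  exact hG.mul_mul_conjTranspose_same (Matrix.vecMul_injective_of_isUnit hC)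

theorem ShapeSpace.IsRepresentedBy.exists_eq {r : ℕ} {s : ShapeSpace r}
    {G H : Matrix (Fin r) (Fin r) ℝ} (hG : s.IsRepresentedBy G) (hH : s.IsRepresentedBy H) :
    ∃ (g : GL (Fin r) ℤ) (t : ℝ), t ≠ 0 ∧ H = t ^ 2 • (glReal g * G * (glReal g)ᵀ) := by
  obtain ⟨h1, e1⟩ := hG
  obtain ⟨h2, e2⟩ := hH
  exact Quotient.exact (s := gramSetoid r) (e1.symm.trans e2)

theorem ShapeSpace.IsRepresentedBy.congr_smul {r : ℕ} {s : ShapeSpace r}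
    {G : Matrix (Fin r) (Fin r) ℝ} (hG : s.IsRepresentedBy G) (g : GL (Fin r) ℤ) {t : ℝ}
    (ht : t ≠ 0) : s.IsRepresentedBy (t ^ 2 • (glReal g * G * (glReal g)ᵀ)) := by
  obtain ⟨h1, e1⟩ := hG
  refine ⟨(h1.congr_isUnit (isUnit_glReal g)).smul (by positivity), e1.trans ?_⟩
  exact Quotient.sound (s := gramSetoid r) ⟨g, t, ht, rfl⟩

theorem ShapeSpace.IsRepresentedBy.smul {r : ℕ} {s : ShapeSpace r}
    {G : Matrix (Fin r) (Fin r) ℝ} (hG : s.IsRepresentedBy G) {c : ℝ} (hc : 0 < c) :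
    s.IsRepresentedBy (c • G) := by
  have := hG.congr_smul 1 (Real.sqrt_pos.2 hc).ne'
  rwa [Real.sq_sqrt hc.le, glReal_one, Matrix.transpose_one, Matrix.one_mul,
    Matrix.mul_one] at this

theorem ShapeSpace.mk_isRepresentedBy {r : ℕ} {G : Matrix (Fin r) (Fin r) ℝ} (hG : G.PosDef) :
    (ShapeSpace.mk G hG).IsRepresentedBy G := ⟨hG, rfl⟩

/-! ### The torus orbit -/

/-- For even `r`, the product of a tuple over `Fin r` pairs each index with its mirror image. -/
theorem prod_eq_one_of_mul_rev {r : ℕ} {d : Fin r → ℝ} (hpos : ∀ i, 0 < d i)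
    (hd : ∀ i, d i * d i.rev = 1) : ∏ i, d i = 1 := by
  have h1 : ∏ i : Fin r, d i.rev = ∏ i, d i := Equiv.prod_comp Fin.revPerm d
  have h2 : (∏ i, d i) ^ 2 = 1 := by
    rw [sq]
    nth_rewrite 2 [← h1]
    rw [← Finset.prod_mul_distrib]
    exact Finset.prod_eq_one fun i _ => hd i
  have h3 : 0 < ∏ i, d i := Finset.prod_pos fun i _ => hpos i
  nlinarith

/-- The torus orbit consists of the positive diagonal matrices with reciprocal mirror entries: every
point of it comes from a torus element with positive entries. -/
theorem mem_torusOrbit_iff {r : ℕ} {D : Matrix (Fin r) (Fin r) ℝ} :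
    D ∈ torusOrbit r ↔
      ∃ e : Fin r → ℝ, (∀ i, 0 < e i) ∧ (∀ i, e i * e i.rev = 1) ∧ D = Matrix.diagonal e := by
  constructor
  · rintro ⟨t, ⟨d, hd, ht⟩, rfl⟩
    refine ⟨fun i => d i * d i, fun i => ?_, fun i => ?_, ?_⟩
    · have : d i ≠ 0 := left_ne_zero_of_mul_eq_one (hd i)
      exact mul_self_pos.2 this
    · calc d i * d i * (d i.rev * d i.rev) = (d i * d i.rev) * (d i * d i.rev) := by ring
        _ = 1 := by rw [hd, one_mul]
    · rw [ht, Matrix.mul_one, Matrix.diagonal_transpose, Matrix.diagonal_mul_diagonal]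
  · rintro ⟨e, he, hrev, rfl⟩
    have hs : ∀ i, √(e i) * √(e i.rev) = 1 := fun i => by
      rw [← Real.sqrt_mul (he i).le, hrev, Real.sqrt_one]
    refine ⟨⟨Matrix.diagonal fun i => √(e i), ?_⟩, ⟨_, hs, rfl⟩, ?_⟩
    · rw [Matrix.det_diagonal]
      exact prod_eq_one_of_mul_rev (fun i => Real.sqrt_pos.2 (he i)) hs
    · simp only [Matrix.mul_one, Matrix.diagonal_transpose, Matrix.diagonal_mul_diagonal]
      congr 1
      funext i
      exact (Real.mul_self_sqrt (he i).le).symm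

theorem posDef_of_mem_torusOrbit {r : ℕ} {D : Matrix (Fin r) (Fin r) ℝ} (hD : D ∈ torusOrbit r) :
    D.PosDef := by
  obtain ⟨e, he, -, rfl⟩ := mem_torusOrbit_iff.1 hD
  exact Matrix.PosDef.diagonal he

theorem det_of_mem_torusOrbit {r : ℕ} {D : Matrix (Fin r) (Fin r) ℝ} (hD : D ∈ torusOrbit r) :
    D.det = 1 := by
  obtain ⟨e, he, hr, rfl⟩ := mem_torusOrbit_iff.1 hD
  rw [Matrix.det_diagonal, prod_eq_one_of_mul_rev he hr]

/-! ### Hausdorff dimension -/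

/-- The exponents of a point of the torus: `(x_1, …, x_ℓ, -x_ℓ, …, -x_1)`. -/
def torusExponent (l : ℕ) (x : Fin l → ℝ) (i : Fin (2 * l)) : ℝ :=
  if h : (i : ℕ) < l then x ⟨i, h⟩ else -x ⟨2 * l - 1 - i, by omega⟩

theorem torusExponent_rev (l : ℕ) (x : Fin l → ℝ) (i : Fin (2 * l)) :
    torusExponent l x i.rev = -torusExponent l x i := by
  have hi := i.2
  unfold torusExponent
  by_cases h : (i : ℕ) < l
  · rw [dif_pos h, dif_neg (by simp only [Fin.val_rev]; omega)]
    congr 3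
    simp only [Fin.val_rev]
    omega
  · rw [dif_neg h, dif_pos (by simp only [Fin.val_rev]; omega), neg_neg]
    congr 2
    simp only [Fin.val_rev]
    omega

theorem torusOrbit_eq_range (l : ℕ) :
    {G : Fin (2 * l) → Fin (2 * l) → ℝ | Matrix.of G ∈ torusOrbit (2 * l)} =
      Set.range fun (x : Fin l → ℝ) (i j : Fin (2 * l)) =>
        if i = j then Real.exp (torusExponent l x i) else 0 := by
  ext G
  rw [Set.mem_range, Set.mem_ofPred_eq]
  rw [mem_torusOrbit_iff]
  constructor
  · rintro ⟨e, he, hr, hG⟩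
    refine ⟨fun i => Real.log (e ⟨i, by omega⟩), ?_⟩
    have hG' : G = Matrix.diagonal e := hG
    rw [hG']
    funext i j
    rw [Matrix.diagonal_apply]
    by_cases hij : i = j
    · rw [if_pos hij, if_pos hij]
      unfold torusExponent
      by_cases h : (i : ℕ) < l
      · rw [dif_pos h, Real.exp_log (he _)]
      · rw [dif_neg h, Real.exp_neg, Real.exp_log (he _), inv_eq_iff_eq_inv,
          ← mul_eq_one_iff_eq_inv₀ (he _).ne', mul_comm]
        convert hr i using 3
        ext
        simp only [Fin.val_rev]
        omega
    · rw [if_neg hij, if_neg hij]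
  · rintro ⟨x, rfl⟩
    refine ⟨fun i => Real.exp (torusExponent l x i), fun i => Real.exp_pos _, fun i => ?_, ?_⟩
    · simp only
      rw [torusExponent_rev, ← Real.exp_add, add_neg_cancel, Real.exp_zero]
    · ext i j
      simp [Matrix.diagonal_apply]

/-- The torus orbit has the dimension of the torus. It is a set of arrays of real numbers here,
since these carry the metric for which `shapeDim` is defined. -/
theorem dimH_torusOrbit (l : ℕ) :
    dimH {G : Fin (2 * l) → Fin (2 * l) → ℝ | Matrix.of G ∈ torusOrbit (2 * l)} = l := by
  rw [torusOrbit_eq_range]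
  apply le_antisymm
  · have h := ContDiff.dimH_range_le (E := Fin l → ℝ) (F := Fin (2 * l) → Fin (2 * l) → ℝ)
      (f := fun x i j => if i = j then Real.exp (torusExponent l x i) else 0) (by
        rw [contDiff_pi]
        intro i
        rw [contDiff_pi]
        intro j
        by_cases hij : i = j
        · simp only [hij, if_true]
          refine Real.contDiff_exp.comp ?_
          unfold torusExponent
          split_ifs
          · fun_prop
          · fun_prop
        · simp only [hij, if_false]
          exact contDiff_const)
    simpa using h
  · -- Reading off the first `l` diagonal entries maps the orbit onto an open orthant.
    have hL : LipschitzWith 1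
        (fun (G : Fin (2 * l) → Fin (2 * l) → ℝ) (i : Fin l) =>
          G ⟨i, by omega⟩ ⟨i, by omega⟩) := by
      refine LipschitzWith.of_dist_le_mul fun G H => ?_
      rw [NNReal.coe_one, one_mul, dist_pi_le_iff dist_nonneg]
      intro i
      exact (dist_le_pi_dist _ _ _).trans (dist_le_pi_dist G H _)
    refine le_trans ?_ (hL.dimH_image_le _)
    have hint : (Set.univ.pi fun _ : Fin l => Set.Ioi (0 : ℝ)) ⊆
        (fun (G : Fin (2 * l) → Fin (2 * l) → ℝ) (i : Fin l) =>
          G ⟨i, by omega⟩ ⟨i, by omega⟩) ''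
        Set.range fun (x : Fin l → ℝ) (i j : Fin (2 * l)) =>
          if i = j then Real.exp (torusExponent l x i) else 0 := by
      intro y hy
      refine ⟨_, ⟨fun i => Real.log (y i), rfl⟩, ?_⟩
      funext i
      simp only [if_true]
      unfold torusExponent
      rw [dif_pos i.2, Real.exp_log (hy i (Set.mem_univ i))]
    refine le_trans ?_ (dimH_mono hint)
    rw [Real.dimH_of_nonempty_interior]
    · simp
    · rw [(isOpen_set_pi Set.finite_univ fun _ _ => isOpen_Ioi).interior_eq]
      exact ⟨fun _ => 1, fun _ _ => by simp⟩

/-- Congruence by `C`, scaled by `c`, as a map on arrays of real numbers. -/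
def congrMap {r : ℕ} (c : ℝ) (C : Matrix (Fin r) (Fin r) ℝ) :
    (Fin r → Fin r → ℝ) →ₗ[ℝ] (Fin r → Fin r → ℝ) where
  toFun G := (c • (C * Matrix.of G * Cᵀ) : Matrix (Fin r) (Fin r) ℝ)
  map_add' G H := by
    have : Matrix.of (G + H) = Matrix.of G + Matrix.of H := rfl
    rw [this, Matrix.mul_add, Matrix.add_mul, smul_add]
    rfl
  map_smul' t G := by
    have : Matrix.of (t • G) = t • Matrix.of G := rfl
    rw [this, Matrix.mul_smul, Matrix.smul_mul, smul_comm]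
    rfl

theorem of_congrMap {r : ℕ} (c : ℝ) (C : Matrix (Fin r) (Fin r) ℝ) (G : Fin r → Fin r → ℝ) :
    Matrix.of (congrMap c C G) = c • (C * Matrix.of G * Cᵀ) := rfl

theorem dimH_image_congrMap_le {r : ℕ} (c : ℝ) (C : Matrix (Fin r) (Fin r) ℝ)
    (S : Set (Fin r → Fin r → ℝ)) : dimH (congrMap c C '' S) ≤ dimH S :=
  (LinearMap.toContinuousLinearMap (congrMap c C)).lipschitz.dimH_image_le S

/-- The space of the shapes represented by `C_i D C_iᵀ`, with `D` in the torus orbit and `C_i` in a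
countable family of matrices of constant determinant, has the dimension of the torus. In
determinant `1`, equivalence of Gram matrices leaves only countably many linear maps, because the
scalar is determined. -/
theorem shapeDim_of_family {l : ℕ} (hl : 0 < l) {ι : Type*} [Countable ι] [Nonempty ι]
    (C : ι → Matrix (Fin (2 * l)) (Fin (2 * l)) ℝ) {δ : ℝ} (hδ : 0 < δ)
    (hC : ∀ i, (C i).det = δ) :
    shapeDim {s | ∃ i, ∃ D ∈ torusOrbit (2 * l), s.IsRepresentedBy (C i * D * (C i)ᵀ)} = l := by
  set O := {G : Fin (2 * l) → Fin (2 * l) → ℝ | Matrix.of G ∈ torusOrbit (2 * l)} with hO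
  -- The scalar `τ` brings the determinant of `C D Cᵀ`, which is `δ²`, to `1`.
  obtain ⟨τ, hτ0, hτ⟩ : ∃ τ : ℝ, 0 < τ ∧ τ ^ (2 * l) * δ ^ 2 = 1 := by
    refine ⟨(δ ^ (-(1 : ℝ) / l)), Real.rpow_pos_of_pos hδ _, ?_⟩
    have hl' : (l : ℝ) ≠ 0 := by exact_mod_cast hl.ne'
    rw [← Real.rpow_natCast (δ ^ (-(1 : ℝ) / l)), ← Real.rpow_mul hδ.le, ← Real.rpow_natCast δ,
      ← Real.rpow_add hδ]
    have : -(1 : ℝ) / l * ((2 * l : ℕ) : ℝ) + ((2 : ℕ) : ℝ) = 0 := by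
      push_cast; field_simp; ring
    rw [this, Real.rpow_zero]
  have hdet : ∀ i, ∀ D ∈ torusOrbit (2 * l), (C i * D * (C i)ᵀ).det = δ ^ 2 := by
    intro i D hD
    rw [Matrix.det_mul, Matrix.det_mul, Matrix.det_transpose, hC, det_of_mem_torusOrbit hD]
    ring
  have hunit : ∀ i, IsUnit (C i) := fun i =>
    (Matrix.isUnit_iff_isUnit_det _).2 (by rw [hC]; exact hδ.ne'.isUnit)
  unfold shapeDim
  apply le_antisymm
  · have hsub : {G : Fin (2 * l) → Fin (2 * l) → ℝ | (Matrix.of G).det = 1 ∧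
        ∃ s ∈ {s : ShapeSpace (2 * l) | ∃ i, ∃ D ∈ torusOrbit (2 * l),
          s.IsRepresentedBy (C i * D * (C i)ᵀ)}, s.IsRepresentedBy (Matrix.of G)} ⊆
        ⋃ q : GL (Fin (2 * l)) ℤ × ι, congrMap τ (glReal q.1 * C q.2) '' O := by
      rintro G ⟨hG1, s, ⟨i, D, hD, hs⟩, hG⟩
      obtain ⟨D, rfl⟩ := Matrix.of.surjective D
      obtain ⟨g, t, ht, hGD⟩ := hs.exists_eq hG
      have hpow : (t ^ 2) ^ (2 * l) * δ ^ 2 = 1 := by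
        rw [← hG1, hGD, Matrix.det_smul, Fintype.card_fin, Matrix.det_mul, Matrix.det_mul,
          Matrix.det_transpose, hdet i _ hD]
        linear_combination (-(t ^ 2) ^ (2 * l) * δ ^ 2) * det_glReal_sq g
      have hteq : t ^ 2 = τ := by
        refine (pow_left_inj₀ (by positivity) hτ0.le (by omega : 2 * l ≠ 0)).1 ?_
        exact mul_right_cancel₀ (pow_pos hδ 2).ne' (hpow.trans hτ.symm)
      refine Set.mem_iUnion.2 ⟨(g, i), D, hD, ?_⟩
      have : Matrix.of (congrMap τ (glReal g * C i) D) = Matrix.of G := by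
        rw [of_congrMap, hGD, hteq, Matrix.transpose_mul]
        congr 1
        simp only [Matrix.mul_assoc]
      exact this
    refine (dimH_mono hsub).trans ?_
    have : Countable (GL (Fin (2 * l)) ℤ) :=
      Function.Injective.countable (f := fun g : GL (Fin (2 * l)) ℤ =>
        fun i j => (g : Matrix (Fin (2 * l)) (Fin (2 * l)) ℤ) i j) (by
          intro g h hgh
          ext i j
          exact congrFun (congrFun hgh i) j)
    rw [dimH_iUnion]
    refine iSup_le fun q => (dimH_image_congrMap_le _ _ _).trans ?_
    rw [hO, dimH_torusOrbit]
  · obtain ⟨i⟩ := ‹Nonempty ι›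
    have hinv : (C i)⁻¹ * C i = 1 :=
      Matrix.nonsing_inv_mul _ ((Matrix.isUnit_iff_isUnit_det _).1 (hunit i))
    have hinv' : (C i)ᵀ * ((C i)⁻¹)ᵀ = 1 := by
      rw [← Matrix.transpose_mul, hinv, Matrix.transpose_one]
    rw [← dimH_torusOrbit l, ← hO]
    refine le_trans (dimH_mono ?_) (dimH_image_congrMap_le τ⁻¹ (C i)⁻¹ _)
    intro G hG
    change Matrix.of G ∈ torusOrbit (2 * l) at hG
    have hpos := (posDef_of_mem_torusOrbit hG).congr_isUnit (hunit i)
    refine ⟨congrMap τ (C i) G, ⟨?_, ShapeSpace.mk _ hpos,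
      ⟨i, Matrix.of G, hG, ShapeSpace.mk_isRepresentedBy hpos⟩, ?_⟩, ?_⟩
    · rw [of_congrMap, Matrix.det_smul, Fintype.card_fin, hdet i _ hG, hτ]
    · exact (ShapeSpace.mk_isRepresentedBy hpos).smul hτ0
    · have : Matrix.of (congrMap τ⁻¹ (C i)⁻¹ (congrMap τ (C i) G)) = Matrix.of G := by
        rw [of_congrMap, of_congrMap, Matrix.mul_smul, Matrix.smul_mul, smul_smul,
          inv_mul_cancel₀ hτ0.ne', one_smul]
        calc _ = ((C i)⁻¹ * C i) * Matrix.of G * ((C i)ᵀ * ((C i)⁻¹)ᵀ) := by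
              simp only [Matrix.mul_assoc]
          _ = _ := by rw [hinv, hinv', Matrix.one_mul, Matrix.mul_one]
      exact this

theorem pureDenom_one {R : Type*} [CommMonoid R] {p : ℕ} (a : Fin (p - 1) → R) :
    pureDenom p a 1 = 1 := by
  refine Finset.prod_eq_one fun i _ => ?_
  rw [mul_one, Nat.div_eq_of_lt (by have := i.2; omega), pow_zero]

/-- A matrix that differs from the identity matrix only in its first row. -/
theorem det_of_firstRow {R : Type*} [CommRing R] {r : ℕ} (C : Matrix (Fin r) (Fin r) R)
    (i₀ : Fin r) (hi₀ : (i₀ : ℕ) = 0)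
    (h : ∀ i j, i ≠ i₀ → C i j = if i = j then 1 else 0) : C.det = C i₀ i₀ := by
  have hT : C.BlockTriangular id := by
    intro i j hij
    have hij' : j < i := hij
    have hne : i ≠ i₀ := by
      rintro rfl
      have := Fin.lt_def.1 hij'
      omega
    rw [h i j hne, if_neg hij'.ne']
  rw [Matrix.det_of_isUpperTriangular hT, Finset.prod_eq_single i₀]
  · intro i _ hi
    rw [h i i hi, if_pos rfl]
  · simp

theorem det_tameChange (p : ℕ) [Fact p.Prime] (hp2 : 2 < p) (u : Fin (p - 1) → (ZMod p)ˣ) :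
    (tameChange p u).det = (p : ℝ)⁻¹ := by
  have : Fact (1 < p) := ⟨by omega⟩
  rw [det_of_firstRow _ ⟨0, by omega⟩ rfl]
  · simp [tameChange, pureDenom_one, ZMod.val_one, -ZMod.natCast_val]
  · intro i j hi
    have : (i : ℕ) ≠ 0 := fun h => hi (Fin.ext h)
    simp [tameChange, this]

theorem shapeDim_wildShapes (p : ℕ) [hp : Fact p.Prime] (hp2 : 2 < p) :
    shapeDim (wildShapes p) = ((p - 1) / 2 : ℕ) := by
  obtain ⟨l, hl⟩ := hp.out.even_sub_one (by omega)
  have hl2 : (p - 1) / 2 = l := by omega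
  have h := shapeDim_of_family (l := l) (by omega)
    (fun _ : Unit => (1 : Matrix (Fin (2 * l)) (Fin (2 * l)) ℝ)) one_pos (by simp)
  rw [hl2]
  unfold wildShapes
  rw [show p - 1 = 2 * l by omega]
  simpa using h

theorem shapeDim_tameShapes (p : ℕ) [hp : Fact p.Prime] (hp2 : 2 < p) :
    shapeDim (tameShapes p) = ((p - 1) / 2 : ℕ) := by
  obtain ⟨l, hl⟩ := hp.out.even_sub_one (by omega)
  have hl2 : (p - 1) / 2 = l := by omega
  have hdet := det_tameChange p hp2
  have hp0 : (0 : ℝ) < (p : ℝ)⁻¹ := inv_pos.2 (by exact_mod_cast hp.out.pos)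
  have hfin : Finite (Fin (p - 1) → (ZMod p)ˣ) := inferInstance
  rw [hl2]
  unfold tameShapes
  revert hdet hfin
  generalize tameChange p = C
  revert C
  rw [show p - 1 = 2 * l by omega]
  intro C hdet hfin
  exact shapeDim_of_family (by omega) C hp0 hdet

/-! ### Isometries of a diagonal lattice with one glue vector -/

/-- The matrix with first row `y / p` whose other rows are those of the identity matrix. Its rows
span the lattice obtained from the square lattice by replacing the first basis vector by `y / p`. -/
def glueMatrix (F : Type*) [Field F] (p : ℕ) {r : ℕ} (y : Fin r → ℤ) : Matrix (Fin r) (Fin r) F :=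
  Matrix.of fun i j => if (i : ℕ) = 0 then (y j : F) / (p : F) else if i = j then 1 else 0

theorem glueMatrix_map (p : ℕ) {r : ℕ} (y : Fin r → ℤ) :
    (glueMatrix ℚ p y).map (algebraMap ℚ ℝ) = glueMatrix ℝ p y := by
  ext i j
  simp only [glueMatrix, Matrix.map_apply, Matrix.of_apply]
  split_ifs <;> simp

theorem det_glueMatrix (F : Type*) [Field F] (p : ℕ) {r : ℕ} (y : Fin r → ℤ) (i₀ : Fin r)
    (hi₀ : (i₀ : ℕ) = 0) (hy : y i₀ = 1) : (glueMatrix F p y).det = (p : F)⁻¹ := by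
  rw [det_of_firstRow _ i₀ hi₀]
  · simp [glueMatrix, hi₀, hy]
  · intro i j hi
    have : (i : ℕ) ≠ 0 := fun h => hi (Fin.ext (h.trans hi₀.symm))
    simp [glueMatrix, this]

theorem isUnit_glueMatrix (F : Type*) [Field F] [CharZero F] {p : ℕ} (hp : p ≠ 0) {r : ℕ}
    (y : Fin r → ℤ) (i₀ : Fin r) (hi₀ : (i₀ : ℕ) = 0) (hy : y i₀ = 1) :
    IsUnit (glueMatrix F p y) := by
  rw [Matrix.isUnit_iff_isUnit_det, det_glueMatrix F p y i₀ hi₀ hy]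
  exact (inv_ne_zero (Nat.cast_ne_zero.2 hp)).isUnit

/-- The entry in column `k` of an integral combination of the rows of `glueMatrix`. -/
theorem mul_glueMatrix_apply (F : Type*) [Field F] (p : ℕ) {r : ℕ} (y : Fin r → ℤ) (i₀ : Fin r)
    (hi₀ : (i₀ : ℕ) = 0) (M : Matrix (Fin r) (Fin r) F) (i k : Fin r) :
    (M * glueMatrix F p y) i k = M i i₀ * (y k / p) + if k = i₀ then 0 else M i k := by
  rw [Matrix.mul_apply, ← Finset.add_sum_erase _ _ (Finset.mem_univ i₀)]
  congr 1
  · simp [glueMatrix, hi₀]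
  · have h : ∀ l ∈ Finset.univ.erase i₀,
        M i l * glueMatrix F p y l k = if l = k then M i k else 0 := by
      intro l hl
      have : (l : ℕ) ≠ 0 := fun h => Finset.ne_of_mem_erase hl (Fin.ext (h.trans hi₀.symm))
      by_cases hlk : l = k
      · subst hlk; simp [glueMatrix, this]
      · simp [glueMatrix, this, hlk]
    rw [Finset.sum_congr rfl h, Finset.sum_ite_eq']
    by_cases hk : k = i₀ <;> simp [hk]

theorem map_mul_diagonal_mul_transpose_apply {r : ℕ} (M : Matrix (Fin r) (Fin r) ℚ) (w : Fin r → ℝ)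
    (i j : Fin r) :
    (M.map (algebraMap ℚ ℝ) * Matrix.diagonal w * (M.map (algebraMap ℚ ℝ))ᵀ) i j =
      ∑ k, (M i k * M j k) • w k := by
  rw [Matrix.mul_apply]
  refine Finset.sum_congr rfl fun k _ => ?_
  rw [Matrix.mul_diagonal, Matrix.transpose_apply, Matrix.map_apply, Matrix.map_apply,
    Algebra.smul_def, map_mul]
  ring

/-- If the squared lengths of an orthogonal basis are linearly independent over `ℚ`, the rational
isometries are the sign changes of the basis vectors. -/
theorem mul_self_eq_of_isometry {r : ℕ} {w : Fin r → ℝ} (hw : LinearIndependent ℚ w)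
    {M : Matrix (Fin r) (Fin r) ℚ}
    (h : M.map (algebraMap ℚ ℝ) * Matrix.diagonal w * (M.map (algebraMap ℚ ℝ))ᵀ =
      Matrix.diagonal w) (i k : Fin r) : M i k * M i k = if i = k then 1 else 0 := by
  have h1 := congrFun (congrFun h i) i
  rw [map_mul_diagonal_mul_transpose_apply, Matrix.diagonal_apply_eq] at h1
  have h2 : ∑ k, (M i k * M i k - if i = k then 1 else 0) • w k = 0 := by
    simp only [sub_smul, Finset.sum_sub_distrib, h1, ite_smul, one_smul, zero_smul,
      Finset.sum_ite_eq, Finset.mem_univ, if_true, sub_self]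
  exact sub_eq_zero.1 (Fintype.linearIndependent_iff.1 hw _ h2 k)

/-- `glReal`, with rational entries. -/
def glRat {r : ℕ} (g : GL (Fin r) ℤ) : Matrix (Fin r) (Fin r) ℚ :=
  (g : Matrix (Fin r) (Fin r) ℤ).map (Int.castRingHom ℚ)

theorem glRat_map {r : ℕ} (g : GL (Fin r) ℤ) : (glRat g).map (algebraMap ℚ ℝ) = glReal g := by
  ext i j
  simp [glRat, glReal]

theorem glRat_mul {r : ℕ} (g h : GL (Fin r) ℤ) : glRat (g * h) = glRat g * glRat h := by
  rw [glRat, Units.val_mul, Matrix.map_mul]; rfl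

theorem glRat_one {r : ℕ} : glRat (1 : GL (Fin r) ℤ) = 1 := by
  simp [glRat]

section Glue

variable {p : ℕ} [hp : Fact p.Prime] {r : ℕ} {y : Fin r → ℤ} {i₀ : Fin r} {w : Fin r → ℝ}

/-- An isometry of the glued lattice is a rational isometry of the orthogonal lattice, thus a sign
change, and the signs agree because it maps the glue vector to a lattice vector. -/
theorem isometry_glue_eq_one_or_neg_one (hp2 : 2 < p) (hi₀ : (i₀ : ℕ) = 0) (hy1 : y i₀ = 1)
    (hy : ∀ k, ¬ (p : ℤ) ∣ y k) (hw : LinearIndependent ℚ w) {g : GL (Fin r) ℤ}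
    (hg : glReal g * (glueMatrix ℝ p y * Matrix.diagonal w * (glueMatrix ℝ p y)ᵀ) * (glReal g)ᵀ =
      glueMatrix ℝ p y * Matrix.diagonal w * (glueMatrix ℝ p y)ᵀ) : g = 1 ∨ g = -1 := by
  have hp0 : (p : ℚ) ≠ 0 := Nat.cast_ne_zero.2 hp.out.ne_zero
  have hC := (Matrix.isUnit_iff_isUnit_det _).1
    (isUnit_glueMatrix ℚ hp.out.ne_zero y i₀ hi₀ hy1)
  set C := glueMatrix ℚ p y with hCdef
  have hCC : C⁻¹ * C = 1 := Matrix.nonsing_inv_mul _ hC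
  have hCC' : C * C⁻¹ = 1 := Matrix.mul_nonsing_inv _ hC
  -- In the orthogonal coordinates the isometry is a diagonal matrix of signs.
  set M := C⁻¹ * glRat g * C with hM
  have hCM : C * M = glRat g * C := by
    rw [hM, ← Matrix.mul_assoc, ← Matrix.mul_assoc, hCC', Matrix.one_mul]
  have hiso : M.map (algebraMap ℚ ℝ) * Matrix.diagonal w * (M.map (algebraMap ℚ ℝ))ᵀ =
      Matrix.diagonal w := by
    have e1 : C⁻¹.map (algebraMap ℚ ℝ) * C.map (algebraMap ℚ ℝ) = 1 := by
      rw [← Matrix.map_mul, hCC]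
      simp
    have e2 : (C.map (algebraMap ℚ ℝ))ᵀ * (C⁻¹.map (algebraMap ℚ ℝ))ᵀ = 1 := by
      rw [← Matrix.transpose_mul, e1, Matrix.transpose_one]
    have hM' : M.map (algebraMap ℚ ℝ) =
        C⁻¹.map (algebraMap ℚ ℝ) * glReal g * C.map (algebraMap ℚ ℝ) := by
      rw [hM, Matrix.map_mul, Matrix.map_mul, glRat_map]
    rw [← glueMatrix_map, ← hCdef] at hg
    rw [hM', Matrix.transpose_mul, Matrix.transpose_mul]
    calc _ = C⁻¹.map (algebraMap ℚ ℝ) * (glReal g * (C.map (algebraMap ℚ ℝ) * Matrix.diagonal w *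
          (C.map (algebraMap ℚ ℝ))ᵀ) * (glReal g)ᵀ) * (C⁻¹.map (algebraMap ℚ ℝ))ᵀ := by
            simp only [Matrix.mul_assoc]
      _ = (C⁻¹.map (algebraMap ℚ ℝ) * C.map (algebraMap ℚ ℝ)) * Matrix.diagonal w *
          ((C.map (algebraMap ℚ ℝ))ᵀ * (C⁻¹.map (algebraMap ℚ ℝ))ᵀ) := by
            rw [hg]; simp only [Matrix.mul_assoc]
      _ = _ := by rw [e1, e2, Matrix.one_mul, Matrix.mul_one]
  have hsq := mul_self_eq_of_isometry hw hiso
  have hdiag : ∀ i k, i ≠ k → M i k = 0 := fun i k hik => by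
    have := hsq i k
    rw [if_neg hik] at this
    exact mul_self_eq_zero.1 this
  have hsign : ∀ k, M k k = 1 ∨ M k k = -1 := fun k => by
    have := hsq k k
    rw [if_pos rfl] at this
    exact mul_self_eq_one_iff.1 this
  -- The glue vector forces the signs to be congruent modulo `p` to one integer.
  have hrow : ∀ k, (g i₀ i₀ : ℚ) * y k + (p : ℚ) * (if k = i₀ then 0 else (g i₀ k : ℚ)) =
      y k * M k k := by
    intro k
    have h1 : (C * M) i₀ k = (glRat g * C) i₀ k := by rw [hCM]
    rw [hCdef, mul_glueMatrix_apply ℚ p y i₀ hi₀, Matrix.mul_apply,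
      Finset.sum_eq_single k (fun l _ hl => by rw [hdiag l k hl, mul_zero]) (by simp)] at h1
    have h2 : glueMatrix ℚ p y i₀ k = (y k : ℚ) / p := by simp [glueMatrix, hi₀]
    have h3 : ∀ l, glRat g i₀ l = (g i₀ l : ℚ) := fun l => by simp [glRat]
    rw [h2, h3, h3] at h1
    field_simp at h1
    linear_combination -h1
  have hcongr : ∀ k (s : ℤ), M k k = s → (p : ℤ) ∣ s - g i₀ i₀ := by
    intro k s hs
    have h1 := hrow k
    rw [hs] at h1
    have h2 : y k * (s - g i₀ i₀) = p * (if k = i₀ then 0 else g i₀ k) := by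
      have : ((y k * (s - g i₀ i₀) : ℤ) : ℚ) = ((p * (if k = i₀ then 0 else g i₀ k) : ℤ) : ℚ) := by
        push_cast
        split_ifs at h1 ⊢ <;> linear_combination -h1
      exact_mod_cast this
    exact ((Nat.prime_iff_prime_int.1 hp.out).dvd_or_dvd ⟨_, h2⟩).resolve_left (hy k)
  have hMsmul : ∀ s : ℤ, M i₀ i₀ = s → (s = 1 ∨ s = -1) → M = (s : ℚ) • 1 := by
    intro s hs hs1
    ext i k
    by_cases hik : i = k
    · subst hik
      rw [Matrix.smul_apply, Matrix.one_apply_eq, smul_eq_mul, mul_one]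
      have hd : ∀ e : ℤ, M i i = e → (p : ℤ) ∣ e - s := fun e he => by
        have := dvd_sub (hcongr i e he) (hcongr i₀ s hs)
        simpa using this
      have hle : ∀ e : ℤ, (p : ℤ) ∣ e → |e| ≤ 2 → e = 0 := fun e he h2 =>
        Int.eq_zero_of_abs_lt_dvd he (by omega)
      rcases hsign i with h | h
      · have := hle _ (hd 1 (by rw [h]; simp)) (by rcases hs1 with rfl | rfl <;> simp)
        rw [h, show s = 1 by omega]; simp
      · have := hle _ (hd (-1) (by rw [h]; simp)) (by rcases hs1 with rfl | rfl <;> simp)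
        rw [h, show s = -1 by omega]; simp
    · rw [hdiag i k hik, Matrix.smul_apply, Matrix.one_apply_ne hik, smul_zero]
  have hfin : ∀ s : ℤ, M = (s : ℚ) • (1 : Matrix (Fin r) (Fin r) ℚ) →
      (g : Matrix (Fin r) (Fin r) ℤ) = s • 1 := by
    intro s hs
    have h1 : glRat g = (s : ℚ) • 1 := by
      calc glRat g = glRat g * C * C⁻¹ := by rw [Matrix.mul_assoc, hCC', Matrix.mul_one]
        _ = (s : ℚ) • 1 := by
          rw [← hCM, hs, Matrix.mul_smul, Matrix.mul_one, Matrix.smul_mul, hCC']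
    ext i j
    have h2 := congrFun (congrFun h1 i) j
    simp only [glRat, Matrix.map_apply, Matrix.smul_apply, smul_eq_mul, eq_intCast] at h2
    have h3 : ((g i j : ℤ) : ℚ) = ((s * (1 : Matrix (Fin r) (Fin r) ℤ) i j : ℤ) : ℚ) := by
      rw [h2, Matrix.one_apply, Matrix.one_apply]
      split_ifs <;> simp
    simpa using (by exact_mod_cast h3 :
      g i j = s * (1 : Matrix (Fin r) (Fin r) ℤ) i j)
  rcases hsign i₀ with h | h
  · left
    ext1
    simpa using hfin 1 (hMsmul 1 (by simpa using h) (Or.inl rfl))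
  · right
    ext1
    simpa using hfin (-1) (hMsmul (-1) (by simpa using h) (Or.inr rfl))

theorem ShapeSpace.isOrdinary_of_glue (hp2 : 2 < p) (hi₀ : (i₀ : ℕ) = 0) (hy1 : y i₀ = 1)
    (hy : ∀ k, ¬ (p : ℤ) ∣ y k) (hw : LinearIndependent ℚ w) {s : ShapeSpace r}
    (hs : s.IsRepresentedBy (glueMatrix ℝ p y * Matrix.diagonal w * (glueMatrix ℝ p y)ᵀ)) :
    s.IsOrdinary := by
  intro G hG g hg
  obtain ⟨h, t, ht, e⟩ := hG.exists_eq hs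
  have key : h * g * h⁻¹ = 1 ∨ h * g * h⁻¹ = -1 := by
    refine isometry_glue_eq_one_or_neg_one hp2 hi₀ hy1 hy hw ?_
    rw [e, Matrix.mul_smul, Matrix.smul_mul]
    congr 1
    have e1 := glReal_inv_mul h
    have e2 : (glReal h)ᵀ * (glReal h⁻¹)ᵀ = 1 := by
      rw [← Matrix.transpose_mul, e1, Matrix.transpose_one]
    rw [glReal_mul, glReal_mul, Matrix.transpose_mul, Matrix.transpose_mul]
    calc _ = glReal h * (glReal g * ((glReal h⁻¹ * glReal h) * G *
          ((glReal h)ᵀ * (glReal h⁻¹)ᵀ)) * (glReal g)ᵀ) * (glReal h)ᵀ := by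
          simp only [Matrix.mul_assoc]
      _ = _ := by rw [e1, e2, Matrix.one_mul, Matrix.mul_one, hg]
  have hgc : g = h⁻¹ * (h * g * h⁻¹) * h := by group
  rcases key with k | k
  · left; rw [hgc, k]; group
  · right; rw [hgc, k]; simp

/-- An orthogonal basis would consist of vectors of disjoint supports. One of them involves the glue
vector with a coefficient prime to `p`, and so has full support. -/
theorem ShapeSpace.not_isOrthorhombic_of_glue (hr : 2 ≤ r) (hi₀ : (i₀ : ℕ) = 0) (hy1 : y i₀ = 1)
    (hy : ∀ k, ¬ (p : ℤ) ∣ y k) (hw : LinearIndependent ℚ w) {s : ShapeSpace r}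
    (hs : s.IsRepresentedBy (glueMatrix ℝ p y * Matrix.diagonal w * (glueMatrix ℝ p y)ᵀ)) :
    ¬ s.IsOrthorhombic := by
  rintro ⟨d, hd⟩
  obtain ⟨g, t, ht, e⟩ := hs.exists_eq hd
  have hp0 : (p : ℚ) ≠ 0 := Nat.cast_ne_zero.2 hp.out.ne_zero
  set N := glRat g * glueMatrix ℚ p y with hN
  have hNmap : N.map (algebraMap ℚ ℝ) = glReal g * glueMatrix ℝ p y := by
    rw [hN, Matrix.map_mul, glRat_map, glueMatrix_map]
  -- Orthogonal lattice vectors have disjoint supports in the orthogonal coordinates.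
  have horth : ∀ i j, i ≠ j → ∀ k, N i k * N j k = 0 := by
    intro i j hij
    have h1 := congrFun (congrFun e i) j
    rw [Matrix.diagonal_apply_ne _ hij, Matrix.smul_apply, smul_eq_mul, eq_comm,
      mul_eq_zero_iff_left (pow_ne_zero 2 ht)] at h1
    have h2 : glReal g * (glueMatrix ℝ p y * Matrix.diagonal w * (glueMatrix ℝ p y)ᵀ) *
        (glReal g)ᵀ = N.map (algebraMap ℚ ℝ) * Matrix.diagonal w * (N.map (algebraMap ℚ ℝ))ᵀ := by
      rw [hNmap, Matrix.transpose_mul]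
      simp only [Matrix.mul_assoc]
    rw [h2, map_mul_diagonal_mul_transpose_apply] at h1
    exact Fintype.linearIndependent_iff.1 hw _ h1
  have hNapply : ∀ i k, N i k =
      (g i i₀ : ℚ) * (y k / p) + if k = i₀ then 0 else (g i k : ℚ) := fun i k => by
    rw [hN, mul_glueMatrix_apply ℚ p y i₀ hi₀]
    simp [glRat]
  -- One row of `N` has no zero entry.
  obtain ⟨i, hi⟩ : ∃ i, ∀ k, N i k ≠ 0 := by
    have h1 : ∑ i, ((g⁻¹ : GL (Fin r) ℤ) : Matrix (Fin r) (Fin r) ℤ) i₀ i * g i i₀ = 1 := by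
      have h2 : ((g⁻¹ : GL (Fin r) ℤ) : Matrix (Fin r) (Fin r) ℤ) * g = 1 := by
        rw [← Units.val_mul, inv_mul_cancel, Units.val_one]
      have h3 := congrFun (congrFun h2 i₀) i₀
      rwa [Matrix.mul_apply, Matrix.one_apply_eq] at h3
    obtain ⟨i, -, hi⟩ := Finset.exists_ne_zero_of_sum_ne_zero (h1.trans_ne one_ne_zero)
    have hgi : g i i₀ ≠ 0 := right_ne_zero_of_mul hi
    have hNi : ∀ j, j ≠ i → g j i₀ = 0 := by
      intro j hj
      have h2 := horth j i hj i₀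
      rw [hNapply, hNapply, if_pos rfl, hy1] at h2
      have h3 : (g j i₀ : ℚ) * g i i₀ = 0 := by
        field_simp at h2
        simpa using h2
      exact_mod_cast (mul_eq_zero.1 h3).resolve_right (by exact_mod_cast hgi)
    rw [Finset.sum_eq_single i (fun j _ hj => by rw [hNi j hj, mul_zero]) (by simp)] at h1
    refine ⟨i, fun k hk => ?_⟩
    rw [hNapply] at hk
    have h2 : g i i₀ * y k = p * -(if k = i₀ then 0 else g i k) := by
      have : ((g i i₀ * y k : ℤ) : ℚ) = ((p * -(if k = i₀ then 0 else g i k) : ℤ) : ℚ) := by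
        field_simp at hk
        push_cast
        split_ifs at hk ⊢ <;> linear_combination hk
      exact_mod_cast this
    rcases (Nat.prime_iff_prime_int.1 hp.out).dvd_or_dvd ⟨_, h2⟩ with h3 | h3
    · have : (p : ℤ) ∣ 1 := h1 ▸ h3.mul_left _
      exact hp.out.one_lt.ne' (by exact_mod_cast Int.eq_one_of_dvd_one (by positivity) this)
    · exact hy k h3
  have : Nontrivial (Fin r) := Fin.nontrivial_iff_two_le.2 hr
  obtain ⟨j, hj⟩ := exists_ne i
  -- Every other row of `N` vanishes, so `N` is singular.
  have hzero : N.det = 0 := Matrix.det_eq_zero_of_row_eq_zero j fun k =>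
    (mul_eq_zero.1 (horth j i hj k)).resolve_right (hi k)
  have hunit : IsUnit N := by
    refine IsUnit.mul ⟨⟨glRat g, glRat g⁻¹, ?_, ?_⟩, rfl⟩
      (isUnit_glueMatrix ℚ hp.out.ne_zero y i₀ hi₀ hy1)
    · rw [← glRat_mul, mul_inv_cancel, glRat_one]
    · rw [← glRat_mul, inv_mul_cancel, glRat_one]
  exact ((Matrix.isUnit_iff_isUnit_det _).1 hunit).ne_zero hzero

end Glue

/-! ### Radical generators of a pure field -/

theorem StronglyCarefree.ne_zero {n : ℕ} {a : Fin n → ℤ} (ha : StronglyCarefree a) (i : Fin n) :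
    a i ≠ 0 := (ha.1 i).ne_zero

theorem StronglyCarefree.pureRadicand_ne_zero {n : ℕ} {a : Fin n → ℤ} (ha : StronglyCarefree a) :
    pureRadicand a ≠ 0 :=
  Finset.prod_ne_zero_iff.2 fun i _ => pow_ne_zero _ (ha.ne_zero i)

theorem StronglyCarefree.pureDenom_ne_zero {n : ℕ} {a : Fin n → ℤ} (ha : StronglyCarefree a)
    (p k : ℕ) : pureDenom p a k ≠ 0 :=
  Finset.prod_ne_zero_iff.2 fun i _ => pow_ne_zero _ (ha.ne_zero i)

theorem pureDenom_zero {R : Type*} [CommMonoid R] (p : ℕ) {n : ℕ} (a : Fin n → R) :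
    pureDenom p a 0 = 1 := by
  simp [pureDenom]

theorem pureRadicand_pow {R : Type*} [CommMonoid R] (p : ℕ) {n : ℕ} (a : Fin n → R) (k : ℕ) :
    pureRadicand a ^ k = pureDenom p a k ^ p * ∏ i, a i ^ (((i : ℕ) + 1) * k % p) := by
  rw [pureRadicand, pureDenom, ← Finset.prod_pow, ← Finset.prod_pow, ← Finset.prod_mul_distrib]
  refine Finset.prod_congr rfl fun i _ => ?_
  rw [← pow_mul, ← pow_mul, ← pow_add, Nat.div_add_mod']

/-- The floors of `i k / p` and `i (p - k) / p` add up to `i - 1`, as neither is an integer. -/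
theorem div_add_div_reflect {p : ℕ} (hp : p.Prime) {i k : ℕ} (hi : 0 < i) (hip : i < p)
    (hk : 0 < k) (hkp : k < p) : i * k / p + i * (p - k) / p + 1 = i := by
  have hr : i * k % p ≠ 0 := fun h => by
    rcases (hp.dvd_mul).1 (Nat.dvd_of_mod_eq_zero h) with h | h
    · exact Nat.not_dvd_of_pos_of_lt hi hip h
    · exact Nat.not_dvd_of_pos_of_lt hk hkp h
  have hlt := Nat.mod_lt (i * k) hp.pos
  have hdm := Nat.div_add_mod (i * k) p
  have hik : i * (p - k) = p * i - i * k := by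
    rw [Nat.mul_sub, mul_comm i p]
  have hq : i * k / p < i := by
    rw [Nat.div_lt_iff_lt_mul hp.pos]
    exact Nat.mul_lt_mul_of_pos_left hkp hi
  obtain ⟨s, hs⟩ : ∃ s, i = i * k / p + 1 + s := ⟨i - (i * k / p + 1), by omega⟩
  have h1 : i * (p - k) = p * s + (p - i * k % p) := by
    have h2 : p * i = p * (i * k / p) + p + p * s := by
      conv_lhs => rw [hs]
      ring
    omega
  have h3 : i * (p - k) / p = s := by
    rw [h1, Nat.mul_add_div hp.pos, Nat.div_eq_of_lt (by omega), add_zero]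
  omega

theorem pureRadicand_eq_mul {R : Type*} [CommMonoid R] {p : ℕ} (hp : p.Prime) (a : Fin (p - 1) → R)
    {k : ℕ} (hk : 0 < k) (hkp : k < p) :
    pureRadicand a = pureDenom p a k * pureDenom p a (p - k) * ∏ i, a i := by
  rw [pureRadicand, pureDenom, pureDenom, ← Finset.prod_mul_distrib, ← Finset.prod_mul_distrib]
  refine Finset.prod_congr rfl fun i _ => ?_
  rw [← pow_add, ← pow_succ,
    div_add_div_reflect hp (Nat.succ_pos _) (by have := i.2; omega) hk hkp]

/-- The field `K`, of degree `p`, is generated by the `p`-th root `θ` of `∏ a_i ^ i`. -/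
structure IsPureGenerator (p : ℕ) {K : Type*} [Field K] [NumberField K] (a : Fin (p - 1) → ℤ)
    (θ : K) : Prop where
  carefree : StronglyCarefree a
  finrank_eq : finrank ℚ K = p
  pow_eq : θ ^ p = ((pureRadicand a : ℤ) : K)
  adjoin_eq_top : IntermediateField.adjoin ℚ {θ} = ⊤

/-- The algebraic integer `α_k = θ ^ k / b_k`. -/
noncomputable def pureElt (p : ℕ) {K : Type*} [Field K] (a : Fin (p - 1) → ℤ) (θ : K) (k : ℕ) : K :=
  θ ^ k / ((pureDenom p a k : ℤ) : K)

/-- An element that is not a `p`-th power has no `p`-th power among its powers of exponent prime to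
`p`. -/
theorem pow_ne_pow_of_not_dvd {F : Type*} [Field F] {p : ℕ} (hp : p.Prime) {m : F} (hm : m ≠ 0)
    (h : ∀ b : F, b ^ p ≠ m) {k : ℕ} (hk : ¬ p ∣ k) (b : F) : b ^ p ≠ m ^ k := by
  intro hb
  obtain ⟨u, v, huv⟩ := Nat.isCoprime_iff_coprime.2 ((Nat.Prime.coprime_iff_not_dvd hp).2 hk)
  refine h (b ^ v * m ^ u) ?_
  have hb0 : b ≠ 0 := fun h0 => by
    rw [h0, zero_pow hp.ne_zero] at hb
    exact pow_ne_zero k hm hb.symm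
  have e1 : (b ^ v) ^ p = m ^ (v * k) := by
    rw [← zpow_natCast, ← _root_.zpow_mul, mul_comm, _root_.zpow_mul, zpow_natCast, hb, ← zpow_natCast,
      ← _root_.zpow_mul, mul_comm]
  rw [mul_pow, e1, ← zpow_natCast (m ^ u), ← _root_.zpow_mul, ← zpow_add₀ hm, add_comm, huv, zpow_one]

namespace IsPureGenerator

variable {p : ℕ} {K : Type*} [Field K] [NumberField K] {a : Fin (p - 1) → ℤ}
  {θ : K}

theorem denom_ne_zero (h : IsPureGenerator p a θ) (k : ℕ) : ((pureDenom p a k : ℤ) : K) ≠ 0 := by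
  exact_mod_cast h.carefree.pureDenom_ne_zero p k

theorem radicand_rat_ne_zero (h : IsPureGenerator p a θ) : ((pureRadicand a : ℤ) : ℚ) ≠ 0 := by
  exact_mod_cast h.carefree.pureRadicand_ne_zero

theorem pureElt_zero : pureElt p a θ 0 = 1 := by
  simp [pureElt, pureDenom_zero]

theorem denom_mul_pureElt (h : IsPureGenerator p a θ) (k : ℕ) :
    ((pureDenom p a k : ℤ) : K) * pureElt p a θ k = θ ^ k :=
  mul_div_cancel₀ _ (h.denom_ne_zero k)

theorem trace_intCast (h : IsPureGenerator p a θ) (n : ℤ) :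
    Algebra.trace ℚ K (n : K) = p * n := by
  rw [← map_intCast (algebraMap ℚ K), Algebra.trace_algebraMap, h.finrank_eq, nsmul_eq_mul]

theorem pureElt_pow (h : IsPureGenerator p a θ) (k : ℕ) :
    pureElt p a θ k ^ p = ((∏ i, a i ^ (((i : ℕ) + 1) * k % p) : ℤ) : K) := by
  rw [pureElt, div_pow, div_eq_iff (pow_ne_zero _ (h.denom_ne_zero k)), ← pow_mul, mul_comm k,
    pow_mul, h.pow_eq, ← Int.cast_pow, pureRadicand_pow p, Int.cast_mul, Int.cast_pow, mul_comm]

variable [hp : Fact p.Prime]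

theorem ne_zero (h : IsPureGenerator p a θ) : θ ≠ 0 := by
  intro h0
  have := h.pow_eq
  rw [h0, zero_pow hp.out.ne_zero] at this
  exact h.carefree.pureRadicand_ne_zero (by exact_mod_cast this.symm)

theorem minpoly_eq (h : IsPureGenerator p a θ) :
    minpoly ℚ θ = Polynomial.X ^ p - Polynomial.C ((pureRadicand a : ℤ) : ℚ) := by
  have hint : IsIntegral ℚ θ := Algebra.IsIntegral.isIntegral θ
  have hdeg : (minpoly ℚ θ).natDegree = p := by
    rw [← IntermediateField.adjoin.finrank hint, h.adjoin_eq_top, IntermediateField.finrank_top',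
      h.finrank_eq]
  have hmonic := Polynomial.monic_X_pow_sub_C ((pureRadicand a : ℤ) : ℚ) hp.out.ne_zero
  have hroot : Polynomial.aeval θ
      (Polynomial.X ^ p - Polynomial.C ((pureRadicand a : ℤ) : ℚ)) = 0 := by
    rw [map_sub, map_pow, Polynomial.aeval_X, Polynomial.aeval_C, h.pow_eq, map_intCast, sub_self]
  refine (Polynomial.eq_of_monic_of_dvd_of_natDegree_le (minpoly.monic hint) hmonic
    (minpoly.dvd _ _ hroot) ?_).symm
  rw [hdeg, Polynomial.natDegree_X_pow_sub_C]

theorem pow_ne (h : IsPureGenerator p a θ) (b : ℚ) : b ^ p ≠ ((pureRadicand a : ℤ) : ℚ) := by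
  refine (X_pow_sub_C_irreducible_iff_of_prime hp.out).1 ?_ b
  rw [← h.minpoly_eq]
  exact minpoly.irreducible (Algebra.IsIntegral.isIntegral θ)

/-- The minimal polynomial of `θ ^ k` is `X ^ p - m ^ k`, whose second coefficient vanishes. -/
theorem trace_pow (h : IsPureGenerator p a θ) (hp2 : 2 < p) {k : ℕ} (hk : ¬ p ∣ k) :
    Algebra.trace ℚ K (θ ^ k) = 0 := by
  have hirr : Irreducible (Polynomial.X ^ p - Polynomial.C (((pureRadicand a : ℤ) : ℚ) ^ k)) :=
    (X_pow_sub_C_irreducible_iff_of_prime hp.out).2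
      (pow_ne_pow_of_not_dvd hp.out h.radicand_rat_ne_zero h.pow_ne hk)
  have hmin := minpoly.eq_of_irreducible_of_monic (x := θ ^ k) hirr
    (by
      rw [map_sub, map_pow, Polynomial.aeval_X, Polynomial.aeval_C, ← pow_mul, mul_comm, pow_mul,
        h.pow_eq]
      simp)
    (Polynomial.monic_X_pow_sub_C _ hp.out.ne_zero)
  have hnext : (Polynomial.X ^ p - Polynomial.C (((pureRadicand a : ℤ) : ℚ) ^ k)).nextCoeff = 0 := by
    rw [Polynomial.nextCoeff_of_natDegree_pos (by rw [Polynomial.natDegree_X_pow_sub_C]; omega),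
      Polynomial.natDegree_X_pow_sub_C, Polynomial.coeff_sub, Polynomial.coeff_X_pow,
      if_neg (by omega), Polynomial.coeff_C, if_neg (by omega), sub_zero]
  rw [trace_eq_finrank_mul_minpoly_nextCoeff, ← hmin, hnext]
  simp

theorem isIntegral_pureElt (h : IsPureGenerator p a θ) (k : ℕ) :
    IsIntegral ℤ (pureElt p a θ k) := by
  refine IsIntegral.of_pow hp.out.pos ?_
  rw [h.pureElt_pow]
  exact isIntegral_algebraMap (R := ℤ) (A := K)

theorem pureElt_mul_reflect (h : IsPureGenerator p a θ) {k : ℕ} (hk : 0 < k) (hkp : k < p) :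
    pureElt p a θ k * pureElt p a θ (p - k) = ((∏ i, a i : ℤ) : K) := by
  rw [pureElt, pureElt, div_mul_div_comm, ← pow_add, Nat.add_sub_of_le hkp.le, h.pow_eq,
    div_eq_iff (mul_ne_zero (h.denom_ne_zero _) (h.denom_ne_zero _)),
    pureRadicand_eq_mul hp.out a hk hkp]
  push_cast
  ring

theorem trace_pureElt_mul (h : IsPureGenerator p a θ) (hp2 : 2 < p) {j k : ℕ}
    (hjk : ¬ p ∣ j + k) : Algebra.trace ℚ K (pureElt p a θ j * pureElt p a θ k) = 0 := by
  have : pureElt p a θ j * pureElt p a θ k =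
      (((pureDenom p a j : ℤ) : ℚ) * ((pureDenom p a k : ℤ) : ℚ))⁻¹ • θ ^ (j + k) := by
    rw [pureElt, pureElt, div_mul_div_comm, ← pow_add, Algebra.smul_def, div_eq_inv_mul]
    simp
  rw [this, map_smul, h.trace_pow hp2 hjk, smul_zero]

theorem trace_pureElt (h : IsPureGenerator p a θ) (hp2 : 2 < p) {k : ℕ} (hk : 0 < k)
    (hkp : k < p) : Algebra.trace ℚ K (pureElt p a θ k) = 0 := by
  have := h.trace_pureElt_mul hp2 (j := 0) (k := k)
    (by rw [zero_add]; exact Nat.not_dvd_of_pos_of_lt hk hkp)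
  rwa [pureElt_zero, one_mul] at this

theorem trace_pureElt_mul_reflect (h : IsPureGenerator p a θ) {k : ℕ} (hk : 0 < k) (hkp : k < p) :
    Algebra.trace ℚ K (pureElt p a θ k * pureElt p a θ (p - k)) = p * ((∏ i, a i : ℤ) : ℚ) := by
  rw [h.pureElt_mul_reflect hk hkp, h.trace_intCast]

theorem linearIndependent_pureElt (h : IsPureGenerator p a θ) :
    LinearIndependent ℚ fun k : Fin p => pureElt p a θ k := by
  have hdeg : (minpoly ℚ θ).natDegree = p := by
    rw [h.minpoly_eq, Polynomial.natDegree_X_pow_sub_C]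
  have h1 := linearIndependent_pow (K := ℚ) θ
  rw [hdeg] at h1
  have hb : ∀ k, ((pureDenom p a k : ℤ) : ℚ) ≠ 0 := fun k => by
    exact_mod_cast h.carefree.pureDenom_ne_zero p k
  have h2 := h1.units_smul fun k : Fin p => (Units.mk0 _ (hb k))⁻¹
  have h3 : (fun k : Fin p => pureElt p a θ k) =
      (fun k : Fin p => (Units.mk0 _ (hb k))⁻¹) • fun k : Fin p => θ ^ (k : ℕ) := by
    funext k
    rw [Pi.smul_apply', Units.smul_def, Units.val_inv_eq_inv_val, Units.val_mk0, Algebra.smul_def,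
      pureElt, div_eq_inv_mul]
    simp
  rw [h3]
  exact h2

/-- The basis `α_0 = 1, α_1, …, α_{p-1}` of `K`. -/
noncomputable def basis (h : IsPureGenerator p a θ) : Basis (Fin p) ℚ K :=
  haveI : Nonempty (Fin p) := ⟨⟨0, hp.out.pos⟩⟩
  basisOfLinearIndependentOfCardEqFinrank h.linearIndependent_pureElt
    (by rw [Fintype.card_fin, h.finrank_eq])

theorem basis_apply (h : IsPureGenerator p a θ) (k : Fin p) : h.basis k = pureElt p a θ k := by
  simp [basis]

theorem exists_eq_sum (h : IsPureGenerator p a θ) (x : K) :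
    ∃ c : ℕ → ℚ, x = ∑ k ∈ Finset.range p, c k • pureElt p a θ k := by
  refine ⟨fun k => if hk : k < p then h.basis.repr x ⟨k, hk⟩ else 0, ?_⟩
  rw [Finset.sum_range]
  conv_lhs => rw [← h.basis.sum_repr x]
  refine Finset.sum_congr rfl fun k _ => ?_
  simp only [k.2, dif_pos, h.basis_apply]

end IsPureGenerator

/-! ### Integral elements in the coordinates `α_0, …, α_{p-1}` -/

/-- Divisibility of rational integers can be tested in the ring of integers of `K`. -/
theorem int_dvd_of_isIntegral {K : Type*} [Field K] [CharZero K] {u v : ℤ} {x : K}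
    (hx : IsIntegral ℤ x) (h : (u : K) = v * x) : v ∣ u := by
  by_cases hv : v = 0
  · subst hv
    rw [Int.cast_zero, zero_mul] at h
    simp [Int.cast_eq_zero.1 h]
  · have hvK : (v : K) ≠ 0 := Int.cast_ne_zero.2 hv
    have hx' : x = algebraMap ℚ K (u / v) := by
      rw [map_div₀, map_intCast, map_intCast, h, mul_div_cancel_left₀ _ hvK]
    rw [hx', isIntegral_algebraMap_iff (algebraMap ℚ K).injective] at hx
    obtain ⟨n, hn⟩ := IsIntegrallyClosed.isIntegral_iff.1 hx
    refine ⟨n, ?_⟩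
    have hvQ : (v : ℚ) ≠ 0 := Int.cast_ne_zero.2 hv
    have : (u : ℚ) = v * n := by
      rw [eq_intCast] at hn
      rw [hn]; field_simp
    exact_mod_cast this

theorem exists_int_trace {K : Type*} [Field K] [NumberField K] {x : K} (hx : IsIntegral ℤ x) :
    ∃ n : ℤ, Algebra.trace ℚ K x = n := by
  obtain ⟨n, hn⟩ := IsIntegrallyClosed.isIntegral_iff.1
    (Algebra.isIntegral_trace (L := ℚ) (F := K) hx)
  exact ⟨n, hn.symm⟩

namespace IsPureGenerator

variable {p : ℕ} {K : Type*} [Field K] [NumberField K] {a : Fin (p - 1) → ℤ} {θ : K}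

/-- The integral combinations of `α_0, …, α_{p-1}`. -/
def InSpan (p : ℕ) (a : Fin (p - 1) → ℤ) (θ : K) (x : K) : Prop :=
  ∃ y : ℕ → ℤ, x = ∑ k ∈ Finset.range p, (y k : K) * pureElt p a θ k

theorem inSpan_natAbs_mul {K : Type*} [Field K] {a : Fin (p - 1) → ℤ} {θ : K}
    {n : ℤ} {x : K} (hx : InSpan p a θ ((n : K) * x)) :
    InSpan p a θ ((n.natAbs : K) * x) := by
  rcases Int.natAbs_eq n with h | h
  · rwa [h, Int.cast_natCast] at hx
  · obtain ⟨y, hy⟩ := hx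
    refine ⟨fun k => -y k, ?_⟩
    have h2 : (n.natAbs : K) = -(n : K) := by
      conv_rhs => rw [h]
      simp
    rw [h2, neg_mul, hy, ← Finset.sum_neg_distrib]
    refine Finset.sum_congr rfl fun k _ => ?_
    push_cast
    ring

theorem exists_eq_sum_ratCast [Fact p.Prime] (h : IsPureGenerator p a θ) (x : K) :
    ∃ c : ℕ → ℚ, x = ∑ k ∈ Finset.range p, (c k : K) * pureElt p a θ k := by
  obtain ⟨c, hc⟩ := h.exists_eq_sum x
  exact ⟨c, by simpa only [Algebra.smul_def, eq_ratCast] using hc⟩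

theorem trace_ratCast_mul (c : ℚ) (x : K) :
    Algebra.trace ℚ K ((c : K) * x) = c * Algebra.trace ℚ K x := by
  rw [← eq_ratCast (algebraMap ℚ K), ← Algebra.smul_def, map_smul, smul_eq_mul]

theorem trace_sum [Fact p.Prime] (h : IsPureGenerator p a θ) (hp2 : 2 < p) (c : ℕ → ℚ) :
    Algebra.trace ℚ K (∑ k ∈ Finset.range p, (c k : K) * pureElt p a θ k) = p * c 0 := by
  rw [map_sum, Finset.sum_eq_single 0]
  · rw [trace_ratCast_mul, pureElt_zero, ← Int.cast_one, h.trace_intCast]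
    push_cast
    ring
  · intro k hk hk0
    rw [trace_ratCast_mul,
      h.trace_pureElt hp2 (Nat.pos_of_ne_zero hk0) (Finset.mem_range.1 hk), mul_zero]
  · intro h0
    exact absurd (Finset.mem_range.2 (by omega)) h0

theorem trace_sum_mul_reflect [Fact p.Prime] (h : IsPureGenerator p a θ) (hp2 : 2 < p) (c : ℕ → ℚ)
    {k : ℕ} (hk : 0 < k) (hkp : k < p) :
    Algebra.trace ℚ K ((∑ l ∈ Finset.range p, (c l : K) * pureElt p a θ l) *
      pureElt p a θ (p - k)) = p * ((∏ i, a i : ℤ) : ℚ) * c k := by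
  rw [Finset.sum_mul, map_sum, Finset.sum_eq_single k]
  · rw [mul_assoc, trace_ratCast_mul, h.trace_pureElt_mul_reflect hk hkp]
    ring
  · intro l hl hlk
    rw [mul_assoc, trace_ratCast_mul, h.trace_pureElt_mul hp2, mul_zero]
    have := Finset.mem_range.1 hl
    rintro ⟨q, hq⟩
    have hq1 : q = 1 := by
      have h1 : 0 < q := by
        rcases Nat.eq_zero_or_pos q with h0 | h0
        · subst h0; omega
        · exact h0
      have h2 : q < 2 := by
        by_contra hge
        have : p * 2 ≤ p * q := Nat.mul_le_mul_left p (by omega)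
        omega
      omega
    subst hq1
    omega
  · intro h0
    exact absurd (Finset.mem_range.2 hkp) h0

/-- Traces bound the denominators of the coordinates of an integral element by `p ∏ a_i`. -/
theorem inSpan_mul_of_isIntegral [Fact p.Prime] (h : IsPureGenerator p a θ) (hp2 : 2 < p) {x : K}
    (hx : IsIntegral ℤ x) :
    InSpan p a θ (((p * ∏ i, a i : ℤ) : K) * x) := by
  obtain ⟨c, rfl⟩ := h.exists_eq_sum_ratCast x
  have hc : ∀ k : ℕ, ∃ n : ℤ, k < p → ((p * ∏ i, a i : ℤ) : ℚ) * c k = n := by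
    intro k
    by_cases hkp : k < p
    · rcases Nat.eq_zero_or_pos k with rfl | hk
      · obtain ⟨n, hn⟩ := exists_int_trace hx
        rw [h.trace_sum hp2] at hn
        refine ⟨(∏ i, a i) * n, fun _ => ?_⟩
        push_cast
        rw [← hn]
        ring
      · obtain ⟨n, hn⟩ := exists_int_trace (hx.mul (h.isIntegral_pureElt (p - k)))
        rw [h.trace_sum_mul_reflect hp2 c hk hkp] at hn
        exact ⟨n, fun _ => by rw [← hn]; push_cast; ring⟩
    · exact ⟨0, fun h0 => absurd h0 hkp⟩
  choose n hn using hc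
  refine ⟨n, ?_⟩
  rw [Finset.mul_sum]
  refine Finset.sum_congr rfl fun k hk => ?_
  rw [← mul_assoc]
  congr 1
  have := congrArg (fun t : ℚ => (t : K)) (hn k (Finset.mem_range.1 hk))
  simpa using this

/-- A prime `q` dividing `a_i` ramifies totally: the elements `α_k` have the distinct `q`-adic
valuations `(i k mod p) / p`, so that a combination divisible by `q` has coefficients divisible by
`q`. The proof goes through the coefficients in the order of these valuations, multiplying by the
`α_k'` of complementary valuation. -/
theorem prime_dvd_coeff [hp : Fact p.Prime] (h : IsPureGenerator p a θ) {q : ℕ} (hq : q.Prime)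
    {i : Fin (p - 1)} (hqi : (q : ℤ) ∣ a i) {y : ℕ → ℤ} {z : K} (hz : IsIntegral ℤ z)
    (hyz : ∑ k ∈ Finset.range p, (y k : K) * pureElt p a θ k = (q : K) * z) :
    ∀ k < p, (q : ℤ) ∣ y k := by
  have hqZ := Nat.prime_iff_prime_int.1 hq
  have hqK : (q : K) ≠ 0 := Nat.cast_ne_zero.2 hq.ne_zero
  set e : ℕ → ℕ := fun k => ((i : ℕ) + 1) * k % p with he
  have hip : ¬ p ∣ (i : ℕ) + 1 := Nat.not_dvd_of_pos_of_lt (Nat.succ_pos _) (by have := i.2; omega)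
  have hinj : ∀ k < p, ∀ l < p, e k = e l → k = l := by
    intro k hk l hl hkl
    have h1 : ((i : ℕ) + 1) * k ≡ ((i : ℕ) + 1) * l [MOD p] := hkl
    have h2 := Nat.ModEq.cancel_left_of_coprime (by
      rw [← Nat.coprime_iff_gcd_eq_one]; exact (Nat.Prime.coprime_iff_not_dvd hp.out).2 hip) h1
    rwa [Nat.ModEq, Nat.mod_eq_of_lt hk, Nat.mod_eq_of_lt hl] at h2
  have hlt : ∀ k, e k < p := fun k => Nat.mod_lt _ hp.out.pos
  have hsurj : ∀ j < p, ∃ k < p, e k = j := by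
    intro j hj
    have h1 : Function.Injective fun k : Fin p => (⟨e k, hlt k⟩ : Fin p) := fun k l hkl =>
      Fin.ext (hinj k k.2 l l.2 (congrArg Fin.val hkl))
    obtain ⟨k, hk⟩ := Finite.surjective_of_injective h1 ⟨j, hj⟩
    exact ⟨k, k.2, congrArg Fin.val hk⟩
  set N : ℕ → ℤ := fun k => ∏ i, a i ^ (((i : ℕ) + 1) * k % p) with hN
  have hpow : ∀ k, pureElt p a θ k ^ p = (N k : K) := h.pureElt_pow
  suffices H : ∀ j, ∀ k < p, e k = j → (q : ℤ) ∣ y k from fun k hk => H _ k hk rfl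
  intro j
  induction j using Nat.strong_induction_on with
  | _ j IH =>
    intro k hk hkj
    obtain ⟨k', -, hk'⟩ := hsurj (p - 1 - j) (by have := hp.out.pos; omega)
    have hjp : j < p := hkj ▸ hlt k
    -- The terms other than the one of index `k` are divisible by `q` after multiplication by `α_k'`.
    have hterm : ∀ l ∈ (Finset.range p).erase k,
        IsIntegral ℤ ((y l : K) * pureElt p a θ l * pureElt p a θ k' / q) := by
      intro l hl
      have hlp := Finset.mem_range.1 (Finset.mem_of_mem_erase hl)
      have hne : e l ≠ j := fun hc =>
        Finset.ne_of_mem_erase hl (hinj l hlp k hk (hc.trans hkj.symm))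
      rcases lt_or_gt_of_ne hne with hlt' | hgt
      · obtain ⟨t, ht⟩ := IH _ hlt' l hlp rfl
        have : (y l : K) * pureElt p a θ l * pureElt p a θ k' / q =
            (t : K) * (pureElt p a θ l * pureElt p a θ k') := by
          rw [ht]
          push_cast
          field_simp
        rw [this]
        exact (isIntegral_intCast t).mul
          ((h.isIntegral_pureElt l).mul (h.isIntegral_pureElt k'))
      · have hdvd : (q : ℤ) ^ p ∣ N l * N k' := by
          have h1 : ∀ k, (q : ℤ) ^ e k ∣ N k := fun k =>
            (pow_dvd_pow_of_dvd hqi _).trans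
              (Finset.dvd_prod_of_mem (fun i : Fin (p - 1) => a i ^ (((i : ℕ) + 1) * k % p))
                (Finset.mem_univ i))
          have h2 := mul_dvd_mul (h1 l) (h1 k')
          rw [← pow_add] at h2
          exact (pow_dvd_pow _ (by omega)).trans h2
        obtain ⟨t, ht⟩ := hdvd
        rw [mul_assoc, mul_div_assoc]
        refine (isIntegral_intCast _).mul (IsIntegral.of_pow hp.out.pos ?_)
        have : (pureElt p a θ l * pureElt p a θ k' / q) ^ p = (t : K) := by
          rw [div_pow, mul_pow, hpow, hpow, ← Int.cast_mul, ht]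
          push_cast
          field_simp
        rw [this]
        exact isIntegral_intCast t
    have hk'int : IsIntegral ℤ ((y k : K) * pureElt p a θ k * pureElt p a θ k' / q) := by
      have h1 : (y k : K) * pureElt p a θ k * pureElt p a θ k' / q =
          z * pureElt p a θ k' -
            ∑ l ∈ (Finset.range p).erase k,
              (y l : K) * pureElt p a θ l * pureElt p a θ k' / q := by
        rw [eq_sub_iff_add_eq, Finset.add_sum_erase _
          (fun l => (y l : K) * pureElt p a θ l * pureElt p a θ k' / q) (Finset.mem_range.2 hk),
          ← Finset.sum_div, ← Finset.sum_mul, hyz]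
        field_simp
      rw [h1]
      exact (hz.mul (h.isIntegral_pureElt k')).sub (IsIntegral.sum _ hterm)
    have hdvd : (q : ℤ) ^ p ∣ y k ^ p * (N k * N k') := by
      refine int_dvd_of_isIntegral (hk'int.pow p) ?_
      rw [div_pow, mul_pow, mul_pow, hpow, hpow]
      push_cast
      field_simp
    by_contra hndvd
    have hdvdN : (q : ℤ) ^ p ∣ N k * N k' := by
      refine IsCoprime.dvd_of_dvd_mul_left ?_ hdvd
      exact IsCoprime.pow ((Prime.coprime_iff_not_dvd hqZ).2 hndvd)
    have hprod : N k * N k' = a i ^ (p - 1) *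
        ∏ l ∈ Finset.univ.erase i, a l ^ (((l : ℕ) + 1) * k % p + ((l : ℕ) + 1) * k' % p) := by
      have h1 : N k * N k' =
          ∏ l, a l ^ (((l : ℕ) + 1) * k % p + ((l : ℕ) + 1) * k' % p) := by
        rw [hN, ← Finset.prod_mul_distrib]
        exact Finset.prod_congr rfl fun l _ => (pow_add _ _ _).symm
      rw [h1, ← Finset.mul_prod_erase _ _ (Finset.mem_univ i)]
      congr 2
      change e k + e k' = p - 1
      omega
    obtain ⟨b, hb⟩ := hqi
    have hqb : ¬ (q : ℤ) ∣ b := by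
      rintro ⟨t, ht⟩
      exact hqZ.not_isUnit (h.carefree.1 i q ⟨t, by rw [hb, ht]; ring⟩)
    have h2 : (q : ℤ) ∣ b ^ (p - 1) *
        ∏ l ∈ Finset.univ.erase i, a l ^ (((l : ℕ) + 1) * k % p + ((l : ℕ) + 1) * k' % p) := by
      have h3 : (q : ℤ) ^ p = q ^ (p - 1) * q := by
        rw [← pow_succ, Nat.sub_add_cancel hp.out.pos]
      rw [hprod, hb, mul_pow, h3, mul_assoc] at hdvdN
      exact (mul_dvd_mul_iff_left (pow_ne_zero _ hqZ.ne_zero)).1 hdvdN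
    rcases hqZ.dvd_or_dvd h2 with h3 | h3
    · exact hqb (hqZ.dvd_of_dvd_pow h3)
    · obtain ⟨l, hl, h4⟩ := (hqZ.dvd_finsetProd_iff _).1 h3
      have h5 := (h.carefree.2 (Finset.ne_of_mem_erase hl)).isUnit_of_dvd'
        (hqZ.dvd_of_dvd_pow h4) ⟨b, hb⟩
      exact hqZ.not_isUnit h5

theorem inSpan_of_mul_inSpan [hp : Fact p.Prime] (h : IsPureGenerator p a θ) (n : ℕ) (hn : n ≠ 0)
    (hprimes : ∀ q : ℕ, q.Prime → q ∣ n → (q : ℤ) ∣ ∏ i, a i) {x : K} (hx : IsIntegral ℤ x)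
    (hnx : InSpan p a θ ((n : K) * x)) : InSpan p a θ x := by
  induction n using induction_on_primes with
  | zero => exact absurd rfl hn
  | one => simpa using hnx
  | prime_mul q n hq IH =>
    refine IH (right_ne_zero_of_mul hn) (fun r hr hrn => hprimes r hr (hrn.mul_left _)) ?_
    obtain ⟨y, hy⟩ := hnx
    obtain ⟨i, -, hi⟩ := ((Nat.prime_iff_prime_int.1 hq).dvd_finsetProd_iff _).1
      (hprimes q hq (dvd_mul_right _ _))
    have hqK : (q : K) ≠ 0 := Nat.cast_ne_zero.2 hq.ne_zero
    have hdvd := h.prime_dvd_coeff hq hi (y := y) (z := (n : K) * x)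
      ((isIntegral_natCast n).mul hx) (by rw [← hy]; push_cast; ring)
    have hdvd' : ∀ k, ∃ t : ℤ, k < p → y k = q * t := fun k => by
      by_cases hk : k < p
      · obtain ⟨t, ht⟩ := hdvd k hk
        exact ⟨t, fun _ => ht⟩
      · exact ⟨0, fun h0 => absurd h0 hk⟩
    choose t ht using hdvd'
    refine ⟨t, mul_left_cancel₀ hqK ?_⟩
    rw [← mul_assoc, ← Nat.cast_mul, hy, Finset.mul_sum]
    refine Finset.sum_congr rfl fun k hk => ?_
    rw [ht k (Finset.mem_range.1 hk)]
    push_cast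
    ring

theorem prod_ne_zero (h : IsPureGenerator p a θ) : ∏ i, a i ≠ 0 :=
  Finset.prod_ne_zero_iff.2 fun i _ => h.carefree.ne_zero i

/-- If `p` divides `m`, then `α_0, …, α_{p-1}` is an integral basis. -/
theorem inSpan_of_dvd [hp : Fact p.Prime] (h : IsPureGenerator p a θ) (hp2 : 2 < p)
    (hpa : (p : ℤ) ∣ ∏ i, a i) {x : K} (hx : IsIntegral ℤ x) : InSpan p a θ x := by
  refine h.inSpan_of_mul_inSpan _ ?_ ?_ hx (inSpan_natAbs_mul (h.inSpan_mul_of_isIntegral hp2 hx))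
  · exact Int.natAbs_ne_zero.2
      (mul_ne_zero (Int.natCast_ne_zero.2 hp.out.ne_zero) h.prod_ne_zero)
  · intro q hq hqn
    have h1 : (q : ℤ) ∣ p * ∏ i, a i := Int.natCast_dvd.2 hqn
    rcases (Nat.prime_iff_prime_int.1 hq).dvd_or_dvd h1 with h2 | h2
    · rwa [(Nat.prime_dvd_prime_iff_eq hq hp.out).1 (Int.natCast_dvd_natCast.1 h2)]
    · exact h2

/-- The integral combinations of `α_0, …, α_{p-1}` have index a power of `p` and exponent at most
`p` in the ring of integers. -/
theorem inSpan_prime_mul [hp : Fact p.Prime] (h : IsPureGenerator p a θ) (hp2 : 2 < p)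
    {x : K} (hx : IsIntegral ℤ x) : InSpan p a θ ((p : K) * x) := by
  refine h.inSpan_of_mul_inSpan (∏ i, a i).natAbs (Int.natAbs_ne_zero.2 h.prod_ne_zero)
    (fun q _ hqn => Int.natCast_dvd.2 hqn)
    ((isIntegral_natCast p).mul hx) (inSpan_natAbs_mul ?_)
  have := h.inSpan_mul_of_isIntegral hp2 hx
  push_cast at this ⊢
  rwa [mul_left_comm, ← mul_assoc]

end IsPureGenerator

/-! ### Ramification of `p` when `p` does not divide `m` -/

theorem exists_one_add_pow_prime {R : Type*} [CommRing R] {p : ℕ} (hp : p.Prime) (x : R) :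
    ∃ t : R, (x + 1) ^ p = x ^ p + 1 + p * x * (1 + x * t) := by
  refine ⟨∑ k ∈ Finset.Ioo 1 p, x ^ (k - 2) * ((p.choose k / p : ℕ) : R), ?_⟩
  have hIoo : Finset.Ioo 0 p = insert 1 (Finset.Ioo 1 p) := by
    ext k
    have := hp.one_lt
    simp only [Finset.mem_Ioo, Finset.mem_insert]
    omega
  rw [add_pow_prime_eq hp, hIoo, Finset.sum_insert (by simp), Finset.mul_sum]
  have h1 : p.choose 1 / p = 1 := by rw [Nat.choose_one_right, Nat.div_self hp.pos]
  rw [h1]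
  simp only [one_pow, mul_one, Nat.sub_self, pow_zero, Nat.cast_one]
  congr 3
  refine Finset.sum_congr rfl fun k hk => ?_
  have hk1 := (Finset.mem_Ioo.1 hk).1
  rw [← mul_assoc, ← pow_succ']
  congr 3
  omega

theorem sub_one_pow_pred_eq_geom_sum {R : Type*} [CommRing R] {p : ℕ} [hp : Fact p.Prime]
    [CharP R p] (x : R) : (x - 1) ^ (p - 1) = ∑ k ∈ Finset.range p, x ^ k := by
  let := ZMod.algebra R p
  have key : (Polynomial.X - 1 : Polynomial (ZMod p)) ^ (p - 1) =
      ∑ k ∈ Finset.range p, Polynomial.X ^ k := by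
    have h0 : (Polynomial.X - 1 : Polynomial (ZMod p)) ≠ 0 := by
      simpa using Polynomial.X_sub_C_ne_zero (1 : ZMod p)
    refine mul_right_cancel₀ h0 ?_
    rw [geom_sum_mul, ← pow_succ, Nat.sub_add_cancel hp.out.pos, sub_pow_char, one_pow]
  have := congrArg (Polynomial.aeval x) key
  simpa using this

/-- The polynomials over a field that vanish at a nilpotent element are the multiples of a power of
`X`. -/
theorem X_pow_dvd_of_aeval_eq_zero {k R : Type*} [Field k] [CommRing R] [Algebra k R] {x : R}
    {n s : ℕ} (hn : x ^ n = 0) (hs : ∀ j < s, x ^ j ≠ 0) {F : Polynomial k}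
    (hF : Polynomial.aeval x F = 0) : Polynomial.X ^ s ∣ F := by
  have hint : IsIntegral k x := ⟨Polynomial.X ^ n, Polynomial.monic_X_pow n, by simp [hn]⟩
  obtain ⟨j, -, hj⟩ := (dvd_prime_pow Polynomial.prime_X n).1
    (minpoly.dvd k x (p := Polynomial.X ^ n) (by simp [hn]))
  have hmin : minpoly k x = Polynomial.X ^ j :=
    Polynomial.eq_of_monic_of_associated (minpoly.monic hint) (Polynomial.monic_X_pow j) hj
  have hxj : x ^ j = 0 := by
    have := minpoly.aeval k x
    rwa [hmin, map_pow, Polynomial.aeval_X] at this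
  have hsj : s ≤ j := by
    by_contra hlt
    exact hs j (by omega) hxj
  exact (pow_dvd_pow _ hsj).trans (hmin ▸ minpoly.dvd k x hF)

theorem isIntegral_of_quadratic {K : Type*} [Field K] {g s : 𝓞 K} {u : K} (h : u ^ 2 - g * u - s = 0) :
    IsIntegral ℤ u := by
  refine isIntegral_trans (A := 𝓞 K) u
    ⟨Polynomial.X ^ 2 - Polynomial.C g * Polynomial.X - Polynomial.C s, by monicity!, ?_⟩
  simpa using h

theorem exists_ringOfIntegers {K : Type*} [Field K] {x : K} (hx : IsIntegral ℤ x) :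
    ∃ X : 𝓞 K, algebraMap (𝓞 K) K X = x := ⟨⟨x, hx⟩, rfl⟩

section

variable {K : Type*} [Field K] [NumberField K]

theorem int_dvd_of_dvd_ringOfIntegers {u v : ℤ} (h : (v : 𝓞 K) ∣ (u : 𝓞 K)) : v ∣ u := by
  obtain ⟨x, hx⟩ := h
  refine int_dvd_of_isIntegral (K := K) (RingOfIntegers.isIntegral_coe x) ?_
  have := congrArg (fun t : 𝓞 K => (t : K)) hx
  simpa using this

/-- If `(ρ + 1) ^ p = 1 + p n` and `p` divides `ρ ^ (p - 1)`, then `ρ` divides `n`, so that `p`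
divides `n ^ (p - 1)`. -/
theorem prime_dvd_of_dvd_pow_pred {p : ℕ} [hp : Fact p.Prime] {ρ : 𝓞 K} {n : ℤ}
    (hρ : (ρ + 1) ^ p = 1 + p * n) (hdvd : (p : 𝓞 K) ∣ ρ ^ (p - 1)) : (p : ℤ) ∣ n := by
  obtain ⟨t, ht⟩ := exists_one_add_pow_prime hp.out ρ
  obtain ⟨τ, hτ⟩ := hdvd
  have hp0 : (p : 𝓞 K) ≠ 0 := Nat.cast_ne_zero.2 hp.out.ne_zero
  have hpow : ρ ^ p = ρ ^ (p - 1) * ρ := by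
    rw [← pow_succ, Nat.sub_add_cancel hp.out.pos]
  have h1 : ρ * (τ + 1 + ρ * t) = n := by
    refine mul_left_cancel₀ hp0 ?_
    rw [hρ, hpow, hτ] at ht
    linear_combination -ht
  have h2 : (p : 𝓞 K) ∣ (n : 𝓞 K) ^ (p - 1) :=
    ⟨τ * (τ + 1 + ρ * t) ^ (p - 1), by rw [← h1, mul_pow, hτ]; ring⟩
  have h3 : (p : ℤ) ∣ n ^ (p - 1) := by
    refine int_dvd_of_dvd_ringOfIntegers (K := K) ?_
    push_cast
    exact h2
  exact (Nat.prime_iff_prime_int.1 hp.out).dvd_of_dvd_pow h3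

/-- If `(ρ + 1) ^ p ≡ 1` modulo `p ^ 2`, then `ρ ^ (p - 1) / p` is integral. -/
theorem prime_dvd_pow_pred {p : ℕ} [hp : Fact p.Prime] {ρ : 𝓞 K} {n : ℤ} (hp2 : 2 < p)
    (hρ : (ρ + 1) ^ p = 1 + p ^ 2 * n) : (p : 𝓞 K) ∣ ρ ^ (p - 1) := by
  obtain ⟨t, ht⟩ := exists_one_add_pow_prime hp.out ρ
  have hp0 : (p : K) ≠ 0 := Nat.cast_ne_zero.2 hp.out.ne_zero
  have hpow : (ρ : K) ^ p = (ρ : K) ^ (p - 1) * ρ := by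
    rw [← pow_succ, Nat.sub_add_cancel hp.out.pos]
  have hpow' : (ρ : K) ^ (p - 1) = ρ * (ρ : K) ^ (p - 2) := by
    rw [← pow_succ']; congr 1; omega
  rw [hρ] at ht
  have htK : (1 : K) + p ^ 2 * n = ρ ^ p + 1 + p * ρ * (1 + ρ * t) := by
    have := congrArg (fun t : 𝓞 K => (t : K)) ht
    simpa using this
  -- `u ρ = p n`, so that `u` satisfies a monic quadratic equation.
  set w : K := (ρ : K) ^ (p - 1) / p with hw
  have hpw : p * w = (ρ : K) ^ (p - 1) := by rw [hw]; field_simp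
  set u : K := w + 1 + ρ * t with hu
  have huρ : u * ρ = p * n := by
    refine mul_left_cancel₀ hp0 ?_
    rw [hpow, ← hpw] at htK
    rw [hu]
    linear_combination -htK
  have hquad : u ^ 2 - ((1 + ρ * t : 𝓞 K) : K) * u - ((n * ρ ^ (p - 2) : 𝓞 K) : K) = 0 := by
    have h1 : u * w = n * (ρ : K) ^ (p - 2) := by
      refine mul_left_cancel₀ hp0 ?_
      rw [mul_left_comm, hpw, hpow']
      linear_combination (ρ : K) ^ (p - 2) * huρ
    simp only [map_mul, map_add, map_one, map_intCast, map_pow]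
    have h2 : u * w = u ^ 2 - (1 + (ρ : K) * t) * u := by
      rw [hu]; ring
    rw [← h1, h2]
    ring
  have huint := isIntegral_of_quadratic hquad
  have hwint : IsIntegral ℤ w := by
    have : w = u - ((1 + ρ * t : 𝓞 K) : K) := by
      simp only [map_mul, map_add, map_one]
      rw [hu]; ring
    rw [this]
    exact huint.sub (RingOfIntegers.isIntegral_coe _)
  obtain ⟨W, hW⟩ := exists_ringOfIntegers hwint
  refine ⟨W, ?_⟩
  apply RingOfIntegers.coe_injective
  rw [map_pow, map_mul, map_natCast, hW]
  exact hpw.symm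

/-- If `(ρ + 1) ^ p ≡ 1` modulo `p ^ 2`, then `p` divides `ρ ^ (p - 2)` only if it divides `ρ`. -/
theorem prime_dvd_of_dvd_pow_sub_two {p : ℕ} [hp : Fact p.Prime] {ρ : 𝓞 K} {n : ℤ} (hp2 : 2 < p)
    (hρ : (ρ + 1) ^ p = 1 + p ^ 2 * n) (hdvd : (p : 𝓞 K) ∣ ρ ^ (p - 2)) : (p : 𝓞 K) ∣ ρ := by
  obtain ⟨t, ht⟩ := exists_one_add_pow_prime hp.out ρ
  obtain ⟨τ, hτ⟩ := hdvd
  have hp0 : (p : 𝓞 K) ≠ 0 := Nat.cast_ne_zero.2 hp.out.ne_zero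
  have hpow : ρ ^ p = ρ ^ (p - 2) * ρ ^ 2 := by
    rw [← pow_add]; congr 1; omega
  rw [hρ, hpow, hτ] at ht
  have h1 : ρ * (1 + ρ * (τ + t)) = p * n := by
    refine mul_left_cancel₀ hp0 ?_
    linear_combination -ht
  -- Modulo `p` the second factor is a unit, because `ρ` is nilpotent.
  have h2 : (∑ i ∈ Finset.range p, (-(ρ * (τ + t))) ^ i) * (-(ρ * (τ + t)) - 1) =
      (-(ρ * (τ + t))) ^ p - 1 := geom_sum_mul _ _
  have h3 : ρ = p * n * (∑ i ∈ Finset.range p, (-(ρ * (τ + t))) ^ i) +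
      ρ * (-(ρ * (τ + t))) ^ p := by
    linear_combination ρ * h2 + (∑ i ∈ Finset.range p, (-(ρ * (τ + t))) ^ i) * h1
  rw [h3]
  refine dvd_add (Dvd.intro _ (mul_assoc _ _ _).symm) (Dvd.dvd.mul_left ?_ _)
  rw [neg_pow, mul_pow, hpow, hτ]
  exact Dvd.intro (τ * ρ ^ 2 * (τ + t) ^ p * (-1) ^ p) (by ring)

end

namespace IsPureGenerator

variable {p : ℕ} [hp : Fact p.Prime] {K : Type*} [Field K] [NumberField K] {a : Fin (p - 1) → ℤ}
  {θ : K}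

theorem isIntegral (h : IsPureGenerator p a θ) : IsIntegral ℤ θ := by
  refine IsIntegral.of_pow hp.out.pos ?_
  rw [h.pow_eq]
  exact isIntegral_intCast _

theorem not_dvd_denom {p : ℕ} (hp : p.Prime) {n : ℕ} {a : Fin n → ℤ}
    (hpm : ¬ (p : ℤ) ∣ pureRadicand a) (k : ℕ) : ¬ (p : ℤ) ∣ pureDenom p a k := by
  intro hk
  have hpZ := Nat.prime_iff_prime_int.1 hp
  obtain ⟨i, -, hi⟩ := (hpZ.dvd_finsetProd_iff _).1 hk
  exact hpm ((hpZ.dvd_of_dvd_pow hi).trans ((dvd_pow_self _ (Nat.succ_ne_zero _)).trans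
    (Finset.dvd_prod_of_mem (fun i : Fin n => a i ^ ((i : ℕ) + 1)) (Finset.mem_univ i))))

/-- The trace of `(ε θ - 1) ^ 2` is `p`, which is not divisible by `p ^ 2`. -/
theorem not_dvd_sub_one (h : IsPureGenerator p a θ) (hp2 : 2 < p) (ε : ℤ) {ρ : 𝓞 K}
    (hρ : (ρ : K) = ε * θ - 1) : ¬ (p : 𝓞 K) ∣ ρ := by
  rintro ⟨τ, rfl⟩
  have hp0 : (p : ℚ) ≠ 0 := Nat.cast_ne_zero.2 hp.out.ne_zero
  obtain ⟨n, hn⟩ := exists_int_trace ((RingOfIntegers.isIntegral_coe τ).pow 2)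
  have h1 : Algebra.trace ℚ K (((ε : K) * θ - 1) ^ 2) = p := by
    have : ((ε : K) * θ - 1) ^ 2 =
        (((ε ^ 2 : ℤ) : ℚ) : K) * θ ^ 2 + ((-2 * ε : ℤ) : ℚ) * θ ^ 1 + ((1 : ℤ) : K) := by
      push_cast; ring
    rw [this, map_add, map_add, trace_ratCast_mul, trace_ratCast_mul, h.trace_intCast,
      h.trace_pow hp2 (Nat.not_dvd_of_pos_of_lt (by omega) hp2),
      h.trace_pow hp2 (Nat.not_dvd_of_pos_of_lt (by omega) (by omega))]
    push_cast
    ring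
  have h2 : Algebra.trace ℚ K (((ε : K) * θ - 1) ^ 2) = p ^ 2 * n := by
    rw [← hρ, ← hn, RingOfIntegers.coe_eq_algebraMap, map_mul, map_natCast, mul_pow]
    have := trace_ratCast_mul (K := K) ((p : ℚ) ^ 2) ((τ : K) ^ 2)
    push_cast at this
    exact this
  have h3 : (p : ℚ) * n = 1 := by
    have := h1.symm.trans h2
    field_simp at this
    linarith
  have h4 : (p : ℤ) ∣ 1 := ⟨n, by exact_mod_cast h3.symm⟩
  exact (Nat.prime_iff_prime_int.1 hp.out).not_dvd_one h4

theorem natCast_mem_nonunits (p : ℕ) [hp : Fact p.Prime] (K : Type*) [Field K] [NumberField K] :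
    (p : 𝓞 K) ∈ nonunits (𝓞 K) := by
  intro hu
  have : (p : ℤ) ∣ 1 := int_dvd_of_dvd_ringOfIntegers (K := K) (by simpa using hu.dvd)
  exact (Nat.prime_iff_prime_int.1 hp.out).not_dvd_one this

theorem mk_eq_zero_iff {p : ℕ} {K : Type*} [Field K] [NumberField K] (x : 𝓞 K) :
    Ideal.Quotient.mk (Ideal.span {(p : 𝓞 K)}) x = 0 ↔ (p : 𝓞 K) ∣ x := by
  rw [Ideal.Quotient.eq_zero_iff_mem, Ideal.mem_span_singleton]

/-- Let `p ∤ m` and let `s` be the least exponent with `p ∣ ρ ^ s`, where `ρ = ε θ - 1`. A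
combination `∑ y_k α_k` that is divisible by `p` gives a polynomial `F` over `𝔽_p`, of degree less
than `p` and divisible by `X ^ s`, such that `y_k / b_k` are the coefficients of `F(ε X - 1)`. -/
theorem exists_polynomial (h : IsPureGenerator p a θ) (hpm : ¬ (p : ℤ) ∣ pureRadicand a) {ε : ℤ}
    (hε : (p : ℤ) ∣ pureRadicand a * ε - 1) {ρ : 𝓞 K} (hρ : (ρ : K) = ε * θ - 1) {N s : ℕ}
    (hN : (p : 𝓞 K) ∣ ρ ^ N) (hs : ∀ j < s, ¬ (p : 𝓞 K) ∣ ρ ^ j) {y : ℕ → ℤ} {x : K}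
    (hx : IsIntegral ℤ x)
    (hyx : (p : K) * x = ∑ k ∈ Finset.range p, (y k : K) * pureElt p a θ k) :
    ∃ F : Polynomial (ZMod p), Polynomial.X ^ s ∣ F ∧ F.natDegree < p ∧ ∀ k < p,
      (y k : ZMod p) = (pureDenom p a k : ℤ) *
        (F.comp (Polynomial.C (ε : ZMod p) * Polynomial.X - 1)).coeff k := by
  have : CharP (𝓞 K ⧸ Ideal.span {(p : 𝓞 K)}) p :=
    CharP.quotient (𝓞 K) p (natCast_mem_nonunits p K)
  let := ZMod.algebra (𝓞 K ⧸ Ideal.span {(p : 𝓞 K)}) p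
  set π := Ideal.Quotient.mk (Ideal.span {(p : 𝓞 K)}) with hπ
  have halg : ∀ n : ℤ, algebraMap (ZMod p) (𝓞 K ⧸ Ideal.span {(p : 𝓞 K)}) n = π n := fun n => by
    rw [map_intCast, map_intCast]
  set b : ℕ → ZMod p := fun k => ((pureDenom p a k : ℤ) : ZMod p) with hb
  have hb0 : ∀ k, b k ≠ 0 := fun k hk =>
    not_dvd_denom hp.out hpm k ((ZMod.intCast_zmod_eq_zero_iff_dvd _ p).1 hk)
  set m : ZMod p := ((pureRadicand a : ℤ) : ZMod p) with hm
  have hmε : m * (ε : ZMod p) = 1 := by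
    have := (ZMod.intCast_zmod_eq_zero_iff_dvd _ p).2 hε
    push_cast at this
    exact sub_eq_zero.1 this
  obtain ⟨Θ, hΘ⟩ := exists_ringOfIntegers h.isIntegral
  choose A hA using fun k => exists_ringOfIntegers (h.isIntegral_pureElt k)
  obtain ⟨x', hx'⟩ := exists_ringOfIntegers hx
  have hρΘ : ρ + 1 = ε * Θ := by
    apply RingOfIntegers.coe_injective
    simp [hρ, hΘ]
  have hbA : ∀ k, π (Θ ^ k) = algebraMap (ZMod p) _ (b k) * π (A k) := by
    intro k
    rw [hb, halg, ← map_mul]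
    congr 1
    apply RingOfIntegers.coe_injective
    have := h.denom_mul_pureElt k
    simpa [hΘ, hA] using this.symm
  set f : Polynomial (ZMod p) :=
    ∑ k ∈ Finset.range p, Polynomial.C ((y k : ZMod p) * (b k)⁻¹) * Polynomial.X ^ k with hf
  have hfcoeff : ∀ k < p, f.coeff k = (y k : ZMod p) * (b k)⁻¹ := by
    intro k hk
    simp only [hf, Polynomial.finsetSum_coeff, Polynomial.coeff_C_mul, Polynomial.coeff_X_pow]
    rw [Finset.sum_eq_single k]
    · simp
    · intro l _ hl
      rw [if_neg (Ne.symm hl), mul_zero]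
    · intro h0
      exact absurd (Finset.mem_range.2 hk) h0
  have hfdeg : f.natDegree < p := by
    refine lt_of_le_of_lt (Polynomial.natDegree_sum_le_of_forall_le (n := p - 1) _ _ ?_)
      (Nat.sub_lt hp.out.pos one_pos)
    intro k hk
    have := Finset.mem_range.1 hk
    exact (Polynomial.natDegree_C_mul_X_pow_le _ _).trans (by omega)
  have hfroot : Polynomial.aeval (π Θ) f = 0 := by
    have h1 : Polynomial.aeval (π Θ) f = π (∑ k ∈ Finset.range p, (y k : 𝓞 K) * A k) := by
      rw [hf, map_sum, map_sum]
      refine Finset.sum_congr rfl fun k _ => ?_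
      rw [map_mul, map_pow, Polynomial.aeval_X, Polynomial.aeval_C, ← map_pow, hbA, map_mul, halg,
        map_mul π, mul_assoc, ← mul_assoc (algebraMap _ _ (b k)⁻¹), ← map_mul,
        inv_mul_cancel₀ (hb0 k), map_one, one_mul]
    rw [h1, mk_eq_zero_iff]
    refine ⟨x', ?_⟩
    apply RingOfIntegers.coe_injective
    simpa [hA, hx'] using hyx.symm
  refine ⟨f.comp (Polynomial.C m * (Polynomial.X + 1)), ?_, ?_, ?_⟩
  · refine X_pow_dvd_of_aeval_eq_zero (x := π ρ) (n := N) ?_ ?_ ?_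
    · rw [← map_pow, mk_eq_zero_iff]
      exact hN
    · intro j hj
      rw [← map_pow, Ne, mk_eq_zero_iff]
      exact hs j hj
    · rw [Polynomial.aeval_comp]
      have : Polynomial.aeval (π ρ) (Polynomial.C m * (Polynomial.X + 1)) = π Θ := by
        rw [map_mul, map_add, Polynomial.aeval_X, Polynomial.aeval_C, map_one, ← map_one π,
          ← map_add, hρΘ, map_mul, ← halg, ← mul_assoc, ← map_mul, hmε, map_one, one_mul]
      rw [this, hfroot]
  · refine lt_of_le_of_lt Polynomial.natDegree_comp_le ?_
    have h1 : (Polynomial.C m * (Polynomial.X + 1)).natDegree ≤ 1 := by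
      refine (Polynomial.natDegree_C_mul_le _ _).trans ?_
      compute_degree
    calc f.natDegree * _ ≤ f.natDegree * 1 := Nat.mul_le_mul_left _ h1
      _ < p := by rwa [mul_one]
  · intro k hk
    have h1 : (Polynomial.C m * (Polynomial.X + 1)).comp
        (Polynomial.C (ε : ZMod p) * Polynomial.X - 1) = Polynomial.X := by
      simp only [Polynomial.mul_comp, Polynomial.C_comp, Polynomial.add_comp, Polynomial.X_comp,
        Polynomial.one_comp, sub_add_cancel]
      rw [← mul_assoc, ← Polynomial.C_mul, hmε, Polynomial.C_1, one_mul]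
    rw [Polynomial.comp_assoc, h1, Polynomial.comp_X, hfcoeff k hk]
    change _ = b k * _
    rw [mul_left_comm, mul_inv_cancel₀ (hb0 k), mul_one]

end IsPureGenerator

/-! ### The two integral bases -/

namespace IsPureGenerator

variable {p : ℕ} {K : Type*} [Field K] [NumberField K] {a : Fin (p - 1) → ℤ} {θ : K}

/-- The elements `α_0, …, α_{p-1}` form an integral basis. -/
def HasWildBasis (p : ℕ) (a : Fin (p - 1) → ℤ) (θ : K) : Prop :=
  ∀ x : K, IsIntegral ℤ x → InSpan p a θ x

/-- The ring of integers is generated by `α_0, …, α_{p-1}` and `(∑ b_k ε ^ k α_k) / p`, where `ε`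
is an inverse of `m` modulo `p`. -/
def HasTameBasis (p : ℕ) (a : Fin (p - 1) → ℤ) (θ : K) : Prop :=
  ¬ (p : ℤ) ∣ pureRadicand a ∧ ∀ ε : ℤ, ((pureRadicand a : ℤ) : ZMod p) * (ε : ZMod p) = 1 →
    ∀ x : K, IsIntegral ℤ x ↔ ∃ (y : ℕ → ℤ) (z : ℤ),
      (p : K) * x = ∑ k ∈ Finset.range p, (y k : K) * pureElt p a θ k ∧
      ∀ k < p, (y k : ZMod p) = z * (pureDenom p a k : ℤ) * (ε : ZMod p) ^ k

variable [hp : Fact p.Prime]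

theorem dvd_prod_of_dvd_radicand {p : ℕ} (hp : p.Prime) {n : ℕ} {a : Fin n → ℤ}
    (hpm : (p : ℤ) ∣ pureRadicand a) : (p : ℤ) ∣ ∏ i, a i := by
  have hpZ := Nat.prime_iff_prime_int.1 hp
  obtain ⟨i, -, hi⟩ := (hpZ.dvd_finsetProd_iff _).1 hpm
  exact (hpZ.dvd_of_dvd_pow hi).trans (Finset.dvd_prod_of_mem a (Finset.mem_univ i))

theorem not_dvd_prod_of_not_dvd_radicand {p : ℕ} (hp : p.Prime) {n : ℕ} {a : Fin n → ℤ}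
    (hpm : ¬ (p : ℤ) ∣ pureRadicand a) : ¬ (p : ℤ) ∣ ∏ i, a i := by
  intro h
  have hpZ := Nat.prime_iff_prime_int.1 hp
  obtain ⟨i, -, hi⟩ := (hpZ.dvd_finsetProd_iff _).1 h
  exact hpm ((hi.trans (dvd_pow_self _ (Nat.succ_ne_zero _))).trans
    (Finset.dvd_prod_of_mem (fun i : Fin n => a i ^ ((i : ℕ) + 1)) (Finset.mem_univ i)))

theorem exists_int_mul_eq_one {p : ℕ} [Fact p.Prime] {n : ℤ} (hn : ¬ (p : ℤ) ∣ n) :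
    ∃ ε : ℤ, (n : ZMod p) * (ε : ZMod p) = 1 := by
  obtain ⟨ε, hε⟩ := ZMod.intCast_surjective ((n : ZMod p)⁻¹)
  refine ⟨ε, ?_⟩
  rw [hε, mul_inv_cancel₀]
  exact fun h0 => hn ((ZMod.intCast_zmod_eq_zero_iff_dvd _ p).1 h0)

/-- When `p ∤ m`, the shape of the ring of integers at `p` depends on whether
`(ε θ) ^ p = ε ^ p m` is congruent to `1` modulo `p ^ 2`. -/
theorem hasWildBasis_or_hasTameBasis (h : IsPureGenerator p a θ) (hp2 : 2 < p) :
    HasWildBasis p a θ ∨ HasTameBasis p a θ := by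
  by_cases hpm : (p : ℤ) ∣ pureRadicand a
  · exact Or.inl fun x hx => h.inSpan_of_dvd hp2 (dvd_prod_of_dvd_radicand hp.out hpm) hx
  obtain ⟨ε, hε⟩ := exists_int_mul_eq_one hpm
  have hε' : (p : ℤ) ∣ pureRadicand a * ε - 1 := by
    rw [← ZMod.intCast_zmod_eq_zero_iff_dvd]
    push_cast
    rw [hε, sub_self]
  obtain ⟨n, hn⟩ : (p : ℤ) ∣ ε ^ p * pureRadicand a - 1 := by
    rw [← ZMod.intCast_zmod_eq_zero_iff_dvd]
    push_cast
    rw [ZMod.pow_card, mul_comm, hε, sub_self]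
  obtain ⟨Θ, hΘ⟩ := exists_ringOfIntegers h.isIntegral
  set ρ : 𝓞 K := ε * Θ - 1 with hρdef
  have hρ : algebraMap (𝓞 K) K ρ = ε * θ - 1 := by simp [hρdef, hΘ]
  have hΘp : Θ ^ p = ((pureRadicand a : ℤ) : 𝓞 K) := by
    apply RingOfIntegers.coe_injective
    rw [map_pow, hΘ, h.pow_eq, map_intCast]
  have hρp : (ρ + 1) ^ p = 1 + p * n := by
    have h1 : ((ε ^ p * pureRadicand a : ℤ) : 𝓞 K) = 1 + p * n := by
      rw [eq_add_of_sub_eq' hn]; push_cast; ring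
    rw [← h1, hρdef, sub_add_cancel, mul_pow, hΘp]
    push_cast
    ring
  have hmono : ∀ {i j : ℕ}, i ≤ j → (p : 𝓞 K) ∣ ρ ^ i → (p : 𝓞 K) ∣ ρ ^ j := fun hij hi =>
    hi.trans (pow_dvd_pow _ hij)
  by_cases hpn : (p : ℤ) ∣ n
  · right
    obtain ⟨n', rfl⟩ := hpn
    have hρp' : (ρ + 1) ^ p = 1 + p ^ 2 * n' := by rw [hρp]; push_cast; ring
    have hdvd := prime_dvd_pow_pred hp2 hρp'
    have hs : ∀ j < p - 1, ¬ (p : 𝓞 K) ∣ ρ ^ j := fun j hj hd =>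
      h.not_dvd_sub_one hp2 ε hρ
        (prime_dvd_of_dvd_pow_sub_two hp2 hρp' (hmono (by omega) hd))
    refine ⟨hpm, fun ε' hε'' x => ?_⟩
    have hεε : (ε' : ZMod p) = (ε : ZMod p) := by
      rw [eq_inv_of_mul_eq_one_right hε'', eq_inv_of_mul_eq_one_right hε]
    rw [hεε]
    constructor
    · intro hx
      obtain ⟨y, hy⟩ := h.inSpan_prime_mul hp2 hx
      obtain ⟨F, ⟨G, rfl⟩, hdeg, hF⟩ := h.exists_polynomial hpm hε' hρ hdvd hs hx hy
      obtain ⟨c, rfl⟩ : ∃ c, G = Polynomial.C c := by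
        by_cases hG : G = 0
        · exact ⟨0, by rw [hG, Polynomial.C_0]⟩
        · rw [Polynomial.natDegree_mul (pow_ne_zero _ Polynomial.X_ne_zero) hG,
            Polynomial.natDegree_X_pow] at hdeg
          exact ⟨_, Polynomial.eq_C_of_natDegree_eq_zero (by omega)⟩
      obtain ⟨z, rfl⟩ := ZMod.intCast_surjective c
      refine ⟨y, z, hy, fun k hk => ?_⟩
      rw [hF k hk, Polynomial.mul_comp, Polynomial.pow_comp, Polynomial.X_comp,
        Polynomial.C_comp, sub_one_pow_pred_eq_geom_sum, Polynomial.coeff_mul_C,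
        Polynomial.finsetSum_coeff, Finset.sum_eq_single k]
      · rw [mul_pow, ← Polynomial.C_pow, Polynomial.coeff_C_mul_X_pow, if_pos rfl]
        ring
      · intro l _ hl
        rw [mul_pow, ← Polynomial.C_pow, Polynomial.coeff_C_mul_X_pow, if_neg (Ne.symm hl)]
      · intro h0
        exact absurd (Finset.mem_range.2 hk) h0
    · rintro ⟨y, z, hy, hyz⟩
      have hp0 : (p : K) ≠ 0 := Nat.cast_ne_zero.2 hp.out.ne_zero
      have hgeom : (p : 𝓞 K) ∣ ∑ k ∈ Finset.range p, (ε * Θ) ^ k := by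
        have : CharP (𝓞 K ⧸ Ideal.span {(p : 𝓞 K)}) p := CharP.quotient (𝓞 K) p (natCast_mem_nonunits p K)
        rw [← mk_eq_zero_iff, map_sum]
        simp only [map_pow]
        rw [← sub_one_pow_pred_eq_geom_sum (p := p), ← map_one (Ideal.Quotient.mk _), ← map_sub,
          ← map_pow, mk_eq_zero_iff]
        exact hdvd
      obtain ⟨w, hw⟩ := hgeom
      have hwK : ∑ k ∈ Finset.range p, ((ε : K) * θ) ^ k = p * algebraMap (𝓞 K) K w := by
        have := congrArg (algebraMap (𝓞 K) K) hw
        simpa [hΘ] using this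
      have ht : ∀ k, ∃ t : ℤ, k < p → y k = z * pureDenom p a k * ε ^ k + p * t := fun k => by
        by_cases hk : k < p
        · have h1 := hyz k hk
          rw [← sub_eq_zero] at h1
          obtain ⟨t, ht⟩ := (ZMod.intCast_zmod_eq_zero_iff_dvd
            (y k - z * pureDenom p a k * ε ^ k) p).1 (by push_cast; exact h1)
          exact ⟨t, fun _ => by rw [← ht]; ring⟩
        · exact ⟨0, fun h0 => absurd h0 hk⟩
      choose t ht using ht
      have hx : x = z * algebraMap (𝓞 K) K w +
          ∑ k ∈ Finset.range p, (t k : K) * pureElt p a θ k := by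
        refine mul_left_cancel₀ hp0 ?_
        rw [hy, mul_add, mul_left_comm, ← hwK, Finset.mul_sum, Finset.mul_sum,
          ← Finset.sum_add_distrib]
        refine Finset.sum_congr rfl fun k hk => ?_
        rw [ht k (Finset.mem_range.1 hk), mul_pow, ← h.denom_mul_pureElt k]
        push_cast
        ring
      rw [hx]
      exact ((isIntegral_intCast z).mul (RingOfIntegers.isIntegral_coe w)).add
        (IsIntegral.sum _ fun k _ => (isIntegral_intCast (t k)).mul (h.isIntegral_pureElt k))
  · left
    have hs : ∀ j < p, ¬ (p : 𝓞 K) ∣ ρ ^ j := fun j hj hd =>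
      hpn (prime_dvd_of_dvd_pow_pred hρp (hmono (by omega) hd))
    have hdvd : (p : 𝓞 K) ∣ ρ ^ p := by
      obtain ⟨t, ht⟩ := exists_one_add_pow_prime hp.out ρ
      exact ⟨n - ρ * (1 + ρ * t), by linear_combination hρp - ht⟩
    intro x hx
    obtain ⟨y, hy⟩ := h.inSpan_prime_mul hp2 hx
    obtain ⟨F, ⟨G, rfl⟩, hdeg, hF⟩ := h.exists_polynomial hpm hε' hρ hdvd hs hx hy
    have hG : G = 0 := by
      by_contra hG
      rw [Polynomial.natDegree_mul (pow_ne_zero _ Polynomial.X_ne_zero) hG,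
        Polynomial.natDegree_X_pow] at hdeg
      omega
    have ht : ∀ k, ∃ t : ℤ, k < p → y k = p * t := fun k => by
      by_cases hk : k < p
      · have h1 := hF k hk
        rw [hG, mul_zero, Polynomial.zero_comp, Polynomial.coeff_zero, mul_zero] at h1
        obtain ⟨t, ht⟩ := (ZMod.intCast_zmod_eq_zero_iff_dvd (y k) p).1 h1
        exact ⟨t, fun _ => ht⟩
      · exact ⟨0, fun h0 => absurd h0 hk⟩
    choose t ht using ht
    refine ⟨t, mul_left_cancel₀ (Nat.cast_ne_zero.2 hp.out.ne_zero : (p : K) ≠ 0) ?_⟩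
    rw [hy, Finset.mul_sum]
    refine Finset.sum_congr rfl fun k hk => ?_
    rw [ht k (Finset.mem_range.1 hk)]
    push_cast
    ring

/-! ### The discriminant at `p` -/

/-- For the basis `α_0, …, α_{p-1}` every trace of an integer is divisible by `p`. -/
theorem isWildAt_of_hasWildBasis (h : IsPureGenerator p a θ) (hp2 : 2 < p)
    (hw : HasWildBasis p a θ) : IsWildAt p K := by
  have hrank : finrank ℤ (𝓞 K) = p := by rw [RingOfIntegers.rank, h.finrank_eq]
  let ω := Module.finBasisOfFinrankEq ℤ (𝓞 K) hrank
  have htr : ∀ x : 𝓞 K, (p : ℤ) ∣ Algebra.trace ℤ (𝓞 K) x := by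
    intro x
    obtain ⟨y, hy⟩ := hw x (RingOfIntegers.isIntegral_coe x)
    refine ⟨y 0, ?_⟩
    have h1 := h.trace_sum hp2 fun k => (y k : ℚ)
    simp only [Rat.cast_intCast] at h1
    have h2 := Algebra.coe_trace_int x
    rw [hy, h1] at h2
    exact_mod_cast h2
  choose t ht using htr
  have hmat : Algebra.traceMatrix ℤ ω =
      (p : ℤ) • Matrix.of fun i j => t (ω i * ω j) := by
    ext i j
    rw [Algebra.traceMatrix_apply, Algebra.traceForm_apply, ht]
    rfl
  unfold IsWildAt
  rw [← NumberField.discr_eq_discr K ω, Algebra.discr_def, hmat, Matrix.det_smul, Fintype.card_fin]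
  exact dvd_mul_right _ _

/-- The discriminant of `α_0, …, α_{p-1}` is `± p ^ p (∏ a_i) ^ (p - 1)`: the trace form pairs
`α_k` with `α_{p-k}`. -/
theorem natAbs_discr_pureElt (h : IsPureGenerator p a θ) (hp2 : 2 < p) {A : Fin p → 𝓞 K}
    (hA : ∀ k : Fin p, algebraMap (𝓞 K) K (A k) = pureElt p a θ k) :
    (Algebra.discr ℤ A).natAbs = p ^ p * (∏ i, a i).natAbs ^ (p - 1) := by
  have : NeZero p := ⟨hp.out.ne_zero⟩
  have hentry : ∀ j k : Fin p, Algebra.traceMatrix ℤ A j (Equiv.neg (Fin p) k) =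
      Matrix.diagonal (fun k : Fin p => if k = 0 then (p : ℤ) else p * ∏ i, a i) j k := by
    intro j k
    have h1 : ((Algebra.traceMatrix ℤ A j (Equiv.neg (Fin p) k) : ℤ) : ℚ) =
        Algebra.trace ℚ K (pureElt p a θ j * pureElt p a θ (-k : Fin p)) := by
      rw [Algebra.traceMatrix_apply, Algebra.traceForm_apply, Algebra.coe_trace_int,
        RingOfIntegers.coe_eq_algebraMap, map_mul, hA, hA]
      rfl
    have hinj : Function.Injective ((↑) : ℤ → ℚ) := Int.cast_injective
    apply hinj
    rw [h1]
    by_cases hjk : j = k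
    · subst hjk
      rw [Matrix.diagonal_apply_eq]
      by_cases hj : j = 0
      · subst hj
        rw [if_pos rfl, neg_zero, Fin.val_zero, pureElt_zero, mul_one, ← Int.cast_one,
          h.trace_intCast]
        simp
      · have hj0 : 0 < (j : ℕ) := Nat.pos_of_ne_zero fun h0 => hj (Fin.ext h0)
        have hneg : ((-j : Fin p) : ℕ) = p - j := by
          rw [Fin.val_neg, if_neg hj]
        rw [if_neg hj, hneg, h.trace_pureElt_mul_reflect hj0 j.2]
        push_cast
        ring
    · rw [Matrix.diagonal_apply_ne _ hjk, h.trace_pureElt_mul hp2, Int.cast_zero]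
      intro hdvd
      have h2 : j + -k = 0 := by
        apply Fin.ext
        rw [Fin.val_add, Fin.val_zero]
        exact Nat.mod_eq_zero_of_dvd hdvd
      exact hjk (add_neg_eq_zero.1 h2)
  have hsub : (Algebra.traceMatrix ℤ A).submatrix id (Equiv.neg (Fin p)) =
      Matrix.diagonal (fun k : Fin p => if k = 0 then (p : ℤ) else p * ∏ i, a i) := by
    ext j k
    exact hentry j k
  have hdet := Matrix.det_permute' (Equiv.neg (Fin p)) (Algebra.traceMatrix ℤ A)
  rw [hsub, Matrix.det_diagonal] at hdet
  have hprod : ∏ k : Fin p, (if k = 0 then (p : ℤ) else p * ∏ i, a i) =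
      p * (p * ∏ i, a i) ^ (p - 1) := by
    rw [← Finset.mul_prod_erase _ _ (Finset.mem_univ (0 : Fin p)), if_pos rfl,
      Finset.prod_congr rfl (fun k hk => if_neg (Finset.ne_of_mem_erase hk)), Finset.prod_const,
      Finset.card_erase_of_mem (Finset.mem_univ _), Finset.card_univ, Fintype.card_fin]
  have habs := congrArg Int.natAbs hdet
  rw [hprod, Int.natAbs_mul, Int.natAbs_mul, Int.natAbs_pow, Int.natAbs_mul, Int.natAbs_natCast,
    Int.cast_id, Int.natAbs_of_isUnit (Units.isUnit _), one_mul, ← Algebra.discr_def] at habs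
  rw [← habs, mul_pow, ← mul_assoc, ← pow_succ', Nat.sub_add_cancel hp.out.pos]

/-- The index of `⟨α_0, …, α_{p-1}⟩` in the ring of integers is divisible by `p`, so the `p`-adic
valuation of the discriminant is odd and less than `p`. -/
theorem isTameAt_of_hasTameBasis (h : IsPureGenerator p a θ) (hp2 : 2 < p)
    (ht : HasTameBasis p a θ) : IsTameAt p K := by
  obtain ⟨hpm, hint⟩ := ht
  have hpA : ¬ p ∣ (∏ i, a i).natAbs := fun hd =>
    not_dvd_prod_of_not_dvd_radicand hp.out hpm (Int.natCast_dvd.2 hd)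
  obtain ⟨ε, hε⟩ := exists_int_mul_eq_one hpm
  have hrank : finrank ℤ (𝓞 K) = p := by rw [RingOfIntegers.rank, h.finrank_eq]
  let ω := Module.finBasisOfFinrankEq ℤ (𝓞 K) hrank
  choose A hA using fun k : Fin p => exists_ringOfIntegers (h.isIntegral_pureElt (k : ℕ))
  -- `P` expresses the `α_k` in an integral basis, and its determinant is divisible by `p`.
  set P : Matrix (Fin p) (Fin p) ℤ := Matrix.of fun k j => ω.repr (A k) j with hP
  have hAP : A = P.map (algebraMap ℤ (𝓞 K)) *ᵥ ω := by
    funext k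
    conv_lhs => rw [← ω.sum_repr (A k)]
    simp [Matrix.mulVec, dotProduct, hP]
  have hdisc : Algebra.discr ℤ A = P.det ^ 2 * discr K := by
    rw [hAP, Algebra.discr_of_matrix_mulVec, NumberField.discr_eq_discr K ω]
  have hpP : (p : ℤ) ∣ P.det := by
    set y : Fin p → ℤ := fun k => pureDenom p a k * ε ^ (k : ℕ) with hy
    have hp0 : (p : K) ≠ 0 := Nat.cast_ne_zero.2 hp.out.ne_zero
    have hx : IsIntegral ℤ ((∑ k ∈ Finset.range p,
        ((pureDenom p a k * ε ^ k : ℤ) : K) * pureElt p a θ k) / p) := by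
      rw [hint ε hε]
      refine ⟨fun k => pureDenom p a k * ε ^ k, 1, by field_simp, fun k _ => ?_⟩
      push_cast
      ring
    obtain ⟨X, hX⟩ := exists_ringOfIntegers hx
    have hpX : (p : ℤ) • X = ∑ k, y k • A k := by
      apply RingOfIntegers.coe_injective
      rw [zsmul_eq_mul, map_mul, map_intCast, hX, map_sum, Finset.sum_range,
        Int.cast_natCast, mul_div_cancel₀ _ hp0]
      refine Finset.sum_congr rfl fun k _ => ?_
      rw [zsmul_eq_mul, map_mul, map_intCast, hA, hy]
    have hyP : y ᵥ* P = (p : ℤ) • (ω.repr X : Fin p → ℤ) := by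
      funext j
      have h1 := congrArg (fun t => ω.repr t j) hpX
      simp only [map_smul, map_sum, Finsupp.smul_apply, Finsupp.coe_finsetSum,
        Finset.sum_apply] at h1
      rw [Pi.smul_apply, h1]
      rfl
    have h2 : P.det • y = (p : ℤ) • ((ω.repr X : Fin p → ℤ) ᵥ* P.adjugate) := by
      rw [← Matrix.smul_vecMul, ← hyP, Matrix.vecMul_vecMul, Matrix.mul_adjugate,
        Matrix.vecMul_smul, Matrix.vecMul_one]
    have h3 := congrFun h2 ⟨0, hp.out.pos⟩
    rw [Pi.smul_apply, Pi.smul_apply, hy] at h3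
    simp only [pureDenom_zero, pow_zero, mul_one, smul_eq_mul] at h3
    exact ⟨_, h3⟩
  have hval : 2 * padicValNat p P.det.natAbs + padicValNat p (discr K).natAbs = p := by
    have h1 := h.natAbs_discr_pureElt hp2 hA
    rw [hdisc, Int.natAbs_mul, Int.natAbs_pow] at h1
    have h2 : P.det.natAbs ^ 2 * (discr K).natAbs ≠ 0 := by
      rw [h1]
      refine mul_ne_zero (pow_ne_zero _ hp.out.ne_zero) (pow_ne_zero _ ?_)
      exact Int.natAbs_ne_zero.2 h.prod_ne_zero
    have h3 := congrArg (padicValNat p) h1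
    rwa [padicValNat.mul (left_ne_zero_of_mul h2) (right_ne_zero_of_mul h2),
      padicValNat.mul (pow_ne_zero _ hp.out.ne_zero)
        (pow_ne_zero _ (Int.natAbs_ne_zero.2 h.prod_ne_zero)), padicValNat.prime_pow,
      padicValNat.pow, padicValNat.pow, padicValNat.eq_zero_of_not_dvd hpA, mul_zero,
      add_zero] at h3
  have hdisc0 : (discr K).natAbs ≠ 0 := Int.natAbs_ne_zero.2 (NumberField.discr_ne_zero K)
  have hdet0 : P.det.natAbs ≠ 0 := fun h0 => by
    have h1 := h.natAbs_discr_pureElt hp2 hA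
    rw [hdisc, Int.natAbs_mul, Int.natAbs_pow, h0, zero_pow two_ne_zero, zero_mul] at h1
    exact mul_ne_zero (pow_ne_zero _ hp.out.ne_zero)
      (pow_ne_zero _ (Int.natAbs_ne_zero.2 h.prod_ne_zero)) h1.symm
  have hone : 1 ≤ padicValNat p P.det.natAbs :=
    one_le_padicValNat_of_dvd hdet0 (Int.natCast_dvd.1 hpP)
  constructor
  · -- The valuation of the discriminant is odd.
    rw [Int.natCast_dvd]
    refine dvd_of_one_le_padicValNat ?_
    obtain ⟨l, hl⟩ := hp.out.odd_of_ne_two (by omega)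
    omega
  · rw [← Int.natCast_pow, Int.natCast_dvd, padicValNat_dvd_iff_le hdisc0]
    omega

end IsPureGenerator

/-! ### The Gram matrix of a pure field -/

theorem sum_ringHom_eq_trace {K : Type*} [Field K] [NumberField K] (x : K) :
    ∑ σ : K →+* ℂ, σ x = ((Algebra.trace ℚ K x : ℚ) : ℂ) := by
  have h := trace_eq_sum_embeddings (K := ℚ) (L := K) ℂ (x := x)
  rw [eq_ratCast] at h
  rw [h]
  exact Fintype.sum_equiv (RingHom.equivRatAlgHom K ℂ) _ _ fun σ => rfl

theorem minkowskiMap_inner {K : Type*} [Field K] [NumberField K] (x y : K) :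
    inner ℝ (minkowskiMap K x) (minkowskiMap K y) =
      (∑ σ : K →+* ℂ, σ y * (starRingEnd ℂ) (σ x)).re := by
  rw [PiLp.inner_apply, Complex.re_sum]
  exact Finset.sum_congr rfl fun σ _ => Complex.inner _ _

theorem minkowskiMap_ratCast_mul {K : Type*} [Field K] [NumberField K] (q : ℚ) (x : K) :
    minkowskiMap K ((q : K) * x) = (q : ℝ) • minkowskiMap K x := by
  ext σ
  simp [minkowskiMap]

theorem inner_eq_sum_of_orthogonal {V ι : Type*} [NormedAddCommGroup V] [InnerProductSpace ℝ V]
    [Fintype ι] [DecidableEq ι] {e : ι → V} {g : ι → ℝ}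
    (he : ∀ k l, inner ℝ (e k) (e l) = if k = l then g k else 0) {c d : ι → ℝ} {x y : V}
    (hx : x = ∑ k, c k • e k) (hy : y = ∑ k, d k • e k) :
    inner ℝ x y = ∑ k, c k * d k * g k := by
  rw [hx, hy, sum_inner]
  refine Finset.sum_congr rfl fun k _ => ?_
  simp only [real_inner_smul_left, inner_sum, real_inner_smul_right, he, mul_ite, mul_zero,
    Finset.sum_ite_eq, Finset.mem_univ, if_true]
  ring

theorem sum_range_eq_add_sum_fin {M : Type*} [AddCommMonoid M] {p : ℕ} (hp : 0 < p) (f : ℕ → M) :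
    ∑ k ∈ Finset.range p, f k = f 0 + ∑ k : Fin (p - 1), f ((k : ℕ) + 1) := by
  obtain ⟨n, rfl⟩ := Nat.exists_eq_succ_of_ne_zero hp.ne'
  rw [Finset.sum_range_succ', add_comm, Finset.sum_range]
  rfl

namespace IsPureGenerator

variable {p : ℕ} {K : Type*} [Field K] [NumberField K] {a : Fin (p - 1) → ℤ} {θ : K}

theorem gamma_ne_zero (h : IsPureGenerator p a θ) (hp : p ≠ 0) {α : ℝ}
    (hα : α ^ p = ((pureRadicand a : ℤ) : ℝ)) (k : ℕ) : pureGamma p a α k ≠ 0 := by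
  have hα0 : α ≠ 0 := by
    rintro rfl
    rw [zero_pow hp] at hα
    exact h.carefree.pureRadicand_ne_zero (by exact_mod_cast hα.symm)
  exact div_ne_zero (pow_ne_zero _ hα0) (Int.cast_ne_zero.2 (h.carefree.pureDenom_ne_zero p k))

variable [hp : Fact p.Prime]

theorem norm_apply (h : IsPureGenerator p a θ) {α : ℝ}
    (hα : α ^ p = ((pureRadicand a : ℤ) : ℝ)) (σ : K →+* ℂ) : ‖σ θ‖ = |α| := by
  refine (pow_left_inj₀ (norm_nonneg _) (abs_nonneg _) hp.out.ne_zero).1 ?_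
  rw [← norm_pow, ← map_pow, h.pow_eq, map_intCast, ← abs_pow, hα, Complex.norm_intCast]

theorem mul_conj_apply (h : IsPureGenerator p a θ) {α : ℝ}
    (hα : α ^ p = ((pureRadicand a : ℤ) : ℝ)) (σ : K →+* ℂ) :
    σ θ * (starRingEnd ℂ) (σ θ) = (α : ℂ) ^ 2 := by
  rw [Complex.mul_conj, Complex.normSq_eq_norm_sq, h.norm_apply hα, sq_abs]
  push_cast
  rfl

/-- The images of the `α_k` in Minkowski space are orthogonal, of squared length `p γ_k²`. -/
theorem inner_pureElt (h : IsPureGenerator p a θ) (hp2 : 2 < p) {α : ℝ}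
    (hα : α ^ p = ((pureRadicand a : ℤ) : ℝ)) {j k : ℕ} (hj : j < p) (hk : k < p) :
    inner ℝ (minkowskiMap K (pureElt p a θ j)) (minkowskiMap K (pureElt p a θ k)) =
      if j = k then (p : ℝ) * pureGamma p a α k ^ 2 else 0 := by
  rw [minkowskiMap_inner]
  by_cases hjk : j = k
  · subst hjk
    rw [if_pos rfl]
    have h1 : ∀ σ : K →+* ℂ, σ (pureElt p a θ j) * (starRingEnd ℂ) (σ (pureElt p a θ j)) =
        ((pureGamma p a α j ^ 2 : ℝ) : ℂ) := by
      intro σ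
      rw [pureElt, map_div₀, map_pow, map_intCast, map_div₀, map_pow, map_intCast,
        div_mul_div_comm, ← mul_pow, h.mul_conj_apply hα, pureGamma]
      push_cast
      rw [div_pow, ← pow_mul, ← pow_mul, mul_comm 2 j, sq ((pureDenom p a j : ℤ) : ℂ)]
    rw [Finset.sum_congr rfl fun σ _ => h1 σ, Finset.sum_const, Finset.card_univ,
      NumberField.Embeddings.card, h.finrank_eq, nsmul_eq_mul, ← Complex.ofReal_natCast,
      ← Complex.ofReal_mul, Complex.ofReal_re]
  · rw [if_neg hjk]
    -- Since `conj (σ θ) = α² / σ θ`, the sum is a multiple of the trace of `θ ^ (k + (p - j))`.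
    have hm : ((pureRadicand a : ℤ) : ℂ) ≠ 0 :=
      Int.cast_ne_zero.2 h.carefree.pureRadicand_ne_zero
    have h1 : ∀ σ : K →+* ℂ, σ (pureElt p a θ k) * (starRingEnd ℂ) (σ (pureElt p a θ j)) =
        ((α : ℂ) ^ (2 * j) / ((pureRadicand a : ℤ) * ((pureDenom p a k : ℤ) : ℂ) *
          ((pureDenom p a j : ℤ) : ℂ))) * σ (θ ^ (k + (p - j))) := by
      intro σ
      have hσp : σ θ ^ (p - j) * σ θ ^ j = ((pureRadicand a : ℤ) : ℂ) := by
        rw [← pow_add, Nat.sub_add_cancel hj.le, ← map_pow, h.pow_eq, map_intCast]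
      have hσ : σ θ ≠ 0 := (map_ne_zero σ).2 h.ne_zero
      have hconj : (starRingEnd ℂ) (σ θ) ^ j =
          (α : ℂ) ^ (2 * j) * σ θ ^ (p - j) / ((pureRadicand a : ℤ) : ℂ) := by
        rw [eq_div_iff hm, ← hσp, pow_mul, ← h.mul_conj_apply hα σ, mul_pow]
        ring
      have hbk : ((pureDenom p a k : ℤ) : ℂ) ≠ 0 :=
        Int.cast_ne_zero.2 (h.carefree.pureDenom_ne_zero p k)
      have hbj : ((pureDenom p a j : ℤ) : ℂ) ≠ 0 :=
        Int.cast_ne_zero.2 (h.carefree.pureDenom_ne_zero p j)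
      rw [pureElt, pureElt, map_div₀, map_pow, map_intCast, map_div₀, map_pow, map_intCast,
        map_div₀, map_pow, map_intCast, hconj, map_pow, pow_add]
      field_simp
    have hndvd : ¬ p ∣ k + (p - j) := by
      rintro ⟨q, hq⟩
      have hq0 : q ≠ 0 := by rintro rfl; omega
      have hq2 : q < 2 := by
        by_contra hge
        have : p * 2 ≤ p * q := Nat.mul_le_mul_left p (by omega)
        omega
      have hq1 : q = 1 := by omega
      subst hq1
      omega
    rw [Finset.sum_congr rfl fun σ _ => h1 σ, ← Finset.mul_sum, sum_ringHom_eq_trace,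
      h.trace_pow hp2 hndvd, Rat.cast_zero, mul_zero, Complex.zero_re]

/-- The combination of `α_1, …, α_{p-1}` with the coefficients in a row of `C`. -/
noncomputable def rowElt (p : ℕ) (a : Fin (p - 1) → ℤ) (θ : K) (C : Matrix (Fin (p - 1)) (Fin (p - 1)) ℚ)
    (i : Fin (p - 1)) : K :=
  ∑ k, (C i k : K) * pureElt p a θ ((k : ℕ) + 1)

theorem trace_rowElt (h : IsPureGenerator p a θ) (hp2 : 2 < p)
    (C : Matrix (Fin (p - 1)) (Fin (p - 1)) ℚ) (i : Fin (p - 1)) :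
    Algebra.trace ℚ K (rowElt p a θ C i) = 0 := by
  rw [rowElt, map_sum]
  refine Finset.sum_eq_zero fun k _ => ?_
  rw [trace_ratCast_mul, h.trace_pureElt hp2 (Nat.succ_pos _) (by have := k.2; omega), mul_zero]

/-- If the ring of integers is generated, up to rational constants, by the combinations of
`α_1, …, α_{p-1}` with coefficients in the rows of `C`, these give the shape of `K`. -/
theorem fieldShape_isRepresentedBy (h : IsPureGenerator p a θ) (hp2 : 2 < p) {α : ℝ}
    (hα : α ^ p = ((pureRadicand a : ℤ) : ℝ)) (C : Matrix (Fin (p - 1)) (Fin (p - 1)) ℚ)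
    (hmem : ∀ i, ∃ r : ℚ, IsIntegral ℤ ((r : K) + rowElt p a θ C i))
    (hspan : ∀ x : K, IsIntegral ℤ x →
      ∃ (r : ℚ) (n : Fin (p - 1) → ℤ), x = r + ∑ i, (n i : K) * rowElt p a θ C i) :
    (fieldShape K h.finrank_eq).IsRepresentedBy
      (C.map (algebraMap ℚ ℝ) * wildGram p a α * (C.map (algebraMap ℚ ℝ))ᵀ) := by
  have hp0 : (p : ℝ) ≠ 0 := Nat.cast_ne_zero.2 hp.out.ne_zero
  set L := perpLattice K
  -- The map `x ↦ p x - tr x` removes the constants.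
  have hperp : ∀ (x : 𝓞 K) (r : ℚ) (u : K), algebraMap (𝓞 K) K x = r + u →
      Algebra.trace ℚ K u = 0 → perpMap K x = p * u := by
    intro x r u hx hu
    have h1 : perpMap K x = (finrank ℚ K : K) * algebraMap (𝓞 K) K x -
      algebraMap ℚ K (Algebra.trace ℚ K (algebraMap (𝓞 K) K x)) := rfl
    rw [h1, hx, map_add, hu, add_zero, ← eq_ratCast (algebraMap ℚ K), Algebra.trace_algebraMap,
      h.finrank_eq, nsmul_eq_mul, map_mul, map_natCast]
    ring
  have hvmem : ∀ i, minkowskiMap K ((p : K) * rowElt p a θ C i) ∈ L := by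
    intro i
    obtain ⟨r, hr⟩ := hmem i
    obtain ⟨x, hx⟩ := exists_ringOfIntegers hr
    refine ⟨x, ?_⟩
    rw [LinearMap.comp_apply, hperp x r _ hx (h.trace_rowElt hp2 C i)]
  let v : Fin (p - 1) → L := fun i => ⟨_, hvmem i⟩
  have htop : ⊤ ≤ Submodule.span ℤ (Set.range v) := by
    rintro ⟨_, x, rfl⟩ -
    obtain ⟨r, n, hx⟩ := hspan _ (RingOfIntegers.isIntegral_coe x)
    have h1 : perpMap K x = ∑ i, n i • ((p : K) * rowElt p a θ C i) := by
      rw [hperp x r _ hx, Finset.mul_sum]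
      · refine Finset.sum_congr rfl fun i _ => ?_
        rw [zsmul_eq_mul]
        ring
      · rw [map_sum]
        refine Finset.sum_eq_zero fun i _ => ?_
        have := trace_ratCast_mul (n i : ℚ) (rowElt p a θ C i)
        rw [Rat.cast_intCast] at this
        rw [this, h.trace_rowElt hp2, mul_zero]
    have h2 : (⟨((minkowskiMap K).comp (perpMap K)) x, x, rfl⟩ : L) = ∑ i, n i • v i := by
      apply Subtype.ext
      change minkowskiMap K (perpMap K x) = _
      rw [h1, map_sum, Submodule.coe_sum]
      refine Finset.sum_congr rfl fun i _ => ?_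
      rw [map_smul]
      rfl
    rw [h2]
    exact Submodule.sum_mem _ fun i _ => Submodule.smul_mem _ _ (Submodule.subset_span ⟨i, rfl⟩)
  obtain ⟨b₀, -⟩ := perpLattice_isLatticeOfRank K h.finrank_eq
  have : Module.Finite ℤ L := Module.Finite.of_basis b₀
  have hcard : Fintype.card (Fin (p - 1)) = finrank ℤ L := (Module.finrank_eq_card_basis b₀).symm
  let b := basisOfTopLeSpanOfCardEqFinrank v htop hcard
  have hb : ∀ i, ((b i : L) : EuclideanSpace ℂ (K →+* ℂ)) =
      minkowskiMap K ((p : K) * rowElt p a θ C i) := fun i => by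
    simp only [b, coe_basisOfTopLeSpanOfCardEqFinrank]
    rfl
  have hrow : ∀ i, minkowskiMap K ((p : K) * rowElt p a θ C i) =
      ∑ k, ((p : ℝ) * (C i k : ℝ)) • minkowskiMap K (pureElt p a θ ((k : ℕ) + 1)) := by
    intro i
    rw [rowElt, Finset.mul_sum, map_sum]
    refine Finset.sum_congr rfl fun k _ => ?_
    have := minkowskiMap_ratCast_mul ((p : ℚ) * C i k) (pureElt p a θ ((k : ℕ) + 1))
    push_cast at this
    rw [← mul_assoc, this]
  have hgram : Matrix.gram ℝ (fun i => ((b i : L) : EuclideanSpace ℂ (K →+* ℂ))) =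
      (p : ℝ) ^ 3 • (C.map (algebraMap ℚ ℝ) * wildGram p a α * (C.map (algebraMap ℚ ℝ))ᵀ) := by
    ext i j
    have horth : ∀ k l : Fin (p - 1),
        inner ℝ (minkowskiMap K (pureElt p a θ ((k : ℕ) + 1)))
          (minkowskiMap K (pureElt p a θ ((l : ℕ) + 1))) =
        if k = l then (p : ℝ) * pureGamma p a α ((k : ℕ) + 1) ^ 2 else 0 := by
      intro k l
      rw [h.inner_pureElt hp2 hα (by have := k.2; omega) (by have := l.2; omega)]
      by_cases hkl : k = l
      · rw [if_pos hkl, if_pos (by rw [hkl]), hkl]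
      · rw [if_neg hkl, if_neg fun h0 => hkl (Fin.ext (by omega))]
    rw [Matrix.gram_apply, hb, hb, inner_eq_sum_of_orthogonal horth (hrow i) (hrow j),
      Matrix.smul_apply, smul_eq_mul, Matrix.mul_apply, Finset.mul_sum]
    refine Finset.sum_congr rfl fun k _ => ?_
    rw [wildGram, Matrix.mul_diagonal, Matrix.transpose_apply, Matrix.map_apply, Matrix.map_apply,
      eq_ratCast, eq_ratCast]
    ring
  have hrep := latticeShape_isRepresentedBy (perpLattice_isLatticeOfRank K h.finrank_eq) b
  rw [hgram] at hrep
  have hpos : (0 : ℝ) < ((p : ℝ) ^ 3)⁻¹ := by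
    have : (0 : ℝ) < p := Nat.cast_pos.2 hp.out.pos
    positivity
  have := hrep.smul hpos
  rwa [smul_smul, inv_mul_cancel₀ (pow_ne_zero 3 hp0), one_smul] at this

theorem fieldShape_isRepresentedBy_wildGram (h : IsPureGenerator p a θ) (hp2 : 2 < p) {α : ℝ}
    (hα : α ^ p = ((pureRadicand a : ℤ) : ℝ)) (hw : HasWildBasis p a θ) :
    (fieldShape K h.finrank_eq).IsRepresentedBy (wildGram p a α) := by
  have hrow : ∀ i : Fin (p - 1), rowElt p a θ 1 i = pureElt p a θ ((i : ℕ) + 1) := by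
    intro i
    rw [rowElt, Finset.sum_eq_single i]
    · simp
    · intro k _ hk
      rw [Matrix.one_apply_ne hk.symm, Rat.cast_zero, zero_mul]
    · simp
  have := h.fieldShape_isRepresentedBy hp2 hα 1
    (fun i => ⟨0, by rw [hrow, Rat.cast_zero, zero_add]; exact h.isIntegral_pureElt _⟩)
    (fun x hx => by
      obtain ⟨y, hy⟩ := hw x hx
      refine ⟨y 0, fun i => y ((i : ℕ) + 1), ?_⟩
      rw [hy, sum_range_eq_add_sum_fin hp.out.pos, pureElt_zero, mul_one, Rat.cast_intCast]
      congr 1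
      exact Finset.sum_congr rfl fun i _ => by rw [hrow])
  simpa using this

/-- The coordinates of the glue vector need only be known modulo `p`. -/
theorem fieldShape_isRepresentedBy_glue (h : IsPureGenerator p a θ) (hp2 : 2 < p) {α : ℝ}
    (hα : α ^ p = ((pureRadicand a : ℤ) : ℝ)) (ht : HasTameBasis p a θ) {ε : ℤ}
    (hε : ((pureRadicand a : ℤ) : ZMod p) * (ε : ZMod p) = 1) {y : Fin (p - 1) → ℤ}
    (hy1 : y ⟨0, by omega⟩ = 1)
    (hy : ∀ k : Fin (p - 1), (y k : ZMod p) =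
      (pureDenom p a ((k : ℕ) + 1) : ℤ) * (ε : ZMod p) ^ (k : ℕ)) :
    (fieldShape K h.finrank_eq).IsRepresentedBy
      (glueMatrix ℝ p y * wildGram p a α * (glueMatrix ℝ p y)ᵀ) := by
  have hint := ht.2 ε hε
  have hp0 : (p : K) ≠ 0 := Nat.cast_ne_zero.2 hp.out.ne_zero
  have hrow0 : ∀ i : Fin (p - 1), (i : ℕ) = 0 → (p : K) * rowElt p a θ (glueMatrix ℚ p y) i =
      ∑ k, (y k : K) * pureElt p a θ ((k : ℕ) + 1) := by
    intro i hi
    rw [rowElt, Finset.mul_sum]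
    refine Finset.sum_congr rfl fun k _ => ?_
    simp only [glueMatrix, Matrix.of_apply, hi, if_true]
    push_cast
    field_simp
  have hrow : ∀ i : Fin (p - 1), (i : ℕ) ≠ 0 → rowElt p a θ (glueMatrix ℚ p y) i =
      pureElt p a θ ((i : ℕ) + 1) := by
    intro i hi
    rw [rowElt, Finset.sum_eq_single i]
    · simp [glueMatrix, hi]
    · intro k _ hk
      simp [glueMatrix, hi, hk.symm]
    · simp
  rw [← glueMatrix_map]
  refine h.fieldShape_isRepresentedBy hp2 hα (glueMatrix ℚ p y) ?_ ?_
  · intro i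
    by_cases hi : (i : ℕ) = 0
    · refine ⟨((pureRadicand a : ℤ) : ℚ) / p, ?_⟩
      rw [hint]
      refine ⟨fun k => if hk : k - 1 < p - 1 ∧ k ≠ 0 then y ⟨k - 1, hk.1⟩ else pureRadicand a,
        pureRadicand a, ?_, ?_⟩
      · rw [mul_add, hrow0 i hi, sum_range_eq_add_sum_fin hp.out.pos, pureElt_zero]
        congr 1
        · push_cast
          simp
          field_simp
        · refine Finset.sum_congr rfl fun k _ => ?_
          simp
      · intro k hk
        rcases Nat.eq_zero_or_pos k with rfl | hk0
        · simp [pureDenom_zero]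
        · have hk1 : k - 1 < p - 1 ∧ k ≠ 0 := ⟨by omega, hk0.ne'⟩
          simp only [dif_pos hk1, hy]
          rw [Nat.sub_add_cancel hk0]
          obtain ⟨j, rfl⟩ := Nat.exists_eq_succ_of_ne_zero hk0.ne'
          rw [pow_succ, Nat.succ_sub_one]
          linear_combination (-((pureDenom p a (j + 1) : ℤ) : ZMod p) * (ε : ZMod p) ^ j) * hε
    · exact ⟨0, by rw [hrow i hi, Rat.cast_zero, zero_add]; exact h.isIntegral_pureElt _⟩
  · intro x hx
    obtain ⟨Y, z, hYx, hYz⟩ := (hint x).1 hx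
    have hY1 : (Y 1 : ZMod p) = z * (ε : ZMod p) := by
      rw [hYz 1 (by omega), pureDenom_one, Int.cast_one, mul_one, pow_one]
    have hdiv : ∀ k : Fin (p - 1), ∃ t : ℤ, Y ((k : ℕ) + 1) - Y 1 * y k = p * t := by
      intro k
      have : ((Y ((k : ℕ) + 1) - Y 1 * y k : ℤ) : ZMod p) = 0 := by
        push_cast
        rw [hY1, hy, hYz _ (by have := k.2; omega)]
        ring
      exact (ZMod.intCast_zmod_eq_zero_iff_dvd _ p).1 this
    choose t htk using hdiv
    refine ⟨(Y 0 : ℚ) / p, fun i => if (i : ℕ) = 0 then Y 1 else t i, ?_⟩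
    refine mul_left_cancel₀ hp0 ?_
    set i₀ : Fin (p - 1) := ⟨0, by omega⟩
    have hsplit : ∀ f : Fin (p - 1) → K, ∑ k, f k = f i₀ + ∑ k ∈ Finset.univ.erase i₀, f k :=
      fun f => (Finset.add_sum_erase _ f (Finset.mem_univ i₀)).symm
    have hrest : ∑ k ∈ Finset.univ.erase i₀, (Y ((k : ℕ) + 1) : K) * pureElt p a θ ((k : ℕ) + 1) =
        (Y 1 : K) * ∑ k ∈ Finset.univ.erase i₀, (y k : K) * pureElt p a θ ((k : ℕ) + 1) +
        p * ∑ k ∈ Finset.univ.erase i₀, ((if (k : ℕ) = 0 then Y 1 else t k : ℤ) : K) *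
          rowElt p a θ (glueMatrix ℚ p y) k := by
      rw [Finset.mul_sum, Finset.mul_sum, ← Finset.sum_add_distrib]
      refine Finset.sum_congr rfl fun k hk => ?_
      have hk0 : (k : ℕ) ≠ 0 := fun h0 => Finset.ne_of_mem_erase hk (Fin.ext h0)
      rw [if_neg hk0, hrow k hk0]
      have := congrArg (fun n : ℤ => (n : K)) (htk k)
      push_cast at this
      linear_combination pureElt p a θ ((k : ℕ) + 1) * this
    have hfirst := hrow0 i₀ rfl
    rw [hsplit, hy1, Int.cast_one, one_mul] at hfirst
    have hconst : (p : K) * (((Y 0 : ℚ) / p : ℚ) : K) = Y 0 := by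
      push_cast
      field_simp
    rw [hYx, sum_range_eq_add_sum_fin hp.out.pos, pureElt_zero, mul_one, mul_add, hconst, hsplit,
      hsplit fun i => ((if (i : ℕ) = 0 then Y 1 else t i : ℤ) : K) * _, hrest, if_pos rfl]
    change _ + ((Y 1 : K) * _ + _) = _
    linear_combination -(Y 1 : K) * hfirst

end IsPureGenerator

/-! ### Strongly carefree factorizations -/

theorem prod_filter_factorization_pow {p n : ℕ} (hn : n ≠ 0)
    (hfree : ∀ q : ℕ, q.Prime → ¬ q ^ p ∣ n) :
    ∏ i : Fin (p - 1), (∏ q ∈ n.primeFactors with n.factorization q = (i : ℕ) + 1, q) ^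
      ((i : ℕ) + 1) = n := by
  have h1 : ∀ i : Fin (p - 1),
      (∏ q ∈ n.primeFactors with n.factorization q = (i : ℕ) + 1, q) ^ ((i : ℕ) + 1) =
      ∏ q ∈ n.primeFactors,
        if n.factorization q = (i : ℕ) + 1 then q ^ n.factorization q else 1 := by
    intro i
    rw [← Finset.prod_pow, Finset.prod_filter]
    refine Finset.prod_congr rfl fun q _ => ?_
    split_ifs with hq
    · rw [hq]
    · rfl
  rw [Finset.prod_congr rfl fun i _ => h1 i, Finset.prod_comm]
  conv_rhs => rw [← Nat.prod_factorization_pow_eq_self hn]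
  refine Finset.prod_congr rfl fun q hq => ?_
  have hqp := Nat.prime_of_mem_primeFactors hq
  have hlt : n.factorization q < p := by
    by_contra hge
    exact hfree q hqp ((hqp.pow_dvd_iff_le_factorization hn).2 (by omega))
  have hpos : 0 < n.factorization q :=
    hqp.factorization_pos_of_dvd hn (Nat.dvd_of_mem_primeFactors hq)
  rw [Finset.prod_eq_single ⟨n.factorization q - 1, by omega⟩]
  · rw [if_pos (by simp only; omega)]
  · intro i _ hi
    rw [if_neg fun h => hi (Fin.ext (by simp only; omega))]
  · simp

/-- Every integer that is `p`-th power free is of the form `∏ a_i ^ i`, with `a_i` up to sign the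
product of the primes of multiplicity `i`. -/
theorem exists_stronglyCarefree {p : ℕ} (hp2 : 2 < p) {m : ℤ}
    (hm : ∀ q : ℕ, q.Prime → ¬ (q : ℤ) ^ p ∣ m) :
    ∃ a : Fin (p - 1) → ℤ, StronglyCarefree a ∧ pureRadicand a = m := by
  have hm0 : m ≠ 0 := fun h0 => hm 2 Nat.prime_two (h0 ▸ dvd_zero _)
  set n := m.natAbs with hn
  have hn0 : n ≠ 0 := Int.natAbs_ne_zero.2 hm0
  set A : Fin (p - 1) → ℕ := fun i =>
    ∏ q ∈ n.primeFactors with n.factorization q = (i : ℕ) + 1, q with hA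
  -- The sign of `m` is given to `a_1`, whose exponent is odd.
  set s : Fin (p - 1) → ℤ := fun i => if (i : ℕ) = 0 then m.sign else 1 with hs
  have habs : ∀ i, (s i * A i).natAbs = A i := by
    intro i
    rw [Int.natAbs_mul, Int.natAbs_natCast, hs]
    simp only
    split_ifs
    · rw [Int.natAbs_sign, if_neg hm0, one_mul]
    · rw [Int.natAbs_one, one_mul]
  refine ⟨fun i => s i * A i, ⟨fun i => ?_, fun i j hij => ?_⟩, ?_⟩
  · rw [← Int.squarefree_natAbs, habs, hA]
    refine Finset.squarefree_prod_of_pairwise_isCoprime (fun q hq r hr hqr => ?_) fun q hq => ?_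
    · rw [Function.onFun, ← Nat.coprime_iff_isRelPrime]
      exact (Nat.coprime_primes (Nat.prime_of_mem_primeFactors (Finset.mem_filter.1 hq).1)
        (Nat.prime_of_mem_primeFactors (Finset.mem_filter.1 hr).1)).2 hqr
    · exact (Nat.prime_of_mem_primeFactors (Finset.mem_filter.1 hq).1).prime.squarefree
  · change IsCoprime (s i * (A i : ℤ)) (s j * (A j : ℤ))
    rw [Int.isCoprime_iff_nat_coprime, habs, habs]
    refine Nat.Coprime.prod_left fun q hq => Nat.Coprime.prod_right fun r hr => ?_
    obtain ⟨hq1, hq2⟩ := Finset.mem_filter.1 hq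
    obtain ⟨hr1, hr2⟩ := Finset.mem_filter.1 hr
    refine (Nat.coprime_primes (Nat.prime_of_mem_primeFactors hq1)
      (Nat.prime_of_mem_primeFactors hr1)).2 ?_
    rintro rfl
    exact hij (Fin.ext (by omega))
  · have h1 := prod_filter_factorization_pow (p := p) hn0 fun q hq hd =>
      hm q hq (by rw [← Int.natCast_pow, Int.natCast_dvd]; exact hd)
    have h2 : ∏ i : Fin (p - 1), s i ^ ((i : ℕ) + 1) = m.sign := by
      rw [Finset.prod_eq_single ⟨0, by omega⟩]
      · simp [hs]
      · intro i _ hi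
        have : (i : ℕ) ≠ 0 := fun h0 => hi (Fin.ext h0)
        simp [hs, this]
      · simp
    rw [pureRadicand]
    simp only [mul_pow]
    rw [Finset.prod_mul_distrib, h2]
    have h3 : ∏ i : Fin (p - 1), (A i : ℤ) ^ ((i : ℕ) + 1) = n := by exact_mod_cast h1
    rw [h3, hn, Int.sign_mul_natAbs]

theorem exists_real_pow_eq {p : ℕ} (hp : Odd p) (x : ℝ) : ∃ α : ℝ, α ^ p = x := by
  have hp0 : p ≠ 0 := hp.pos.ne'
  rcases le_total 0 x with hx | hx
  · exact ⟨x ^ (p⁻¹ : ℝ), Real.rpow_inv_natCast_pow hx hp0⟩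
  · refine ⟨-(-x) ^ (p⁻¹ : ℝ), ?_⟩
    rw [hp.neg_pow, Real.rpow_inv_natCast_pow (neg_nonneg.2 hx) hp0, neg_neg]

/-! ### The two families of Gram matrices -/

theorem glueMatrix_mul_diagonal_apply {p r : ℕ} (y : Fin r → ℤ) (w : Fin r → ℝ) (i j : Fin r) :
    (glueMatrix ℝ p y * Matrix.diagonal w * (glueMatrix ℝ p y)ᵀ) i j =
      ∑ k, glueMatrix ℝ p y i k * w k * glueMatrix ℝ p y j k := by
  rw [Matrix.mul_apply]
  exact Finset.sum_congr rfl fun k _ => by rw [Matrix.mul_diagonal, Matrix.transpose_apply]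

namespace IsPureGenerator

variable {p : ℕ} {K : Type*} [Field K] [NumberField K] {a : Fin (p - 1) → ℤ} {θ : K} {α : ℝ}

theorem pureGamma_one : pureGamma p a α 1 = α := by
  rw [pureGamma, pureDenom_one, Int.cast_one, div_one, pow_one]

theorem denom_mul_gamma (h : IsPureGenerator p a θ) (k : ℕ) :
    ((pureDenom p a k : ℤ) : ℝ) * pureGamma p a α k = pureGamma p a α 1 ^ k := by
  rw [pureGamma_one]
  exact mul_div_cancel₀ _ (Int.cast_ne_zero.2 (h.carefree.pureDenom_ne_zero p k))

/-- The glue vector of `tameGram` has the coordinates `b_k ε ^ (k - 1) / p`. -/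
theorem tameGram_eq (h : IsPureGenerator p a θ) (hp0 : p ≠ 0) (ε : ℤ) :
    tameGram p a α ε = (p : ℝ) •
      (glueMatrix ℝ p (fun k : Fin (p - 1) => pureDenom p a ((k : ℕ) + 1) * ε ^ (k : ℕ)) *
        wildGram p a α *
        (glueMatrix ℝ p (fun k : Fin (p - 1) => pureDenom p a ((k : ℕ) + 1) * ε ^ (k : ℕ)))ᵀ) := by
  have hpR : (p : ℝ) ≠ 0 := Nat.cast_ne_zero.2 hp0
  ext i j
  rw [wildGram, Matrix.smul_apply, glueMatrix_mul_diagonal_apply, smul_eq_mul]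
  simp only [tameGram, Matrix.of_apply]
  by_cases hi : (i : ℕ) = 0 <;> by_cases hj : (j : ℕ) = 0
  · rw [if_pos ⟨hi, hj⟩, Finset.mul_sum, Finset.mul_sum]
    have hIcc : Finset.Icc 1 (p - 1) = (Finset.range (p - 1)).map (addRightEmbedding 1) := by
      ext k
      simp only [Finset.mem_Icc, Finset.mem_map, Finset.mem_range, addRightEmbedding_apply]
      constructor
      · rintro ⟨h1, h2⟩
        exact ⟨k - 1, by omega, by omega⟩
      · rintro ⟨l, h1, rfl⟩
        omega
    rw [hIcc, Finset.sum_map, Finset.sum_range]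
    refine Finset.sum_congr rfl fun k _ => ?_
    simp only [glueMatrix, Matrix.of_apply, hi, hj, if_true, addRightEmbedding_apply,
      Nat.add_sub_cancel]
    have := h.denom_mul_gamma (α := α) ((k : ℕ) + 1)
    rw [mul_comm 2 ((k : ℕ) + 1), pow_mul _ ((k : ℕ) + 1) 2, ← this]
    push_cast
    field_simp
    ring
  · rw [if_neg (by tauto), if_pos hi, Finset.sum_eq_single j]
    · simp only [glueMatrix, Matrix.of_apply, hi, hj, if_true, if_false]
      rw [← h.denom_mul_gamma (α := α) ((j : ℕ) + 1)]
      push_cast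
      field_simp
    · intro k _ hk
      simp [glueMatrix, hj, hk.symm]
    · simp
  · rw [if_neg (by tauto), if_neg hi, if_pos hj, Finset.sum_eq_single i]
    · simp only [glueMatrix, Matrix.of_apply, hi, hj, if_true, if_false]
      rw [← h.denom_mul_gamma (α := α) ((i : ℕ) + 1)]
      push_cast
      field_simp
    · intro k _ hk
      simp [glueMatrix, hi, hk.symm]
    · simp
  · rw [if_neg (by tauto), if_neg hi, if_neg hj, Finset.sum_eq_single i]
    · by_cases hij : i = j
      · subst hij
        simp [glueMatrix, hi]
      · simp [glueMatrix, hi, hj, hij, Ne.symm hij]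
    · intro k _ hk
      simp [glueMatrix, hi, hk.symm]
    · simp

theorem abs_prod_pos (h : IsPureGenerator p a θ) : 0 < |((∏ i, a i : ℤ) : ℝ)| :=
  abs_pos.2 (Int.cast_ne_zero.2 h.prod_ne_zero)

variable [hp : Fact p.Prime]

theorem gamma_mul_reflect (h : IsPureGenerator p a θ) (hα : α ^ p = ((pureRadicand a : ℤ) : ℝ))
    {k : ℕ} (hk : 0 < k) (hkp : k < p) :
    pureGamma p a α k * pureGamma p a α (p - k) = ((∏ i, a i : ℤ) : ℝ) := by
  have hb : ∀ k, ((pureDenom p a k : ℤ) : ℝ) ≠ 0 := fun k =>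
    Int.cast_ne_zero.2 (h.carefree.pureDenom_ne_zero p k)
  rw [pureGamma, pureGamma, div_mul_div_comm, ← pow_add, Nat.add_sub_of_le hkp.le, hα,
    div_eq_iff (mul_ne_zero (hb _) (hb _)), pureRadicand_eq_mul hp.out a hk hkp]
  push_cast
  ring

theorem exists_wildGram_eq_smul (h : IsPureGenerator p a θ)
    (hα : α ^ p = ((pureRadicand a : ℤ) : ℝ)) :
    ∃ D ∈ torusOrbit (p - 1), wildGram p a α = |((∏ i, a i : ℤ) : ℝ)| • D := by
  have hA := h.abs_prod_pos
  refine ⟨Matrix.diagonal fun i => pureGamma p a α ((i : ℕ) + 1) ^ 2 / |((∏ i, a i : ℤ) : ℝ)|,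
    mem_torusOrbit_iff.2 ⟨_, fun i => ?_, fun i => ?_, rfl⟩, ?_⟩
  · exact div_pos (sq_pos_of_ne_zero (h.gamma_ne_zero hp.out.ne_zero hα _)) hA
  · have hi := i.2
    have hrev : ((i.rev : Fin (p - 1)) : ℕ) + 1 = p - ((i : ℕ) + 1) := by
      rw [Fin.val_rev]; omega
    rw [hrev, div_mul_div_comm, ← mul_pow,
      h.gamma_mul_reflect hα (Nat.succ_pos _) (by omega), ← sq_abs, sq]
    exact div_self (mul_ne_zero hA.ne' hA.ne')
  · ext i j
    rw [wildGram, Matrix.smul_apply, smul_eq_mul, Matrix.diagonal_apply, Matrix.diagonal_apply]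
    split_ifs
    · rw [mul_div_cancel₀ _ hA.ne']
    · rw [mul_zero]

/-- The `γ_k²` are rational multiples of powers of `α²`, which has degree `p` over `ℚ`. -/
theorem linearIndependent_gamma_sq (h : IsPureGenerator p a θ) (hp2 : 2 < p)
    (hα : α ^ p = ((pureRadicand a : ℤ) : ℝ)) :
    LinearIndependent ℚ fun i : Fin (p - 1) => pureGamma p a α ((i : ℕ) + 1) ^ 2 := by
  have hirr : Irreducible (Polynomial.X ^ p - Polynomial.C (((pureRadicand a : ℤ) : ℚ) ^ 2)) :=
    (X_pow_sub_C_irreducible_iff_of_prime hp.out).2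
      (pow_ne_pow_of_not_dvd hp.out h.radicand_rat_ne_zero h.pow_ne
        (Nat.not_dvd_of_pos_of_lt two_pos hp2))
  have hmin := minpoly.eq_of_irreducible_of_monic (x := α ^ 2) hirr
    (by
      rw [map_sub, map_pow, Polynomial.aeval_X, Polynomial.aeval_C, ← pow_mul, mul_comm, pow_mul,
        hα]
      simp)
    (Polynomial.monic_X_pow_sub_C _ hp.out.ne_zero)
  have h1 := linearIndependent_pow (K := ℚ) (α ^ 2)
  rw [← hmin, Polynomial.natDegree_X_pow_sub_C] at h1
  have h2 := h1.comp (fun i : Fin (p - 1) => (⟨(i : ℕ) + 1, by have := i.2; omega⟩ : Fin p))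
    fun i j hij => Fin.ext (by simpa using hij)
  have hb : ∀ k, ((pureDenom p a k : ℤ) : ℚ) ≠ 0 := fun k =>
    Int.cast_ne_zero.2 (h.carefree.pureDenom_ne_zero p k)
  have h3 := h2.units_smul fun i => (Units.mk0 _ (pow_ne_zero 2 (hb ((i : ℕ) + 1))))⁻¹
  have h4 : (fun i : Fin (p - 1) => pureGamma p a α ((i : ℕ) + 1) ^ 2) =
      (fun i : Fin (p - 1) => (Units.mk0 _ (pow_ne_zero 2 (hb ((i : ℕ) + 1))))⁻¹) •
      ((fun k : Fin p => (α ^ 2) ^ (k : ℕ)) ∘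
        fun i : Fin (p - 1) => (⟨(i : ℕ) + 1, by have := i.2; omega⟩ : Fin p)) := by
    funext i
    rw [Pi.smul_apply', Units.smul_def, Units.val_inv_eq_inv_val, Units.val_mk0, Algebra.smul_def,
      pureGamma, div_pow, div_eq_inv_mul, ← pow_mul, mul_comm ((i : ℕ) + 1) 2, pow_mul]
    simp
  rw [h4]
  exact h3

theorem isUnit_intCast_of_not_dvd_radicand (ht : ¬ (p : ℤ) ∣ pureRadicand a) (i : Fin (p - 1)) :
    IsUnit (a i : ZMod p) := by
  rw [isUnit_iff_ne_zero, Ne, ZMod.intCast_zmod_eq_zero_iff_dvd]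
  intro hd
  exact ht ((hd.trans (dvd_pow_self _ (Nat.succ_ne_zero _))).trans
    (Finset.dvd_prod_of_mem (fun i : Fin (p - 1) => a i ^ ((i : ℕ) + 1)) (Finset.mem_univ i)))

theorem not_dvd_glueCoeff {y : Fin (p - 1) → ℤ} {ε : ℤ}
    (ht : ¬ (p : ℤ) ∣ pureRadicand a)
    (hε : ((pureRadicand a : ℤ) : ZMod p) * (ε : ZMod p) = 1)
    (hy : ∀ k : Fin (p - 1), (y k : ZMod p) =
      (pureDenom p a ((k : ℕ) + 1) : ℤ) * (ε : ZMod p) ^ (k : ℕ)) (k : Fin (p - 1)) :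
    ¬ (p : ℤ) ∣ y k := by
  rw [← ZMod.intCast_zmod_eq_zero_iff_dvd, hy]
  refine mul_ne_zero ?_ (pow_ne_zero _ (right_ne_zero_of_mul_eq_one hε))
  rw [Ne, ZMod.intCast_zmod_eq_zero_iff_dvd]
  exact not_dvd_denom hp.out ht _

theorem fieldShape_mem_wildShapes (h : IsPureGenerator p a θ) (hp2 : 2 < p)
    (hα : α ^ p = ((pureRadicand a : ℤ) : ℝ)) (hw : HasWildBasis p a θ) :
    fieldShape K h.finrank_eq ∈ wildShapes p := by
  obtain ⟨D, hD, hDe⟩ := h.exists_wildGram_eq_smul hα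
  refine ⟨D, hD, ?_⟩
  have := (h.fieldShape_isRepresentedBy_wildGram hp2 hα hw).smul (inv_pos.2 h.abs_prod_pos)
  rwa [hDe, smul_smul, inv_mul_cancel₀ h.abs_prod_pos.ne', one_smul] at this

theorem fieldShape_mem_tameShapes (h : IsPureGenerator p a θ) (hp2 : 2 < p)
    (hα : α ^ p = ((pureRadicand a : ℤ) : ℝ)) (ht : HasTameBasis p a θ) :
    fieldShape K h.finrank_eq ∈ tameShapes p := by
  obtain ⟨ε, hε⟩ := exists_int_mul_eq_one ht.1
  set u : Fin (p - 1) → (ZMod p)ˣ := fun i => (isUnit_intCast_of_not_dvd_radicand ht.1 i).unit with hu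
  set c : Fin (p - 1) → (ZMod p)ˣ := fun j =>
    (pureRadicand u)⁻¹ ^ (j : ℕ) * pureDenom p u ((j : ℕ) + 1) with hc
  have hchange : tameChange p u = glueMatrix ℝ p fun j => (((c j : ZMod p).val : ℕ) : ℤ) := by
    ext i j
    simp only [tameChange, glueMatrix, Matrix.of_apply, Int.cast_natCast]
    rfl
  have hrad : ((pureRadicand u : (ZMod p)ˣ) : ZMod p) = ((pureRadicand a : ℤ) : ZMod p) := by
    simp [pureRadicand, hu]
  have hden : ∀ k, ((pureDenom p u k : (ZMod p)ˣ) : ZMod p) =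
      ((pureDenom p a k : ℤ) : ZMod p) := fun k => by
    simp [pureDenom, hu]
  have hinv : (((pureRadicand u)⁻¹ : (ZMod p)ˣ) : ZMod p) = ε := by
    rw [Units.inv_eq_of_mul_eq_one_right]
    rw [hrad, hε]
  have : Fact (1 < p) := ⟨hp.out.one_lt⟩
  have hrep := h.fieldShape_isRepresentedBy_glue hp2 hα ht hε
    (y := fun j => (((c j : ZMod p).val : ℕ) : ℤ))
    (by simp [hc, pureDenom_one, ZMod.val_one, -ZMod.natCast_val])
    (fun k => by
      rw [Int.cast_natCast, ZMod.natCast_zmod_val, hc]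
      simp only [Units.val_mul, Units.val_pow_eq_pow_val, hden, hinv]
      ring)
  obtain ⟨D, hD, hDe⟩ := h.exists_wildGram_eq_smul hα
  refine ⟨u, D, hD, ?_⟩
  have := hrep.smul (inv_pos.2 h.abs_prod_pos)
  rwa [hDe, Matrix.mul_smul, Matrix.smul_mul, smul_smul, inv_mul_cancel₀ h.abs_prod_pos.ne',
    one_smul, ← hchange] at this

theorem fieldShape_isRepresentedBy_glue_denom (h : IsPureGenerator p a θ) (hp2 : 2 < p)
    (hα : α ^ p = ((pureRadicand a : ℤ) : ℝ)) (ht : HasTameBasis p a θ) {ε : ℤ}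
    (hε : ((pureRadicand a : ℤ) : ZMod p) * (ε : ZMod p) = 1) :
    (fieldShape K h.finrank_eq).IsRepresentedBy
      (glueMatrix ℝ p (fun k : Fin (p - 1) => pureDenom p a ((k : ℕ) + 1) * ε ^ (k : ℕ)) *
        wildGram p a α *
        (glueMatrix ℝ p (fun k : Fin (p - 1) => pureDenom p a ((k : ℕ) + 1) * ε ^ (k : ℕ)))ᵀ) :=
  h.fieldShape_isRepresentedBy_glue hp2 hα ht hε (by simp [pureDenom_one])
    (fun k => by push_cast; rfl)

end IsPureGenerator

theorem theoremA (p : ℕ) [hp : Fact p.Prime] (hp2 : 2 < p) :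
    shapeDim (wildShapes p) = ((p - 1) / 2 : ℕ) ∧
    shapeDim (tameShapes p) = ((p - 1) / 2 : ℕ) ∧
    ∀ (K : Type*) [Field K] [NumberField K] (hK : IsPureField p K),
      (IsWildAt p K ∨ IsTameAt p K) ∧
      (IsWildAt p K →
        fieldShape K hK.finrank_eq ∈ wildShapes p ∧
        (fieldShape K hK.finrank_eq).IsOrthorhombic) ∧
      (IsTameAt p K →
        fieldShape K hK.finrank_eq ∈ tameShapes p ∧
        (fieldShape K hK.finrank_eq).IsOrdinary ∧
        ¬ (fieldShape K hK.finrank_eq).IsOrthorhombic) ∧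
      ∀ (a : Fin (p - 1) → ℤ), StronglyCarefree a →
        ∀ θ : K, θ ^ p = ((pureRadicand a : ℤ) : K) → IntermediateField.adjoin ℚ {θ} = ⊤ →
        ∀ α : ℝ, α ^ p = ((pureRadicand a : ℤ) : ℝ) →
          (IsWildAt p K →
            (fieldShape K hK.finrank_eq).IsRepresentedBy (wildGram p a α) ∧
            ∃ D ∈ torusOrbit (p - 1), wildGram p a α = |((∏ i, a i : ℤ) : ℝ)| • D) ∧
          (IsTameAt p K →
            IsCoprime (pureRadicand a) (p : ℤ) ∧
            ∀ ε : ℤ, pureRadicand a * ε ≡ 1 [ZMOD (p : ℤ) ^ 2] →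
              (fieldShape K hK.finrank_eq).IsRepresentedBy (tameGram p a α ε)) := by
  refine ⟨shapeDim_wildShapes p hp2, shapeDim_tameShapes p hp2, ?_⟩
  intro K _ _ hK
  -- The type of the field decides which integral basis every radical generator gives.
  have hwild : IsWildAt p K → ∀ {a : Fin (p - 1) → ℤ} {θ : K}, IsPureGenerator p a θ →
      IsPureGenerator.HasWildBasis p a θ := fun hw a θ h =>
    (h.hasWildBasis_or_hasTameBasis hp2).resolve_right fun ht =>
      (h.isTameAt_of_hasTameBasis hp2 ht).2 hw
  have htame : IsTameAt p K → ∀ {a : Fin (p - 1) → ℤ} {θ : K}, IsPureGenerator p a θ →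
      IsPureGenerator.HasTameBasis p a θ := fun ht a θ h =>
    (h.hasWildBasis_or_hasTameBasis hp2).resolve_left fun hw =>
      ht.2 (h.isWildAt_of_hasWildBasis hp2 hw)
  obtain ⟨m, hm, θ₀, hθ₀, htop₀⟩ := hK.exists_root
  obtain ⟨a₀, ha₀, rfl⟩ := exists_stronglyCarefree hp2 hm
  have h₀ : IsPureGenerator p a₀ θ₀ := ⟨ha₀, hK.finrank_eq, hθ₀, htop₀⟩
  obtain ⟨α₀, hα₀⟩ := exists_real_pow_eq (hp.out.odd_of_ne_two (by omega))
    ((pureRadicand a₀ : ℤ) : ℝ)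
  refine ⟨?_, fun hw => ⟨h₀.fieldShape_mem_wildShapes hp2 hα₀ (hwild hw h₀),
    ⟨_, h₀.fieldShape_isRepresentedBy_wildGram hp2 hα₀ (hwild hw h₀)⟩⟩, fun ht => ?_, ?_⟩
  · exact (h₀.hasWildBasis_or_hasTameBasis hp2).imp (h₀.isWildAt_of_hasWildBasis hp2)
      (h₀.isTameAt_of_hasTameBasis hp2)
  · have ht₀ := htame ht h₀
    obtain ⟨ε, hε⟩ := IsPureGenerator.exists_int_mul_eq_one ht₀.1
    have hrep := h₀.fieldShape_isRepresentedBy_glue_denom hp2 hα₀ ht₀ hε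
    have hndvd := IsPureGenerator.not_dvd_glueCoeff ht₀.1 hε
      (y := fun k : Fin (p - 1) => pureDenom p a₀ ((k : ℕ) + 1) * ε ^ (k : ℕ))
      (fun k => by push_cast; rfl)
    have hlin := h₀.linearIndependent_gamma_sq hp2 hα₀
    exact ⟨h₀.fieldShape_mem_tameShapes hp2 hα₀ ht₀,
      ShapeSpace.isOrdinary_of_glue (i₀ := ⟨0, by omega⟩) hp2 rfl (by simp [pureDenom_one])
        hndvd hlin hrep,
      ShapeSpace.not_isOrthorhombic_of_glue (i₀ := ⟨0, by omega⟩) (by omega) rfl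
        (by simp [pureDenom_one]) hndvd hlin hrep⟩
  · intro a ha θ hθ htop α hα
    have h : IsPureGenerator p a θ := ⟨ha, hK.finrank_eq, hθ, htop⟩
    refine ⟨fun hw => ⟨h.fieldShape_isRepresentedBy_wildGram hp2 hα (hwild hw h),
      h.exists_wildGram_eq_smul hα⟩, fun ht => ⟨?_, fun ε hε => ?_⟩⟩
    · exact ((Prime.coprime_iff_not_dvd (Nat.prime_iff_prime_int.1 hp.out)).2
        (htame ht h).1).symm
    · have hεp : ((pureRadicand a : ℤ) : ZMod p) * (ε : ZMod p) = 1 := by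
        have h1 : pureRadicand a * ε ≡ 1 [ZMOD (p : ℤ)] :=
          hε.of_dvd (dvd_pow_self _ two_ne_zero)
        have h2 := (ZMod.intCast_eq_intCast_iff _ _ p).2 h1
        push_cast at h2
        exact h2
      rw [h.tameGram_eq hp.out.ne_zero]
      exact (h.fieldShape_isRepresentedBy_glue_denom hp2 hα (htame ht h) hεp).smul
        (Nat.cast_pos.2 hp.out.pos)
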